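/- Theorem 1. An algebra $L$ over a field $\mathbb F$ with bilinear product $[\,,\,]$ (not assumed associative, commutative, anticommutative or unital) is called a Lie type algebra if for all $a,b,c\in L$ there exist $\alpha,\beta\in\mathbb F$, possibly depending on $a,b,c$, such that $\alpha\neq 0$ and $$[[a,b],c]=\alpha[a,[b,c]]+\beta[[a,c],b].$$ For a subspace $I$ of $L$ put $I^{(0)}=I$ and let $I^{(k+1)}=[I^{(k)},I^{(k)}]$ be the subspace spanned by all products $[x,y]$ with $x,y\in I^{(k)}$. There exist functions $c:\mathbb N\times\mathbb N\to\mathbb N$ and $d:\mathbb N\to\mathbb N$ with the following property. Let $L$ be a Lie type algebra, possibly infinite-dimensional, over an arbitrary field $\mathbb F$, and let $\varphi$ be an automorphism of the $\mathbb F$-algebra $L$ of finite order $n\geq 1$ whose fixed-point subalgebra $C_L(\varphi)=\{x\in L\mid\varphi(x)=x\}$ has finite dimension $m$. Then $L$ has a two-sided ideal $I$ (an $\mathbb F$-subspace with $[I,L]\subseteq I$ and $[L,I]\subseteq I$) of finite codimension $\dim L/I\leq c(n,m)$ that is soluble of derived length at most $d(n)$, that is, $I^{(d(n))}=0$. -/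

import Mathlib

namespace LieType

variable {F L : Type*} [Field F] [NonUnitalNonAssocRing L] [Module F L]

/-- A Lie type algebra, with the product `[a, b]` written `a * b`. The scalars may depend on the
three elements. -/
def IsLieType (F L : Type*) [Field F] [NonUnitalNonAssocRing L] [Module F L] : Prop :=
  ∀ a b c : L, ∃ α β : F, α ≠ 0 ∧ (a * b) * c = α • (a * (b * c)) + β • ((a * c) * b)

/-- The invertible linear map `φ` is an automorphism of the algebra `L`. -/
def IsAlgAut (φ : L ≃ₗ[F] L) : Prop :=
  ∀ x y : L, φ (x * y) = φ x * φ y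

/-- The subalgebra of fixed points of an automorphism. -/
def fixedSubalgebra (φ : L ≃ₗ[F] L) (hφ : IsAlgAut φ) : NonUnitalSubalgebra F L where
  carrier := {x | φ x = x}
  zero_mem' := map_zero φ
  add_mem' {x y} (hx : φ x = x) (hy : φ y = y) := show φ (x + y) = x + y by
    rw [map_add, hx, hy]
  mul_mem' {x y} (hx : φ x = x) (hy : φ y = y) := show φ (x * y) = x * y by
    rw [hφ, hx, hy]
  smul_mem' r x (hx : φ x = x) := show φ (r • x) = r • x by
    rw [map_smul, hx]

/-- A two-sided ideal of the algebra `L`: a subspace that is closed under multiplication by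
arbitrary elements on both sides. -/
def IsIdeal (I : Submodule F L) : Prop :=
  ∀ x ∈ I, ∀ y : L, x * y ∈ I ∧ y * x ∈ I

/-- `[M, N]`: the subspace spanned by all products of an element of `M` and an element of `N`. -/
def prodSpan (M N : Submodule F L) : Submodule F L :=
  Submodule.span F {z | ∃ x ∈ M, ∃ y ∈ N, x * y = z}

/-- The derived series `M, [M, M], [[M, M], [M, M]], …`. -/
def derived (M : Submodule F L) : ℕ → Submodule F L
  | 0 => M
  | k + 1 => prodSpan (derived M k) (derived M k)

end LieType

/-! Write n = p^s q with p the characteristic exponent of F and q invertible in F, and put ψ =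
φ^(p^s). Since ψ - 1 = (φ - 1)^(p^s), the fixed space of ψ has dimension at most nm, and ψ^q = 1.

If the scalars in the Lie type identity were constant and ψ had no nonzero fixed points, Kreknin's
argument on the eigenspaces of ψ would give solubility. Both defects disappear for generic elements,
that is, elements chosen one after another, each in a subspace of bounded codimension depending on
the earlier choices. A trilinear map lying pointwise in the span of two others agrees generically
with one fixed combination of them (`Nrm.exists_trilinear_relation`). The trace 1 + ψ + … + ψ^(q-1)
takes values in the fixed space, so it vanishes on a subspace of bounded codimension. Hence for
generic letters all multilinear monomials in their ψ-images have trace zero and satisfy Jacobi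
relations whose scalars depend only on the sets of letters involved (`IsLieType.exists_gen_isGood`).
Over the algebraic closure they span an algebra graded by finite sets, and a lattice form of
Kreknin's theorem (`derivedFamily_eq_bot`, `balProd_eq_zero`) shows that balanced products of
sufficiently many generic letters vanish (`IsLieType.hyp_bal`).

It remains to pass from generic letters to arbitrary elements of an ideal (`rt_of_nodup`). This is
proved for every shape T by induction, with vanishing replaced by smallness in a filtration `Nrm`,
because the induction applies the statement to auxiliary filtrations. The letters are released from
generic to arbitrary in a derived term of an ideal, for larger and larger sets U
(`exists_mixed_step`). A monomial with both kinds of letters contains a product of a subtree w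
without letters of U and a subtree s with letters in U only. Up to small errors the operators
applied to w lie in the span of boundedly many (`exists_spanning_values`), so generic values of
shape s act as small elements beside w (`hyp_star`). Induction for s yields an ideal whose balanced
products are small beside w, and the Lie type identity carries this back to the monomial. When all
letters but one are free, the last ideal comes from `exists_ideal_of_smallOn`. All bounds depend
only on trees and levels, never on F or L. -/

namespace LieType

universe u v w

/-! ### Subspaces of bounded codimension. -/

section Codim

variable {F : Type*} [Field F] {V : Type*} [AddCommGroup V] [Module F V]

/-- The subspace `C` contains the common kernel of `c` linear functionals. -/
def CodimLE (C : Submodule F V) (c : ℕ) : Prop :=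
  ∃ g : V →ₗ[F] (Fin c → F), LinearMap.ker g ≤ C

variable {V' : Type*} [AddCommGroup V'] [Module F V']

theorem CodimLE.top : CodimLE (⊤ : Submodule F V) 0 := ⟨0, le_top⟩

theorem CodimLE.mono {C C' : Submodule F V} {c c' : ℕ} (h : CodimLE C c) (hC : C ≤ C')
    (hc : c ≤ c') : CodimLE C' c' := by
  obtain ⟨g, hg⟩ := h
  refine ⟨LinearMap.pi fun i : Fin c' => if hi : i.1 < c then
    (LinearMap.proj ⟨i.1, hi⟩).comp g else 0, ?_⟩
  intro x hx
  apply hC; apply hg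
  rw [LinearMap.mem_ker] at hx ⊢
  ext i
  have := congrFun hx ⟨i.1, i.2.trans_le hc⟩
  simpa using this

theorem CodimLE.inf {C C' : Submodule F V} {c c' : ℕ} (h : CodimLE C c) (h' : CodimLE C' c') :
    CodimLE (C ⊓ C') (c + c') := by
  obtain ⟨g, hg⟩ := h
  obtain ⟨g', hg'⟩ := h'
  refine ⟨LinearMap.pi fun i : Fin (c + c') => Fin.addCases (motive := fun _ => V →ₗ[F] F)
    (fun i => (LinearMap.proj i).comp g) (fun i => (LinearMap.proj i).comp g') i, ?_⟩
  intro x hx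
  rw [LinearMap.mem_ker] at hx
  refine ⟨hg ?_, hg' ?_⟩ <;> rw [LinearMap.mem_ker] <;> ext i
  · have := congrFun hx (Fin.castAdd c' i)
    simpa using this
  · have := congrFun hx (Fin.natAdd c i)
    simpa using this

theorem CodimLE.comap {C : Submodule F V'} {c : ℕ} (h : CodimLE C c) (T : V →ₗ[F] V') :
    CodimLE (C.comap T) c := by
  obtain ⟨g, hg⟩ := h
  exact ⟨g.comp T, fun x hx => hg hx⟩

/-- A section of `g` over its range, extended linearly to `Fin c → F`, gives one representative per
coordinate. It inverts `g` only on the range, which is all that is used. -/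
theorem CodimLE.exists_reps {C : Submodule F V} {c : ℕ} (h : CodimLE C c) :
    ∃ t : Fin c → V, ∀ x, ∃ ξ : Fin c → F, x - ∑ i, ξ i • t i ∈ C := by
  obtain ⟨g, hg⟩ := h
  obtain ⟨s, hs⟩ := g.rangeRestrict.exists_rightInverse_of_surjective
    (LinearMap.range_eq_top.2 g.surjective_rangeRestrict)
  obtain ⟨s', hs'⟩ := LinearMap.exists_extend s
  refine ⟨fun i => s' (Pi.single i 1), fun x => ⟨g x, hg ?_⟩⟩
  have h1 : ∑ i, g x i • s' (Pi.single i 1) = s' (g x) := by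
    conv_rhs => rw [← Finset.univ_sum_single (g x), map_sum]
    refine Finset.sum_congr rfl fun i _ => ?_
    rw [← map_smul, ← Pi.single_smul, smul_eq_mul, mul_one]
  have h2 : s' (g x) = s (g.rangeRestrict x) := by
    rw [← hs']; rfl
  have h3 : g.rangeRestrict (s (g.rangeRestrict x)) = g.rangeRestrict x :=
    LinearMap.congr_fun hs _
  rw [LinearMap.mem_ker, map_sub, h1, h2, sub_eq_zero]
  exact (congrArg Subtype.val h3).symm

theorem CodimLE.of_ker_le [Module.Finite F V'] {T : V →ₗ[F] V'} {C : Submodule F V} {c : ℕ}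
    (hc : Module.finrank F V' ≤ c) (h : LinearMap.ker T ≤ C) : CodimLE C c := by
  let e := (Module.finBasis F V').equivFun
  refine CodimLE.mono (c := Module.finrank F V') ⟨e.toLinearMap.comp T, ?_⟩ le_rfl hc
  intro x hx
  apply h
  rw [LinearMap.mem_ker] at hx ⊢
  exact e.map_eq_zero_iff.1 hx

theorem codimLE_iff_rank {C : Submodule F V} {c : ℕ} :
    CodimLE C c ↔ Module.rank F (V ⧸ C) ≤ c := by
  constructor
  · intro h
    obtain ⟨t, ht⟩ := h.exists_reps
    have : Submodule.span F (Set.range fun i => C.mkQ (t i)) = ⊤ := by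
      rw [eq_top_iff]
      rintro y -
      obtain ⟨x, rfl⟩ := C.mkQ_surjective y
      obtain ⟨ξ, hξ⟩ := ht x
      have : C.mkQ x = ∑ i, ξ i • C.mkQ (t i) := by
        rw [← sub_eq_zero, ← (Submodule.Quotient.mk_eq_zero C).2 hξ]
        simp only [← C.mkQ_apply, map_sub, map_sum, map_smul]
      rw [this]
      exact Submodule.sum_mem _ fun i _ => Submodule.smul_mem _ _
        (Submodule.subset_span ⟨i, rfl⟩)
    have h1 := rank_span_le (R := F) (Set.range fun i => C.mkQ (t i))
    rw [this, rank_top] at h1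
    refine h1.trans ?_
    refine (Cardinal.mk_range_le_lift.{0} (f := fun i => C.mkQ (t i)) |> fun h => ?_)
    simpa using h
  · intro h
    have : Module.Finite F (V ⧸ C) :=
      Module.rank_lt_aleph0_iff.1 (h.trans_lt (Cardinal.natCast_lt_aleph0))
    refine CodimLE.of_ker_le (T := C.mkQ) ?_ (by simp)
    rw [← Module.finrank_eq_rank] at h
    exact_mod_cast h

theorem CodimLE.map_subtype {B : Submodule F V} {C : Submodule F B} {b c : ℕ}
    (hB : CodimLE B b) (hC : CodimLE C c) : CodimLE (C.map B.subtype) (b + c) := by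
  obtain ⟨g, hg⟩ := hC
  obtain ⟨g', hg'⟩ := LinearMap.exists_extend g
  refine (hB.inf (C' := LinearMap.ker g') ⟨g', le_rfl⟩).mono ?_ le_rfl
  rintro x ⟨hx, hx'⟩
  refine ⟨⟨x, hx⟩, hg ?_, rfl⟩
  rw [LinearMap.mem_ker, ← hg']
  exact hx'

theorem CodimLE.biInf {ι : Type*} (s : Finset ι) (C : ι → Submodule F V) (c : ℕ)
    (h : ∀ i ∈ s, CodimLE (C i) c) : CodimLE (⨅ i ∈ s, C i) (s.card * c) := by
  classical
  induction s using Finset.induction_on with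
  | empty => simpa using CodimLE.top
  | insert a s ha ih =>
    rw [Finset.iInf_insert, Finset.card_insert_of_notMem ha]
    refine ((h a (by simp)).inf (ih fun i hi => h i (by simp [hi]))).mono le_rfl ?_
    rw [add_mul, one_mul, add_comm]

end Codim

/-! ### Smallness filtrations and pointwise dependent linear maps. -/

/-- A filtration of a vector space by notions of smallness. -/
structure Nrm (F E : Type*) [Field F] [AddCommGroup E] [Module F E] where
  S : ℕ → E → Prop
  mono : ∀ {c c' x}, c ≤ c' → S c x → S c' x
  zero : S 0 0
  add : ∀ {c c' x y}, S c x → S c' y → S (c + c') (x + y)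
  smul : ∀ {c x} (r : F), S c x → S c (r • x)

namespace Nrm

variable {F : Type*} [Field F] {E : Type*} [AddCommGroup E] [Module F E]
  {B : Type*} [AddCommGroup B] [Module F B]

variable (N : Nrm F E)

theorem zero' (c : ℕ) : N.S c 0 := N.mono (Nat.zero_le c) N.zero

variable {N}

theorem neg {c : ℕ} {x : E} (h : N.S c x) : N.S c (-x) := by
  simpa using N.smul (-1 : F) h

theorem sub {c c' : ℕ} {x y : E} (h : N.S c x) (h' : N.S c' y) : N.S (c + c') (x - y) := by
  rw [sub_eq_add_neg]; exact N.add h (neg h')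

theorem of_smul {c : ℕ} {x : E} {r : F} (hr : r ≠ 0) (h : N.S c (r • x)) : N.S c x := by
  simpa [smul_smul, inv_mul_cancel₀ hr] using N.smul r⁻¹ h

theorem sum {ι : Type*} (s : Finset ι) {c : ℕ} {x : ι → E} (h : ∀ i ∈ s, N.S c (x i)) :
    N.S (s.card * c) (∑ i ∈ s, x i) := by
  classical
  induction s using Finset.induction_on with
  | empty => simpa using N.zero
  | insert a s ha ih =>
    rw [Finset.sum_insert ha, Finset.card_insert_of_notMem ha]
    refine N.mono ?_ (N.add (h a (by simp)) (ih fun i hi => h i (by simp [hi])))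
    rw [add_mul, one_mul, add_comm]

variable (N)

/-- Smallness modulo a subspace. -/
def mod (W : Submodule F E) : Nrm F E where
  S c x := ∃ w ∈ W, N.S c (x - w)
  mono h := fun ⟨w, hw, hx⟩ => ⟨w, hw, N.mono h hx⟩
  zero := ⟨0, W.zero_mem, by simpa using N.zero⟩
  add := fun ⟨w, hw, hx⟩ ⟨w', hw', hx'⟩ => ⟨w + w', W.add_mem hw hw', by
    rw [add_sub_add_comm]; exact N.add hx hx'⟩
  smul r := fun ⟨w, hw, hx⟩ => ⟨r • w, W.smul_mem r hw, by
    rw [← smul_sub]; exact N.smul r hx⟩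

/-- A linear map is small if its values are small on a subspace of small codimension. -/
def hom (B : Type*) [AddCommGroup B] [Module F B] : Nrm F (B →ₗ[F] E) where
  S c T := ∃ C : Submodule F B, CodimLE C c ∧ ∀ b ∈ C, N.S c (T b)
  mono h := fun ⟨C, hC, hT⟩ => ⟨C, hC.mono le_rfl h, fun b hb => N.mono h (hT b hb)⟩
  zero := ⟨⊤, CodimLE.top, fun _ _ => N.zero⟩
  add := fun ⟨C, hC, hT⟩ ⟨C', hC', hT'⟩ => ⟨C ⊓ C', hC.inf hC', fun b hb =>
    N.add (hT b hb.1) (hT' b hb.2)⟩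
  smul r := fun ⟨C, hC, hT⟩ => ⟨C, hC, fun b hb => N.smul r (hT b hb)⟩

variable (F E) in
/-- The filtration whose only small vector is zero. -/
def exact : Nrm F E where
  S _ x := x = 0
  mono _ h := h
  zero := rfl
  add h h' := by rw [h, h', add_zero]
  smul r h := by rw [h, smul_zero]

/-- If `W` has no nonzero vector of level `3 * c`, the approximant of `T b` in `W` is unique, hence
linear in `b`, and its kernel has codimension at most `dim W`. Otherwise such a vector is absorbed
into the error, which lowers the dimension at the cost of a factor 4. -/
theorem small_of_small_mod (k : ℕ) : ∀ (c : ℕ) (W : Submodule F E) [Module.Finite F W]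
    (_ : Module.finrank F W ≤ k) (T : B →ₗ[F] E) (_ : ∀ b, ∃ w ∈ W, N.S c (T b - w)),
    ∃ C : Submodule F B, CodimLE C k ∧ ∀ b ∈ C, N.S (4 ^ k * c) (T b) := by
  induction k with
  | zero =>
    intro c W _ hW T hT
    have hW' : W = ⊥ := Submodule.finrank_eq_zero.1 (Nat.le_zero.1 hW)
    refine ⟨⊤, CodimLE.top, fun b _ => ?_⟩
    obtain ⟨w, hw, h⟩ := hT b
    rw [hW', Submodule.mem_bot] at hw
    simpa [hw] using h
  | succ k ih =>
    intro c W _ hW T hT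
    by_cases hw : ∃ w ∈ W, w ≠ 0 ∧ N.S (3 * c) w
    · obtain ⟨w, hwW, hw0, hw⟩ := hw
      obtain ⟨W', hW'⟩ := (Submodule.span F {(⟨w, hwW⟩ : W)}).exists_isCompl
      have hfin := Submodule.finrank_add_eq_of_isCompl hW'
      rw [finrank_span_singleton (by simpa using hw0)] at hfin
      have hmap : Module.finrank F (W'.map W.subtype) = Module.finrank F W' :=
        LinearEquiv.finrank_eq (Submodule.equivMapOfInjective _ W.subtype_injective W').symm
      obtain ⟨C, hC, h⟩ := ih (4 * c) (W'.map W.subtype) (by omega) T (by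
        intro b
        obtain ⟨y, hy, hyb⟩ := hT b
        have : (⟨y, hy⟩ : W) ∈ Submodule.span F {(⟨w, hwW⟩ : W)} ⊔ W' := by
          rw [hW'.sup_eq_top]; trivial
        obtain ⟨a, ha, a', ha', hs⟩ := Submodule.mem_sup.1 this
        obtain ⟨r, rfl⟩ := Submodule.mem_span_singleton.1 ha
        refine ⟨a', ⟨a', ha', rfl⟩, ?_⟩
        have hs' : r • w + (a' : E) = y := congrArg Subtype.val hs
        have : T b - (a' : E) = (T b - y) + r • w := by rw [← hs']; abel
        rw [this]
        exact N.mono (by omega) (N.add hyb (N.smul r hw)))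
      refine ⟨C, hC.mono le_rfl (Nat.le_succ k), fun b hb => ?_⟩
      have := h b hb
      rwa [← mul_assoc, ← pow_succ] at this
    · push Not at hw
      choose f hfW hf using hT
      have hz : ∀ w ∈ W, N.S (3 * c) w → w = 0 := fun w hwW h => by
        by_contra h0
        exact hw w hwW h0 h
      let g : B →ₗ[F] W :=
        { toFun := fun b => ⟨f b, hfW b⟩
          map_add' := fun b b' => by
            apply Subtype.ext
            rw [← sub_eq_zero]
            apply hz _ (W.sub_mem (hfW _) (W.add_mem (hfW _) (hfW _)))
            have : f (b + b') - (f b + f b') =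
                (T b - f b) + (T b' - f b') - (T (b + b') - f (b + b')) := by
              rw [map_add]; abel
            rw [this]
            exact N.mono (by omega) (sub (N.add (hf b) (hf b')) (hf _))
          map_smul' := fun r b => by
            apply Subtype.ext
            rw [← sub_eq_zero]
            apply hz _ (W.sub_mem (hfW _) (W.smul_mem _ (hfW _)))
            have : f (r • b) - r • f b =
                r • (T b - f b) - (T (r • b) - f (r • b)) := by
              rw [map_smul, smul_sub]; abel
            change N.S (3 * c) (f (r • b) - r • f b)
            rw [this]
            exact N.mono (by omega) (sub (N.smul r (hf b)) (hf _)) }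
      refine ⟨LinearMap.ker g, CodimLE.of_ker_le hW le_rfl, fun b hb => ?_⟩
      have hb0 : f b = 0 := congrArg Subtype.val (LinearMap.mem_ker.1 hb)
      have := hf b
      rw [hb0, sub_zero] at this
      exact N.mono (Nat.le_mul_of_pos_left c (by positivity)) this

theorem hom_small_of_mod {k c b₀ e : ℕ} {W : Submodule F E} [Module.Finite F W]
    (hW : Module.finrank F W ≤ k) {T : B →ₗ[F] E} {B₀ : Submodule F B} (hB : CodimLE B₀ b₀)
    (hT : ∀ b ∈ B₀, (N.mod W).S c (T b)) (he : b₀ + k ≤ e) (he' : 4 ^ k * c ≤ e) :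
    (N.hom B).S e T := by
  obtain ⟨C, hC, h⟩ := N.small_of_small_mod k c W hW (T.comp B₀.subtype) (fun b => hT b b.2)
  refine ⟨C.map B₀.subtype, (hB.map_subtype hC).mono le_rfl he, ?_⟩
  rintro _ ⟨b, hb, rfl⟩
  exact N.mono he' (h b hb)

theorem exists_not_small {θ c : ℕ} {X : B →ₗ[F] E} {B₀ : Submodule F B} (hB : CodimLE B₀ c)
    (hc : c ≤ θ) (h : ¬ (N.hom B).S θ X) : ∃ b ∈ B₀, ¬ N.S θ (X b) := by
  by_contra! h'
  exact h ⟨B₀, hB.mono le_rfl hc, h'⟩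

theorem finrank_span_singleton_le_one (x : E) : Module.finrank F (Submodule.span F {x}) ≤ 1 := by
  simpa using finrank_span_le_card (R := F) ({x} : Set E)

theorem not_both {p q : F} (h : p ≠ 0 ∨ q ≠ 0) (hq : q = 0) : p ≠ 0 := by
  rcases h with h | h
  · exact h
  · exact absurd hq h

/-- This is the approximate form of the fact that a map which is pointwise a multiple of `X` is a
multiple of `X`. After normalising at a `b₀` with `X b₀` not small, comparison of `b` with `b + b₀`
shows that `Z'` is small at `b` or `X b` is nearly a multiple of `X b₀`. Translating by a `b₁`
outside the second case removes that case. -/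
theorem exists_smul_of_local {s : ℕ} {X Z : B →ₗ[F] E} {B₀ : Submodule F B}
    (hB : CodimLE B₀ s) (h : ∀ b ∈ B₀, ∃ x : F, N.S s (Z b - x • X b)) :
    ∃ x : F, (N.hom B).S (26 * s + 1) (Z - x • X) := by
  by_cases hX : (N.hom B).S (25 * s + 1) X
  · refine ⟨0, ?_⟩
    obtain ⟨C, hC, hCX⟩ := hX
    refine ⟨B₀ ⊓ C, (hB.inf hC).mono le_rfl (by omega), fun b hb => ?_⟩
    obtain ⟨x, hx⟩ := h b hb.1
    have := N.add hx (N.smul x (hCX b hb.2))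
    rw [sub_add_cancel] at this
    simpa using N.mono (by omega) this
  obtain ⟨b₀, hb₀, hXb₀⟩ := N.exists_not_small hB (by omega) hX
  obtain ⟨x₀, hx₀⟩ := h b₀ hb₀
  refine ⟨x₀, ?_⟩
  set Z' := Z - x₀ • X with hZ'
  have h' : ∀ b ∈ B₀, ∃ x : F, N.S s (Z' b - x • X b) := by
    intro b hb
    obtain ⟨x, hx⟩ := h b hb
    refine ⟨x - x₀, ?_⟩
    convert hx using 1
    simp only [hZ', LinearMap.sub_apply, LinearMap.smul_apply]; module
  have hZb₀ : N.S s (Z' b₀) := hx₀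
  have key : ∀ b ∈ B₀, N.S (2 * s) (Z' b) ∨ (N.mod (Submodule.span F {X b₀})).S (3 * s) (X b) := by
    intro b hb
    obtain ⟨x, hx⟩ := h' b hb
    obtain ⟨y, hy⟩ := h' (b + b₀) (B₀.add_mem hb hb₀)
    have h3 : N.S (3 * s) ((x - y) • X b - y • X b₀) := by
      have := N.mono (c' := 3 * s) (by omega) (sub (sub hy hx) hZb₀)
      convert this using 1
      simp only [map_add]; module
    by_cases hy0 : y = 0
    · left
      subst hy0
      have := N.mono (c' := 2 * s) (by omega) (sub hy hZb₀)
      simpa using this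
    by_cases hxy : x = y
    · exfalso
      subst hxy
      apply hXb₀
      rw [sub_self, zero_smul, zero_sub] at h3
      have := of_smul hy0 (by simpa using neg h3)
      exact N.mono (by omega) this
    · right
      have hxy' : x - y ≠ 0 := sub_ne_zero.2 hxy
      refine ⟨((x - y)⁻¹ * y) • X b₀, Submodule.smul_mem _ _
        (Submodule.mem_span_singleton_self _), ?_⟩
      convert N.smul (x - y)⁻¹ h3 using 1
      rw [smul_sub, smul_smul, smul_smul, inv_mul_cancel₀ hxy', one_smul]
  obtain ⟨b₁, hb₁, hXb₁⟩ : ∃ b ∈ B₀, ¬ (N.mod (Submodule.span F {X b₀})).S (6 * s) (X b) := by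
    by_contra! hcon
    exact hX (N.hom_small_of_mod (k := 1) (finrank_span_singleton_le_one _) hB hcon
      (by omega) (by omega))
  have hZb₁ : N.S (2 * s) (Z' b₁) :=
    (key b₁ hb₁).resolve_right fun hc => hXb₁ ((N.mod _).mono (by omega) hc)
  refine ⟨B₀, hB.mono le_rfl (by omega), fun b hb => ?_⟩
  rcases key b hb with hb' | hb'
  · exact N.mono (by omega) hb'
  · rcases key (b + b₁) (B₀.add_mem hb hb₁) with h2 | h2
    · rw [map_add] at h2
      have := sub h2 hZb₁
      rw [add_sub_cancel_right] at this
      exact N.mono (by omega) this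
    · exfalso
      apply hXb₁
      rw [map_add] at h2
      have := (N.mod (Submodule.span F {X b₀})).mono (c' := 6 * s) (by omega) (sub h2 hb')
      rwa [add_sub_cancel_left] at this

/-- Let `X a` be not small and correct `Y` by a multiple of `X` so that it becomes small at `a`. The
relations at `b` and `b + a` then force the corrected map to be small modulo the line of `X a`, and
a one-dimensional space of values is removed by one more linear condition. -/
theorem exists_dependent_of_local {s : ℕ} {X Y : B →ₗ[F] E} {B₀ : Submodule F B}
    (hB : CodimLE B₀ s)
    (h : ∀ b ∈ B₀, ∃ p q : F, (p ≠ 0 ∨ q ≠ 0) ∧ N.S s (p • X b + q • Y b)) :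
    ∃ p q : F, (p ≠ 0 ∨ q ≠ 0) ∧ (N.hom B).S (16 * s + 1) (p • X + q • Y) := by
  by_cases hX : (N.hom B).S (3 * s) X
  · exact ⟨1, 0, Or.inl one_ne_zero, by
      simpa using (N.hom B).mono (c' := 16 * s + 1) (by omega) hX⟩
  obtain ⟨a, ha, hXa⟩ := N.exists_not_small hB (by omega) hX
  obtain ⟨p₀, q₀, hpq₀, h₀⟩ := h a ha
  have hq₀ : q₀ ≠ 0 := fun hq => hXa (N.mono (c := s) (by omega)
    (of_smul (not_both hpq₀ hq) (by simpa [hq] using h₀)))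
  refine ⟨q₀⁻¹ * p₀, 1, Or.inr one_ne_zero, ?_⟩
  set Y' := (q₀⁻¹ * p₀) • X + (1 : F) • Y with hY'
  have hYa : N.S s (Y' a) := by
    convert N.smul q₀⁻¹ h₀ using 1
    simp only [hY', LinearMap.add_apply, LinearMap.smul_apply, smul_add, smul_smul,
      inv_mul_cancel₀ hq₀]
  have h' : ∀ b ∈ B₀, ∃ p q : F, (p ≠ 0 ∨ q ≠ 0) ∧ N.S s (p • X b + q • Y' b) := by
    intro b hb
    obtain ⟨p, q, hpq, hs⟩ := h b hb
    refine ⟨p - q * (q₀⁻¹ * p₀), q, ?_, ?_⟩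
    · by_cases hq : q = 0
      · left; simpa [hq] using not_both hpq hq
      · exact Or.inr hq
    · convert hs using 1
      simp only [hY', LinearMap.add_apply, LinearMap.smul_apply]; module
  refine N.hom_small_of_mod (k := 1) (W := Submodule.span F {X a}) (c := 4 * s)
    (finrank_span_singleton_le_one _) hB (fun b hb => ?_) (by omega) (by omega)
  have aux : ∀ (r : F) (c : ℕ), c ≤ 4 * s → N.S c (Y' b - r • X a) →
      (N.mod (Submodule.span F {X a})).S (4 * s) (Y' b) := fun r c hc hr =>
    ⟨r • X a, Submodule.smul_mem _ _ (Submodule.mem_span_singleton_self _), N.mono hc hr⟩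
  obtain ⟨p, q, hpq, hs⟩ := h' b hb
  obtain ⟨p', q', hpq', hs'⟩ := h' (b + a) (B₀.add_mem hb ha)
  have hs₂ : N.S (2 * s) (p' • X b + p' • X a + q' • Y' b) := by
    have := N.mono (c' := 2 * s) (by omega) (sub hs' (N.smul q' hYa))
    convert this using 1
    simp only [map_add]; module
  by_cases hq : q = 0
  · have hXb : N.S s (X b) := of_smul (not_both hpq hq) (by simpa [hq] using hs)
    by_cases hq' : q' = 0
    · exfalso
      apply hXa
      have h1 : N.S s (X (b + a)) := of_smul (not_both hpq' hq') (by simpa [hq'] using hs')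
      have := sub h1 hXb
      rw [map_add, add_sub_cancel_left] at this
      exact N.mono (by omega) this
    · refine aux (-(q'⁻¹ * p')) (2 * s + s) (by omega) ?_
      convert N.smul q'⁻¹ (sub hs₂ (N.smul p' hXb)) using 1
      simp only [smul_sub, smul_add, smul_smul, inv_mul_cancel₀ hq']; module
  · have hYb : N.S s (Y' b - (-(q⁻¹ * p)) • X b) := by
      convert N.smul q⁻¹ hs using 1
      simp only [smul_add, smul_smul, inv_mul_cancel₀ hq]; module
    by_cases hq' : q' = 0
    · have h1 : N.S s (X (b + a)) := of_smul (not_both hpq' hq') (by simpa [hq'] using hs')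
      refine aux (q⁻¹ * p) (s + s) (by omega) ?_
      convert sub hYb (N.smul (q⁻¹ * p) h1) using 1
      simp only [map_add]; module
    · generalize -(q⁻¹ * p) = y at hYb
      have hY2 : N.S (2 * s) (Y' b - (-(q'⁻¹ * p')) • (X b + X a)) := by
        convert N.smul q'⁻¹ hs₂ using 1
        simp only [smul_add, smul_smul, inv_mul_cancel₀ hq']; module
      generalize -(q'⁻¹ * p') = y' at hY2
      by_cases hyy : y = y'
      · subst hyy
        by_cases hy0 : y = 0
        · subst hy0
          exact aux 0 s (by omega) (by simpa using hYb)
        · exfalso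
          apply hXa
          refine of_smul hy0 ?_
          convert sub hYb hY2 using 1
          · omega
          · module
      · have hd : y - y' ≠ 0 := sub_ne_zero.2 hyy
        have h3 : N.S (s + 2 * s) (X b - ((y - y')⁻¹ * y') • X a) := by
          convert N.smul (-(y - y')⁻¹) (sub hYb hY2) using 1
          have : X b = ((y - y')⁻¹ * (y - y')) • X b := by rw [inv_mul_cancel₀ hd, one_smul]
          conv_lhs => rw [this]
          module
        refine aux (y * ((y - y')⁻¹ * y')) (s + (s + 2 * s)) (by omega) ?_
        convert N.add hYb (N.smul y h3) using 1
        module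

/-- If some nontrivial combination of `X` and `Y` is small, one of the two is redundant and the
one-map case applies. Otherwise there are always points where `X` and `Y` stay independent modulo a
given space of dimension 4, and coefficients can be compared through such points. -/
theorem exists_smul_add_smul_of_local {s : ℕ} {X Y Z : B →ₗ[F] E} {B₀ : Submodule F B}
    (hB : CodimLE B₀ s) (h : ∀ b ∈ B₀, ∃ x y : F, N.S s (Z b - x • X b - y • Y b)) :
    ∃ x y : F, (N.hom B).S (400000 * (s + 1)) (Z - x • X - y • Y) := by
  by_cases hdep : ∃ p q : F, (p ≠ 0 ∨ q ≠ 0) ∧ (N.hom B).S (13000 * s + 260) (p • X + q • Y)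
  · obtain ⟨p, q, hpq, C, hC, hs⟩ := hdep
    by_cases hq : q = 0
    · have hp := not_both hpq hq
      obtain ⟨y, hy⟩ := N.exists_smul_of_local (s := s + (13000 * s + 260)) (X := Y) (Z := Z)
        (hB.inf hC) (by
        rintro b ⟨hb, hb'⟩
        obtain ⟨x, y, hxy⟩ := h b hb
        refine ⟨y, ?_⟩
        have h1 := hs b hb'
        simp only [hq, zero_smul, add_zero, LinearMap.smul_apply] at h1
        convert N.add hxy (N.smul x (of_smul hp h1)) using 1
        module)
      exact ⟨0, y, by simpa using (N.hom B).mono (by omega) hy⟩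
    · obtain ⟨x, hx⟩ := N.exists_smul_of_local (s := s + (13000 * s + 260)) (X := X) (Z := Z)
        (hB.inf hC) (by
        rintro b ⟨hb, hb'⟩
        obtain ⟨x, y, hxy⟩ := h b hb
        refine ⟨x - y * (q⁻¹ * p), ?_⟩
        have h1 := hs b hb'
        simp only [LinearMap.add_apply, LinearMap.smul_apply] at h1
        convert N.add hxy (N.smul (y * q⁻¹) h1) using 1
        have : Y b = (q⁻¹ * q) • Y b := by rw [inv_mul_cancel₀ hq, one_smul]
        rw [smul_add, smul_smul, smul_smul, mul_assoc y q⁻¹ q, inv_mul_cancel₀ hq]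
        module)
      exact ⟨x, 0, by simpa using (N.hom B).mono (by omega) hx⟩
  -- Dependence modulo `W` at level `3 * s` gives level `48 * s + 1`; removing `W` multiplies by `4
  -- ^ 4`, which stays below `13000 * s + 260`.
  have indep : ∀ (W : Submodule F E) [Module.Finite F W], Module.finrank F W ≤ 4 →
      ∃ b ∈ B₀, ∀ p q : F, (N.mod W).S (3 * s) (p • X b + q • Y b) → p = 0 ∧ q = 0 := by
    intro W _ hW
    by_contra! hcon
    obtain ⟨p, q, hpq, C, hC, hs⟩ := (N.mod W).exists_dependent_of_local (s := 3 * s) (X := X)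
      (Y := Y) (hB.mono le_rfl (by omega)) (by
        intro b hb
        obtain ⟨p, q, hm, hpq⟩ := hcon b hb
        exact ⟨p, q, by
          by_cases hp : p = 0
          · exact Or.inr (hpq hp)
          · exact Or.inl hp, hm⟩)
    exact hdep ⟨p, q, hpq, N.hom_small_of_mod (k := 4) hW hC hs (by omega) (by omega)⟩
  obtain ⟨b₀, hb₀, hind₀⟩ := indep ⊥ (by simp)
  obtain ⟨x₀, y₀, h₀⟩ := h b₀ hb₀
  refine ⟨x₀, y₀, ?_⟩
  set Z' := Z - x₀ • X - y₀ • Y with hZ'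
  have hZb₀ : N.S s (Z' b₀) := h₀
  have h' : ∀ b ∈ B₀, ∃ x y : F, N.S s (Z' b - x • X b - y • Y b) := by
    intro b hb
    obtain ⟨x, y, hxy⟩ := h b hb
    refine ⟨x - x₀, y - y₀, ?_⟩
    convert hxy using 1
    simp only [hZ', LinearMap.sub_apply, LinearMap.smul_apply]; module
  refine ⟨B₀, hB.mono le_rfl (by omega), fun b hb => ?_⟩
  have hWfin : Module.finrank F (Submodule.span F (Set.range ![X b₀, Y b₀, X b, Y b])) ≤ 4 :=
    finrank_range_le_card (R := F) ![X b₀, Y b₀, X b, Y b]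
  have hmem : ∀ i, ![X b₀, Y b₀, X b, Y b] i ∈
      Submodule.span F (Set.range ![X b₀, Y b₀, X b, Y b]) :=
    fun i => Submodule.subset_span ⟨i, rfl⟩
  have hfin : Module.Finite F (Submodule.span F (Set.range ![X b₀, Y b₀, X b, Y b])) :=
    Module.Finite.span_of_finite F (Set.finite_range _)
  obtain ⟨W, hW, hW', m0, m1, m2, m3⟩ : ∃ (W : Submodule F E) (_ : Module.Finite F W),
      Module.finrank F W ≤ 4 ∧ X b₀ ∈ W ∧ Y b₀ ∈ W ∧ X b ∈ W ∧ Y b ∈ W :=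
    ⟨_, hfin, hWfin, hmem 0, hmem 1, hmem 2, hmem 3⟩
  -- `b₁` is independent of both `b₀` and `b`: comparison with `b₀` makes `Z' b₁` small, then
  -- comparison with `b` makes `Z' b` small.
  obtain ⟨b₁, hb₁, hind₁⟩ := indep W hW'
  have hZb₁ : N.S s (Z' b₁) := by
    obtain ⟨x₁, y₁, h₁⟩ := h' b₁ hb₁
    obtain ⟨x, y, hxy⟩ := h' (b₀ + b₁) (B₀.add_mem hb₀ hb₁)
    have h3 : N.S (3 * s) ((x₁ - x) • X b₁ + (y₁ - y) • Y b₁ - (x • X b₀ + y • Y b₀)) := by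
      convert N.mono (c' := 3 * s) (by omega) (sub (sub hxy h₁) hZb₀) using 1
      simp only [map_add]; module
    obtain ⟨e1, e2⟩ := hind₁ _ _ ⟨_, W.add_mem (W.smul_mem x m0) (W.smul_mem y m1), h3⟩
    obtain ⟨f1, f2⟩ := hind₀ x y ⟨0, Submodule.zero_mem _, by
      rw [e1, e2] at h3
      simpa using neg h3⟩
    rw [f1, sub_zero] at e1
    rw [f2, sub_zero] at e2
    simpa [e1, e2] using h₁
  obtain ⟨x', y', hb'⟩ := h' b hb
  obtain ⟨x, y, hxy⟩ := h' (b + b₁) (B₀.add_mem hb hb₁)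
  have h3 : N.S (3 * s) (x • X b₁ + y • Y b₁ - ((x' - x) • X b + (y' - y) • Y b)) := by
    convert N.mono (c' := 3 * s) (by omega) (neg (sub (sub hxy hb') hZb₁)) using 1
    simp only [map_add]; module
  obtain ⟨e1, e2⟩ := hind₁ _ _ ⟨_, W.add_mem (W.smul_mem _ m2) (W.smul_mem _ m3), h3⟩
  rw [e1, e2] at hxy
  have := sub hxy hZb₁
  simp only [zero_smul, sub_zero, map_add, add_sub_cancel_right] at this
  exact N.mono (by omega) this

theorem exists_trilinear_relation {A C : Type*} [AddCommGroup A] [Module F A]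
    [AddCommGroup C] [Module F C] (X Y Z : A →ₗ[F] B →ₗ[F] C →ₗ[F] E)
    (h : ∀ a b c, ∃ x y : F, Z a b c = x • X a b c + y • Y a b c) :
    ∃ x y : F, ((((exact F E).hom C).hom B).hom A).S (10 ^ 18) (Z - x • X - y • Y) := by
  -- The two-map lemma is applied once per argument, the filtration growing by one `hom` each time.
  -- Starting from `s = 0`, the levels 400000 and 400000 * 400001 lead to a third one below `10 ^
  -- 18`.
  have h1 : ∀ a b, ∃ x y : F, ((exact F E).hom C).S 400000
      (Z a b - x • X a b - y • Y a b) := fun a b =>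
    (exact F E).exists_smul_add_smul_of_local (s := 0) (B₀ := ⊤) CodimLE.top fun c _ => by
      obtain ⟨x, y, hxy⟩ := h a b c
      refine ⟨x, y, ?_⟩
      change _ = _
      rw [hxy]; module
  have h2 : ∀ a, ∃ x y : F, (((exact F E).hom C).hom B).S (400000 * 400001)
      (Z a - x • X a - y • Y a) := fun a =>
    ((exact F E).hom C).exists_smul_add_smul_of_local (s := 400000) (B₀ := ⊤)
      (CodimLE.top.mono le_rfl (by omega)) fun b _ => h1 a b
  obtain ⟨x, y, h3⟩ := (((exact F E).hom C).hom B).exists_smul_add_smul_of_local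
    (s := 400000 * 400001) (B₀ := ⊤) (CodimLE.top.mono le_rfl (by omega)) fun a _ => h2 a
  exact ⟨x, y, Nrm.mono _ (by norm_num) h3⟩

end Nrm

end LieType


namespace LieType

-- Monomials as labelled trees, and the contexts around a subtree.

universe u v

/-- Nonassociative monomials with labelled leaves, without a choice of orientations. -/
inductive Tr
  | leaf (i : ℕ) : Tr
  | node (s t : Tr) : Tr

namespace Tr

/-- The list of labels of a tree. -/
def leaves : Tr → List ℕ
  | leaf i => [i]
  | node s t => s.leaves ++ t.leaves

/-- The height of a tree. -/
def height : Tr → ℕ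
  | leaf _ => 0
  | node s t => max s.height t.height + 1

/-- The number of orientations of a tree. -/
def count : Tr → ℕ
  | leaf _ => 1
  | node s t => s.count * (t.count * 2)

theorem leaves_ne_nil : ∀ t : Tr, t.leaves ≠ []
  | leaf _ => by simp [leaves]
  | node s t => by simp [leaves, leaves_ne_nil s]

end Tr

section Eval

variable {F : Type*} [Field F] {L : Type*} [NonUnitalNonAssocRing L]

/-- The values of a tree under all choices of orientations of the products. -/
def evl (L : Type*) [NonUnitalNonAssocRing L] : Tr → List ((ℕ → L) → L)
  | .leaf i => [fun x => x i]
  | .node s t => (evl L s).flatMap fun f => (evl L t).flatMap fun g =>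
      [fun x => f x * g x, fun x => g x * f x]

theorem mem_evl_leaf {i : ℕ} {f : (ℕ → L) → L} : f ∈ evl L (.leaf i) ↔ f = fun x => x i := by
  simp [evl]

theorem mem_evl_node {s t : Tr} {h : (ℕ → L) → L} :
    h ∈ evl L (.node s t) ↔ ∃ f ∈ evl L s, ∃ g ∈ evl L t,
      h = (fun x => f x * g x) ∨ h = fun x => g x * f x := by
  simp [evl]

theorem length_evl (t : Tr) : (evl L t).length = t.count := by
  induction t with
  | leaf i => rfl
  | node s t hs ht => simp [evl, Tr.count, List.length_flatMap, hs, ht]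

theorem evl_congr {t : Tr} {f : (ℕ → L) → L} (hf : f ∈ evl L t) {x y : ℕ → L}
    (h : ∀ i ∈ t.leaves, x i = y i) : f x = f y := by
  induction t generalizing f with
  | leaf i => rw [mem_evl_leaf] at hf; subst hf; exact h i (by simp [Tr.leaves])
  | node s t hs ht =>
    obtain ⟨p, hp, q, hq, rfl | rfl⟩ := mem_evl_node.1 hf <;>
    · simp only []
      rw [hs hp fun i hi => h i (by simp [Tr.leaves, hi]),
        ht hq fun i hi => h i (by simp [Tr.leaves, hi])]

theorem evl_update_of_notMem {t : Tr} {f : (ℕ → L) → L} (hf : f ∈ evl L t) {j : ℕ}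
    (hj : j ∉ t.leaves) (x : ℕ → L) (a : L) : f (Function.update x j a) = f x :=
  evl_congr hf fun i hi => Function.update_of_ne (by rintro rfl; exact hj hi) _ _

variable [Module F L] [IsScalarTower F L L] [SMulCommClass F L L]

variable (F) in
theorem evl_linear {t : Tr} (ht : t.leaves.Nodup) {f : (ℕ → L) → L} (hf : f ∈ evl L t) {j : ℕ}
    (hj : j ∈ t.leaves) (x : ℕ → L) : IsLinearMap F fun a => f (Function.update x j a) := by
  induction t generalizing f with
  | leaf i =>
    rw [mem_evl_leaf] at hf
    simp only [Tr.leaves, List.mem_singleton] at hj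
    subst hf hj
    exact ⟨by simp, by simp⟩
  | node s t hs ht' =>
    simp only [Tr.leaves, List.nodup_append'] at ht
    simp only [Tr.leaves, List.mem_append] at hj
    obtain ⟨p, hp, q, hq, h⟩ := mem_evl_node.1 hf
    rcases hj with hj | hj
    · have h1 := hs ht.1 hp hj
      have h2 := evl_update_of_notMem hq (fun h' => ht.2.2 hj h') x
      rcases h with rfl | rfl
      · exact ⟨fun a b => by simp only [h2, h1.map_add, add_mul],
          fun r a => by simp only [h2, h1.map_smul, smul_mul_assoc]⟩
      · exact ⟨fun a b => by simp only [h2, h1.map_add, mul_add],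
          fun r a => by simp only [h2, h1.map_smul, mul_smul_comm]⟩
    · have h1 := ht' ht.2.1 hq hj
      have h2 := evl_update_of_notMem hp (fun h' => ht.2.2 h' hj) x
      rcases h with rfl | rfl
      · exact ⟨fun a b => by simp only [h2, h1.map_add, mul_add],
          fun r a => by simp only [h2, h1.map_smul, mul_smul_comm]⟩
      · exact ⟨fun a b => by simp only [h2, h1.map_add, add_mul],
          fun r a => by simp only [h2, h1.map_smul, smul_mul_assoc]⟩

variable (F L) in
/-- The linear operators `v ↦ (… (v ∘ t₁) ∘ t₂ …)` for a list of trees `t₁, t₂, …`, under all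
choices of orientations. -/
def Ctx : List Tr → Set ((ℕ → L) → (L →ₗ[F] L))
  | [] => {fun _ => LinearMap.id}
  | t :: cs => {φ | ∃ g ∈ evl L t, ∃ ψ ∈ Ctx cs,
      φ = (fun x => (ψ x).comp (LinearMap.mulLeft F (g x))) ∨
      φ = fun x => (ψ x).comp (LinearMap.mulRight F (g x))}

/-- The labels of a list of trees. -/
def labels (cs : List Tr) : List ℕ := cs.flatMap Tr.leaves

theorem labels_cons (t : Tr) (cs : List Tr) : labels (t :: cs) = t.leaves ++ labels cs := by
  simp [labels]

theorem ctx_congr {cs : List Tr} {φ : (ℕ → L) → (L →ₗ[F] L)} (hφ : φ ∈ Ctx F L cs) {x y : ℕ → L}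
    (h : ∀ i ∈ labels cs, x i = y i) : φ x = φ y := by
  induction cs generalizing φ with
  | nil => rw [Ctx, Set.mem_singleton_iff] at hφ; rw [hφ]
  | cons t cs ih =>
    rw [labels_cons] at h
    obtain ⟨g, hg, ψ, hψ, rfl | rfl⟩ := hφ <;>
    · simp only []
      rw [ih hψ fun i hi => h i (by simp [hi]), evl_congr hg fun i hi => h i (by simp [hi])]

theorem ctx_update_of_notMem {cs : List Tr} {φ : (ℕ → L) → (L →ₗ[F] L)} (hφ : φ ∈ Ctx F L cs)
    {j : ℕ} (hj : j ∉ labels cs) (x : ℕ → L) (a : L) : φ (Function.update x j a) = φ x :=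
  ctx_congr hφ fun i hi => Function.update_of_ne (by rintro rfl; exact hj hi) _ _

theorem ctx_linear {cs : List Tr} (hcs : (labels cs).Nodup) {φ : (ℕ → L) → (L →ₗ[F] L)}
    (hφ : φ ∈ Ctx F L cs) {j : ℕ} (hj : j ∈ labels cs) (x : ℕ → L) :
    IsLinearMap F fun a => φ (Function.update x j a) := by
  induction cs generalizing φ with
  | nil => simp [labels] at hj
  | cons t cs ih =>
    rw [labels_cons, List.nodup_append'] at hcs
    rw [labels_cons, List.mem_append] at hj
    obtain ⟨g, hg, ψ, hψ, h⟩ := hφ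
    rcases hj with hj | hj
    · have h1 := evl_linear F hcs.1 hg hj x
      have h2 := ctx_update_of_notMem hψ (fun h' => hcs.2.2 hj h') x
      rcases h with rfl | rfl
      · exact ⟨fun a b => by ext v; simp [h2, h1.map_add, add_mul],
          fun r a => by ext v; simp [h2, h1.map_smul, smul_mul_assoc]⟩
      · exact ⟨fun a b => by ext v; simp [h2, h1.map_add, mul_add],
          fun r a => by ext v; simp [h2, h1.map_smul, mul_smul_comm]⟩
    · have h1 := ih hcs.2.1 hψ hj
      have h2 := evl_update_of_notMem hg (fun h' => hcs.2.2 h' hj) x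
      rcases h with rfl | rfl
      · exact ⟨fun a b => by ext v; simp [h2, h1.map_add],
          fun r a => by ext v; simp [h2, h1.map_smul]⟩
      · exact ⟨fun a b => by ext v; simp [h2, h1.map_add],
          fun r a => by ext v; simp [h2, h1.map_smul]⟩

variable (F L) in
/-- The values of the tree `t` inserted into the list of sibling trees `cs`. -/
def Vals (cs : List Tr) (t : Tr) : Set ((ℕ → L) → L) :=
  {h | ∃ φ ∈ Ctx F L cs, ∃ f ∈ evl L t, h = fun x => φ x (f x)}

theorem vals_nil (t : Tr) : Vals F L [] t = {f | f ∈ evl L t} := by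
  ext h
  simp only [Vals, Ctx, Set.mem_singleton_iff, Set.mem_ofPred_eq, exists_eq_left,
    LinearMap.id_apply]
  exact ⟨by rintro ⟨f, hf, rfl⟩; exact hf, fun hf => ⟨h, hf, rfl⟩⟩

/-- Descending into a factor turns its sibling into the innermost layer of the context. Both sides
range over all orientations, so the sets agree. -/
theorem vals_node_left (cs : List Tr) (s t : Tr) :
    Vals F L cs (.node s t) = Vals F L (t :: cs) s := by
  ext h
  constructor
  · rintro ⟨φ, hφ, f, hf, rfl⟩
    obtain ⟨p, hp, q, hq, rfl | rfl⟩ := mem_evl_node.1 hf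
    · exact ⟨_, ⟨q, hq, φ, hφ, Or.inr rfl⟩, p, hp, by simp⟩
    · exact ⟨_, ⟨q, hq, φ, hφ, Or.inl rfl⟩, p, hp, by simp⟩
  · rintro ⟨φ, ⟨q, hq, ψ, hψ, rfl | rfl⟩, p, hp, rfl⟩
    · exact ⟨ψ, hψ, _, mem_evl_node.2 ⟨p, hp, q, hq, Or.inr rfl⟩, by simp⟩
    · exact ⟨ψ, hψ, _, mem_evl_node.2 ⟨p, hp, q, hq, Or.inl rfl⟩, by simp⟩

theorem vals_node_right (cs : List Tr) (s t : Tr) :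
    Vals F L cs (.node s t) = Vals F L (s :: cs) t := by
  ext h
  constructor
  · rintro ⟨φ, hφ, f, hf, rfl⟩
    obtain ⟨p, hp, q, hq, rfl | rfl⟩ := mem_evl_node.1 hf
    · exact ⟨_, ⟨p, hp, φ, hφ, Or.inl rfl⟩, q, hq, by simp⟩
    · exact ⟨_, ⟨p, hp, φ, hφ, Or.inr rfl⟩, q, hq, by simp⟩
  · rintro ⟨φ, ⟨p, hp, ψ, hψ, rfl | rfl⟩, q, hq, rfl⟩
    · exact ⟨ψ, hψ, _, mem_evl_node.2 ⟨p, hp, q, hq, Or.inl rfl⟩, by simp⟩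
    · exact ⟨ψ, hψ, _, mem_evl_node.2 ⟨p, hp, q, hq, Or.inr rfl⟩, by simp⟩

end Eval

/-- A tree with some leaves in `U` and some outside has a minimal such subtree, with one factor
inside and one factor outside `U`. -/
theorem exists_mixed_node (U : Finset ℕ) (T : Tr) : ∀ (cs : List Tr),
    (∃ i ∈ T.leaves, i ∈ U) → (∃ i ∈ T.leaves, i ∉ U) →
    ∃ (w s : Tr) (ts : List Tr), (∀ i ∈ w.leaves, i ∉ U) ∧ (∀ i ∈ s.leaves, i ∈ U) ∧
      (w.leaves ++ labels (s :: ts)).Perm (T.leaves ++ labels cs) ∧ sizeOf s < sizeOf T ∧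
      ∀ (F : Type u) (L : Type v) [Field F] [NonUnitalNonAssocRing L] [Module F L]
        [IsScalarTower F L L] [SMulCommClass F L L], Vals F L cs T = Vals F L (s :: ts) w := by
  induction T with
  | leaf i =>
    intro cs h h'
    simp only [Tr.leaves, List.mem_singleton, exists_eq_left] at h h'
    exact absurd h h'
  | node l r hl hr =>
    intro cs h h'
    have pl : (l.leaves ++ labels (r :: cs)).Perm ((Tr.node l r).leaves ++ labels cs) := by
      simp [labels_cons, Tr.leaves]
    have pr : (r.leaves ++ labels (l :: cs)).Perm ((Tr.node l r).leaves ++ labels cs) := by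
      rw [labels_cons, Tr.leaves, ← List.append_assoc]
      exact List.perm_append_comm.append_right _
    by_cases l1 : ∃ i ∈ l.leaves, i ∈ U
    · by_cases l2 : ∃ i ∈ l.leaves, i ∉ U
      · obtain ⟨w, s, ts, h1, h2, h3, h4, h5⟩ := hl (r :: cs) l1 l2
        refine ⟨w, s, ts, h1, h2, h3.trans pl, h4.trans (by simp +arith), ?_⟩
        intros; rw [vals_node_left, h5]
      · by_cases r1 : ∃ i ∈ r.leaves, i ∈ U
        · by_cases r2 : ∃ i ∈ r.leaves, i ∉ U
          · obtain ⟨w, s, ts, h1, h2, h3, h4, h5⟩ := hr (l :: cs) r1 r2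
            refine ⟨w, s, ts, h1, h2, h3.trans pr, h4.trans (by simp +arith), ?_⟩
            intros; rw [vals_node_right, h5]
          · exfalso
            push Not at l2 r2
            obtain ⟨i, hi, hiU⟩ := h'
            rcases List.mem_append.1 hi with hi | hi
            exacts [hiU (l2 i hi), hiU (r2 i hi)]
        · push Not at l2 r1
          refine ⟨r, l, cs, r1, l2, pr, by simp +arith, ?_⟩
          intros; rw [vals_node_right]
    · by_cases r2 : ∃ i ∈ r.leaves, i ∉ U
      · by_cases r1 : ∃ i ∈ r.leaves, i ∈ U
        · obtain ⟨w, s, ts, h1, h2, h3, h4, h5⟩ := hr (l :: cs) r1 r2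
          refine ⟨w, s, ts, h1, h2, h3.trans pr, h4.trans (by simp +arith), ?_⟩
          intros; rw [vals_node_right, h5]
        · exfalso
          push Not at l1 r1
          obtain ⟨i, hi, hiU⟩ := h
          rcases List.mem_append.1 hi with hi | hi
          exacts [l1 i hi hiU, r1 i hi hiU]
      · push Not at l1 r2
        refine ⟨l, r, cs, l1, r2, pl, by simp +arith, ?_⟩
        intros; rw [vals_node_left]

/-! ### Generic successive choice of letters. -/

section Gen

variable {F : Type*} [Field F] {L : Type*} [AddCommGroup L] [Module F L]

open Function (update)

variable (F) in
/-- `P` holds when the coordinates in the list are chosen one after the other, each in a subspace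
of codimension at most `c` that depends on the earlier choices. -/
def Gen (c : ℕ) : List ℕ → ((ℕ → L) → Prop) → (ℕ → L) → Prop
  | [], P, x => P x
  | i :: ℓ, P, x => ∃ C : Submodule F L, CodimLE C c ∧ ∀ y ∈ C, Gen c ℓ P (update x i y)

theorem Gen.mono {c c' : ℕ} {ℓ : List ℕ} {P P' : (ℕ → L) → Prop} {x : ℕ → L}
    (h : Gen F c ℓ P x) (hc : c ≤ c') (hP : ∀ z, P z → P' z) : Gen F c' ℓ P' x := by
  induction ℓ generalizing x with
  | nil => exact hP _ h
  | cons i ℓ ih =>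
    obtain ⟨C, hC, h⟩ := h
    exact ⟨C, hC.mono le_rfl hc, fun y hy => ih (h y hy)⟩

theorem Gen.of_forall {c : ℕ} {ℓ : List ℕ} {P : (ℕ → L) → Prop} {x : ℕ → L} (h : ∀ z, P z) :
    Gen F c ℓ P x := by
  induction ℓ generalizing x with
  | nil => exact h _
  | cons i ℓ ih => exact ⟨⊤, CodimLE.top.mono le_rfl (Nat.zero_le c), fun y _ => ih⟩

theorem Gen.and {c c' : ℕ} {ℓ : List ℕ} {P P' : (ℕ → L) → Prop} {x : ℕ → L}
    (h : Gen F c ℓ P x) (h' : Gen F c' ℓ P' x) : Gen F (c + c') ℓ (fun z => P z ∧ P' z) x := by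
  induction ℓ generalizing x with
  | nil => exact ⟨h, h'⟩
  | cons i ℓ ih =>
    obtain ⟨C, hC, h⟩ := h
    obtain ⟨C', hC', h'⟩ := h'
    exact ⟨C ⊓ C', hC.inf hC', fun y hy => ih (h y hy.1) (h' y hy.2)⟩

theorem Gen.forall_list {α : Type*} {c : ℕ} {ℓ : List ℕ} (as : List α)
    {P : α → (ℕ → L) → Prop} {x : ℕ → L} (h : ∀ a ∈ as, Gen F c ℓ (P a) x) :
    Gen F (as.length * c) ℓ (fun z => ∀ a ∈ as, P a z) x := by
  induction as with
  | nil => exact Gen.of_forall (by simp)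
  | cons a as ih =>
    refine ((h a (by simp)).and (ih fun b hb => h b (by simp [hb]))).mono ?_ ?_
    · rw [List.length_cons, add_mul, one_mul, add_comm]
    · rintro z ⟨h1, h2⟩ b hb
      rcases List.mem_cons.1 hb with rfl | hb
      exacts [h1, h2 b hb]

theorem gen_append {c : ℕ} {ℓ ℓ' : List ℕ} {P : (ℕ → L) → Prop} {x : ℕ → L} :
    Gen F c (ℓ ++ ℓ') P x ↔ Gen F c ℓ (fun z => Gen F c ℓ' P z) x := by
  induction ℓ generalizing x with
  | nil => rfl
  | cons i ℓ ih => simp only [List.cons_append, Gen, ih]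

/-- Letters outside `ℓ` keep their values from the base point, so the same subspaces serve for
another base point once the two conditions are compared there. -/
theorem Gen.transfer {c : ℕ} {ℓ : List ℕ} {P P' : (ℕ → L) → Prop} {x x' : ℕ → L}
    (h : Gen F c ℓ P x) (hP : ∀ z z' : ℕ → L, (∀ i ∈ ℓ, z i = z' i) → (∀ i ∉ ℓ, z i = x i) →
      (∀ i ∉ ℓ, z' i = x' i) → P z → P' z') : Gen F c ℓ P' x' := by
  induction ℓ generalizing x x' with
  | nil => exact hP x x' (by simp) (fun _ _ => rfl) (fun _ _ => rfl) h
  | cons i ℓ ih =>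
    obtain ⟨C, hC, h⟩ := h
    refine ⟨C, hC, fun y hy => ih (h y hy) fun z z' h1 h2 h3 => hP z z' ?_ ?_ ?_⟩
    · intro j hj
      by_cases hj' : j ∈ ℓ
      · exact h1 j hj'
      · have : j = i := by simpa [hj'] using hj
        subst this
        rw [h2 j hj', h3 j hj', Function.update_self, Function.update_self]
    · intro j hj
      rw [List.mem_cons, not_or] at hj
      rw [h2 j hj.2, Function.update_of_ne hj.1]
    · intro j hj
      rw [List.mem_cons, not_or] at hj
      rw [h3 j hj.2, Function.update_of_ne hj.1]

/-- The preimage under `T` of the subspace allowed for letter `j` has no larger codimension. A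
letter outside `ℓ` is simply replaced in the base point. -/
theorem Gen.subst {c : ℕ} {ℓ : List ℕ} {P : (ℕ → L) → Prop} {x : ℕ → L} {j : ℕ} (T : L →ₗ[F] L)
    (h : Gen F c ℓ P (update x j (T (x j)))) :
    Gen F c ℓ (fun z => P (update z j (T (z j)))) x := by
  induction ℓ generalizing x with
  | nil => exact h
  | cons i ℓ ih =>
    obtain ⟨C, hC, h⟩ := h
    by_cases hij : j = i
    · subst hij
      refine ⟨C.comap T, hC.comap T, fun y hy => ih ?_⟩
      have := h (T y) hy
      simpa using this
    · refine ⟨C, hC, fun y hy => ih ?_⟩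
      have := h y hy
      rwa [Function.update_of_ne hij, Function.update_comm (Ne.symm hij)] 

/-- Only the last letter needs to be restricted, because its subspace may depend on all the others.
-/
theorem Gen.of_slices {c : ℕ} {ℓ : List ℕ} (hℓ : ℓ ≠ []) {P : (ℕ → L) → Prop}
    (h : ∀ k ∈ ℓ, ∀ z : ℕ → L, ∃ C : Submodule F L, CodimLE C c ∧ ∀ y ∈ C, P (update z k y))
    (x : ℕ → L) : Gen F c ℓ P x := by
  induction ℓ generalizing x with
  | nil => exact absurd rfl hℓ
  | cons i ℓ ih =>
    by_cases hℓ' : ℓ = []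
    · subst hℓ'
      exact h i (by simp) x
    · exact ⟨⊤, CodimLE.top.mono le_rfl (Nat.zero_le c), fun y _ =>
        ih hℓ' (fun k hk => h k (by simp [hk])) _⟩

end Gen

end LieType


namespace LieType

open Function (update)

/-! ### The Lie type identity as an approximate Leibniz rule. -/

section Hits

variable {F : Type*} [Field F] {L : Type*} [NonUnitalNonAssocRing L] [Module F L]

/-- The filtration pulled back along a linear map. -/
def Nrm.comap {E E' : Type*} [AddCommGroup E] [Module F E] [AddCommGroup E'] [Module F E']
    (N : Nrm F E) (T : E' →ₗ[F] E) : Nrm F E' where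
  S c x := N.S c (T x)
  mono := N.mono
  zero := by simpa using N.zero
  add h h' := by simpa using N.add h h'
  smul r h := by simpa using N.smul r h

theorem IsLieType.small_mul_mul (hL : IsLieType F L) (N : Nrm F L) {c c' : ℕ} {a b d : L}
    (h : N.S c (a * (b * d))) (h' : N.S c' ((a * d) * b)) : N.S (c + c') ((a * b) * d) := by
  obtain ⟨α, β, -, e⟩ := hL a b d
  rw [e]
  exact N.add (N.smul α h) (N.smul β h')

/-- The identity is solved for the right-nested product, which is where α ≠ 0 enters. -/
theorem IsLieType.small_mul_mul' (hL : IsLieType F L) (N : Nrm F L) {c c' : ℕ} {a b d : L}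
    (h : N.S c ((d * a) * b)) (h' : N.S c' ((d * b) * a)) : N.S (c + c') (d * (a * b)) := by
  obtain ⟨α, β, hα, e⟩ := hL d a b
  refine Nrm.of_smul hα ?_
  rw [eq_sub_of_add_eq e.symm]
  exact Nrm.sub h (N.smul β h')

variable [IsScalarTower F L L] [SMulCommClass F L L]

variable (F) in
/-- Left and right multiplication by `l`. -/
def ops (l : L) : List (L →ₗ[F] L) := [LinearMap.mulLeft F l, LinearMap.mulRight F l]

theorem forall_ops {l : L} {P : (L →ₗ[F] L) → Prop} :
    (∀ T ∈ ops F l, P T) ↔ P (LinearMap.mulLeft F l) ∧ P (LinearMap.mulRight F l) := by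
  simp [ops]

theorem small_ops_mul (hL : IsLieType F L) (N : Nrm F L) {k k' : ℕ} {p q l : L}
    (hp : ∀ T ∈ ops F l, N.S k (T p * q) ∧ N.S k (q * T p))
    (hq : ∀ T ∈ ops F l, N.S k' (T q * p) ∧ N.S k' (p * T q)) :
    ∀ T ∈ ops F l, N.S (k + k') (T (p * q)) ∧ N.S (k + k') (T (q * p)) := by
  rw [forall_ops] at hp hq ⊢
  obtain ⟨⟨p1, p2⟩, p3, p4⟩ := hp
  obtain ⟨⟨q1, q2⟩, q3, q4⟩ := hq
  simp only [LinearMap.mulLeft_apply, LinearMap.mulRight_apply] at *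
  refine ⟨⟨hL.small_mul_mul' N p1 q1, ?_⟩, ?_, hL.small_mul_mul N p4 q3⟩
  · rw [add_comm]; exact hL.small_mul_mul' N q1 p1
  · rw [add_comm]; exact hL.small_mul_mul N q4 p3

/-- The product of a monomial with `l` is small if all monomials with one letter multiplied by `l`
are small. -/
theorem small_ops_evl (hL : IsLieType F L) {w : Tr} (hw : w.leaves.Nodup) {x : ℕ → L} {l : L}
    {f : (ℕ → L) → L} (hf : f ∈ evl L w) (N : Nrm F L) {c : ℕ}
    (h : ∀ j ∈ w.leaves, ∀ T ∈ ops F l, ∀ g ∈ evl L w, N.S c (g (update x j (T (x j))))) :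
    ∀ T ∈ ops F l, N.S (w.leaves.length * c) (T (f x)) := by
  induction w generalizing f N with
  | leaf i =>
    intro T hT
    have := h i (by simp [Tr.leaves]) T hT _ (mem_evl_leaf.2 rfl)
    rw [mem_evl_leaf] at hf
    subst hf
    simpa [Tr.leaves] using this
  | node s t hs ht =>
    simp only [Tr.leaves, List.nodup_append'] at hw
    simp only [Tr.leaves, List.mem_append] at h
    obtain ⟨p, hp, q, hq, hf⟩ := mem_evl_node.1 hf
    have key := small_ops_mul hL N (k := s.leaves.length * c) (k' := t.leaves.length * c)
      (p := p x) (q := q x) (l := l)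
      (fun T hT => by
        have hq' : ∀ j ∈ s.leaves, ∀ a, q (update x j a) = q x := fun j hj =>
          evl_update_of_notMem hq (fun h' => hw.2.2 hj h') x
        constructor
        · refine hs hw.1 hp (N.comap (LinearMap.mulRight F (q x))) (fun j hj T hT g hg => ?_) T hT
          have := h j (Or.inl hj) T hT _ (mem_evl_node.2 ⟨g, hg, q, hq, Or.inl rfl⟩)
          rwa [hq' j hj] at this
        · refine hs hw.1 hp (N.comap (LinearMap.mulLeft F (q x))) (fun j hj T hT g hg => ?_) T hT
          have := h j (Or.inl hj) T hT _ (mem_evl_node.2 ⟨g, hg, q, hq, Or.inr rfl⟩)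
          rwa [hq' j hj] at this)
      (fun T hT => by
        have hp' : ∀ j ∈ t.leaves, ∀ a, p (update x j a) = p x := fun j hj =>
          evl_update_of_notMem hp (fun h' => hw.2.2 h' hj) x
        constructor
        · refine ht hw.2.1 hq (N.comap (LinearMap.mulRight F (p x))) (fun j hj T hT g hg => ?_) T hT
          have := h j (Or.inr hj) T hT _ (mem_evl_node.2 ⟨p, hp, g, hg, Or.inr rfl⟩)
          rwa [hp' j hj] at this
        · refine ht hw.2.1 hq (N.comap (LinearMap.mulLeft F (p x))) (fun j hj T hT g hg => ?_) T hT
          have := h j (Or.inr hj) T hT _ (mem_evl_node.2 ⟨p, hp, g, hg, Or.inl rfl⟩)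
          rwa [hp' j hj] at this)
    intro T hT
    rw [Tr.leaves, List.length_append, add_mul]
    rcases hf with rfl | rfl
    exacts [(key T hT).1, (key T hT).2]

/-- The factor `l` at the centre is moved outwards. At each layer the identity leaves one term in
which `l` has passed the sibling tree and one in which it multiplies that tree, hence its letters.
At the end `l` multiplies the whole value, which is `h₀`. -/
theorem small_ctx_ops (hL : IsLieType F L) {cs : List Tr} (hcs : (labels cs).Nodup) {x : ℕ → L}
    {l v : L} {φ : (ℕ → L) → (L →ₗ[F] L)} (hφ : φ ∈ Ctx F L cs) (N : Nrm F L) {c : ℕ}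
    (h₀ : ∀ ψ ∈ Ctx F L cs, ∀ T ∈ ops F l, N.S c (T (ψ x v)))
    (h : ∀ j ∈ labels cs, ∀ T ∈ ops F l, ∀ ψ ∈ Ctx F L cs, N.S c (ψ (update x j (T (x j))) v)) :
    ∀ T ∈ ops F l, N.S (((labels cs).length + 1) * c) (φ x (T v)) := by
  induction cs generalizing φ v with
  | nil =>
    rw [Ctx, Set.mem_singleton_iff] at hφ
    subst hφ
    intro T hT
    simpa [labels] using h₀ _ rfl T hT
  | cons t cs ih =>
    rw [labels_cons, List.nodup_append'] at hcs
    simp only [labels_cons, List.mem_append] at h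
    obtain ⟨g, hg, ψ, hψ, hφ⟩ := hφ
    have hg' : ∀ j ∈ labels cs, ∀ a, g (update x j a) = g x := fun j hj =>
      evl_update_of_notMem hg (fun h' => hcs.2.2 h' hj) x
    have hψ' : ∀ j ∈ t.leaves, ∀ a, ψ (update x j a) = ψ x := fun j hj =>
      ctx_update_of_notMem hψ (fun h' => hcs.2.2 hj h') x
    have A1 := ih hcs.2.1 (v := g x * v) hψ
      (fun ψ hψ T hT => h₀ _ ⟨g, hg, ψ, hψ, Or.inl rfl⟩ T hT)
      (fun j hj T hT ψ hψ => by
        have := h j (Or.inr hj) T hT _ ⟨g, hg, ψ, hψ, Or.inl rfl⟩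
        simpa [hg' j hj] using this)
    have A2 := ih hcs.2.1 (v := v * g x) hψ
      (fun ψ hψ T hT => h₀ _ ⟨g, hg, ψ, hψ, Or.inr rfl⟩ T hT)
      (fun j hj T hT ψ hψ => by
        have := h j (Or.inr hj) T hT _ ⟨g, hg, ψ, hψ, Or.inr rfl⟩
        simpa [hg' j hj] using this)
    have B1 := small_ops_evl hL hcs.1 hg (N.comap ((ψ x).comp (LinearMap.mulRight F v)))
      (x := x) (l := l) (c := c) (fun j hj T hT g' hg' => by
        have := h j (Or.inl hj) T hT _ ⟨g', hg', ψ, hψ, Or.inl rfl⟩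
        simpa [hψ' j hj, Nrm.comap] using this)
    have B2 := small_ops_evl hL hcs.1 hg (N.comap ((ψ x).comp (LinearMap.mulLeft F v)))
      (x := x) (l := l) (c := c) (fun j hj T hT g' hg' => by
        have := h j (Or.inl hj) T hT _ ⟨g', hg', ψ, hψ, Or.inr rfl⟩
        simpa [hψ' j hj, Nrm.comap] using this)
    have e : ((labels (t :: cs)).length + 1) * c =
        ((labels cs).length + 1) * c + t.leaves.length * c := by
      rw [labels_cons, List.length_append]; ring
    rw [e]
    rw [forall_ops] at A1 A2 B1 B2 ⊢
    simp only [Nrm.comap, LinearMap.comp_apply, LinearMap.mulLeft_apply,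
      LinearMap.mulRight_apply] at *
    rcases hφ with rfl | rfl
    · simp only [LinearMap.comp_apply, LinearMap.mulLeft_apply]
      refine ⟨?_, hL.small_mul_mul' (N.comap (ψ x)) A1.2 B1.2⟩
      rw [add_comm]
      exact hL.small_mul_mul' (N.comap (ψ x)) B1.2 A1.2
    · simp only [LinearMap.comp_apply, LinearMap.mulRight_apply]
      refine ⟨hL.small_mul_mul (N.comap (ψ x)) A2.1 B1.1, ?_⟩
      rw [add_comm]
      exact hL.small_mul_mul (N.comap (ψ x)) B2.1 A2.2

end Hits

/-! ### Balanced products, ideals and the derived series. -/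

section Pure

variable {F : Type*} [Field F] {L : Type*} [NonUnitalNonAssocRing L] [Module F L]

/-- The values of the balanced products of `2 ^ j` elements of `I`. -/
def Pure (I : Submodule F L) : ℕ → Set L
  | 0 => I
  | j + 1 => {z | ∃ a ∈ Pure I j, ∃ b ∈ Pure I j, z = a * b}

theorem pure_mono {I J : Submodule F L} (h : I ≤ J) : ∀ j, Pure I j ⊆ Pure J j
  | 0 => h
  | j + 1 => by
    rintro _ ⟨a, ha, b, hb, rfl⟩
    exact ⟨a, pure_mono h j ha, b, pure_mono h j hb, rfl⟩

theorem pure_succ_subset {I : Submodule F L} (hI : IsIdeal I) : ∀ j, Pure I (j + 1) ⊆ Pure I j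
  | 0 => by
    rintro _ ⟨a, ha, b, -, rfl⟩
    exact (hI a ha b).1
  | j + 1 => by
    rintro _ ⟨a, ha, b, hb, rfl⟩
    exact ⟨a, pure_succ_subset hI j ha, b, pure_succ_subset hI j hb, rfl⟩

theorem pure_antitone {I : Submodule F L} (hI : IsIdeal I) : Antitone (Pure I) :=
  antitone_nat_of_succ_le (pure_succ_subset hI)

theorem IsIdeal.inf {I J : Submodule F L} (hI : IsIdeal I) (hJ : IsIdeal J) : IsIdeal (I ⊓ J) :=
  fun x hx y => ⟨⟨(hI x hx.1 y).1, (hJ x hx.2 y).1⟩, (hI x hx.1 y).2, (hJ x hx.2 y).2⟩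

theorem prodSpan_mono {M M' N N' : Submodule F L} (h : M ≤ M') (h' : N ≤ N') :
    prodSpan M N ≤ prodSpan M' N' :=
  Submodule.span_mono fun _ ⟨x, hx, y, hy, e⟩ => ⟨x, h hx, y, h' hy, e⟩

theorem derived_mono {I J : Submodule F L} (h : I ≤ J) : ∀ j, derived I j ≤ derived J j
  | 0 => h
  | j + 1 => prodSpan_mono (derived_mono h j) (derived_mono h j)

/-- A balanced product is unfolded along `s`. Where a branch of `s` ends early, the unused levels
are forgotten, since `Pure I` decreases for an ideal. -/
theorem exists_evl_eq_of_mem_pure {I : Submodule F L} (hI : IsIdeal I) {s : Tr}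
    (hs : s.leaves.Nodup) {e h : ℕ} (hh : s.height ≤ h) {q : L} (hq : q ∈ Pure I (h + e)) :
    ∃ f ∈ evl L s, ∃ x : ℕ → L, (∀ j, x j ∈ Pure I e) ∧ f x = q := by
  induction s generalizing h q with
  | leaf i => exact ⟨_, mem_evl_leaf.2 rfl, fun _ => q, fun _ =>
      pure_antitone hI (Nat.le_add_left e h) hq, rfl⟩
  | node s t hs' ht' =>
    simp only [Tr.leaves, List.nodup_append'] at hs
    simp only [Tr.height] at hh
    obtain ⟨h, rfl⟩ : ∃ k, h = k + 1 := ⟨h - 1, by omega⟩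
    rw [add_right_comm] at hq
    obtain ⟨a, ha, b, hb, rfl⟩ := hq
    obtain ⟨f, hf, x, hx, rfl⟩ := hs' hs.1 (h := h) (by omega) ha
    obtain ⟨g, hg, y, hy, rfl⟩ := ht' hs.2.1 (h := h) (by omega) hb
    refine ⟨_, mem_evl_node.2 ⟨f, hf, g, hg, Or.inl rfl⟩,
      fun i => if i ∈ s.leaves then x i else y i, fun j => ?_, ?_⟩
    · by_cases hj : j ∈ s.leaves <;> simp [hj, hx, hy]
    · congr 1
      · exact evl_congr hf fun i hi => by simp [hi]
      · exact evl_congr hg fun i hi => if_neg fun h' => hs.2.2 h' hi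

theorem evl_mem_pure {I : Submodule F L} (hI : IsIdeal I) {s : Tr} {t : ℕ} {f : (ℕ → L) → L}
    (hf : f ∈ evl L s) {x : ℕ → L} (hx : ∀ j ∈ s.leaves, x j ∈ Pure I t) : f x ∈ Pure I t := by
  induction s generalizing f with
  | leaf i => rw [mem_evl_leaf] at hf; subst hf; exact hx i (by simp [Tr.leaves])
  | node s s' h h' =>
    simp only [Tr.leaves, List.mem_append] at hx
    obtain ⟨p, hp, q, hq, rfl | rfl⟩ := mem_evl_node.1 hf
    · exact pure_succ_subset hI t ⟨_, h hp fun j hj => hx j (Or.inl hj), _,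
        h' hq fun j hj => hx j (Or.inr hj), rfl⟩
    · exact pure_succ_subset hI t ⟨_, h' hq fun j hj => hx j (Or.inr hj), _,
        h hp fun j hj => hx j (Or.inl hj), rfl⟩

theorem evl_mem_pure_mul {I : Submodule F L} (hI : IsIdeal I) {s : Tr} {t : ℕ}
    {f : (ℕ → L) → L} (hf : f ∈ evl L s) {x : ℕ → L}
    (hx : ∀ j ∈ s.leaves, x j ∈ Pure I (t + 1)) :
    ∃ p ∈ Pure I t, ∃ q ∈ Pure I t, f x = p * q :=
  evl_mem_pure hI hf hx

variable [IsScalarTower F L L] [SMulCommClass F L L]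

/-- Right multiplication preserves [M, N], but y(ab) also produces (yb)a, which lies in [N, M]. This
is why both products are needed. -/
theorem isIdeal_prodSpan (hL : IsLieType F L) {M N : Submodule F L} (hM : IsIdeal M)
    (hN : IsIdeal N) : IsIdeal (prodSpan M N ⊔ prodSpan N M) := by
  intro x hx y
  have key : ∀ M N : Submodule F L, IsIdeal M → IsIdeal N → ∀ x ∈ prodSpan M N,
      x * y ∈ prodSpan M N ⊔ prodSpan N M ∧ y * x ∈ prodSpan M N ⊔ prodSpan N M := by
    intro M N hM hN x hx
    induction hx using Submodule.span_induction with
    | mem z hz =>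
      obtain ⟨a, ha, b, hb, rfl⟩ := hz
      constructor
      · obtain ⟨α, β, -, e⟩ := hL a b y
        rw [e]
        exact Submodule.mem_sup_left (Submodule.add_mem _
          (Submodule.smul_mem _ _ (Submodule.subset_span ⟨a, ha, _, (hN b hb y).1, rfl⟩))
          (Submodule.smul_mem _ _ (Submodule.subset_span ⟨_, (hM a ha y).1, b, hb, rfl⟩)))
      · obtain ⟨α, β, hα, e⟩ := hL y a b
        have e' : α • (y * (a * b)) = (y * a) * b - β • ((y * b) * a) :=
          eq_sub_of_add_eq e.symm
        rw [← Submodule.smul_mem_iff _ hα, e']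
        exact Submodule.sub_mem _
          (Submodule.mem_sup_left (Submodule.subset_span ⟨_, (hM a ha y).2, b, hb, rfl⟩))
          (Submodule.smul_mem _ _
            (Submodule.mem_sup_right (Submodule.subset_span ⟨_, (hN b hb y).2, a, ha, rfl⟩)))
    | zero => simp
    | add u v _ _ hu hv =>
      exact ⟨by rw [add_mul]; exact Submodule.add_mem _ hu.1 hv.1,
        by rw [mul_add]; exact Submodule.add_mem _ hu.2 hv.2⟩
    | smul r u _ hu =>
      exact ⟨by rw [smul_mul_assoc]; exact Submodule.smul_mem _ _ hu.1,
        by rw [mul_smul_comm]; exact Submodule.smul_mem _ _ hu.2⟩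
  obtain ⟨p, hp, q, hq, rfl⟩ := Submodule.mem_sup.1 hx
  have h1 := key M N hM hN p hp
  have h2 := key N M hN hM q hq
  rw [sup_comm (prodSpan N M)] at h2
  exact ⟨by rw [add_mul]; exact Submodule.add_mem _ h1.1 h2.1,
    by rw [mul_add]; exact Submodule.add_mem _ h1.2 h2.2⟩

theorem isIdeal_derived (hL : IsLieType F L) {I : Submodule F L} (hI : IsIdeal I) :
    ∀ j, IsIdeal (derived I j)
  | 0 => hI
  | j + 1 => by
    have := isIdeal_prodSpan hL (isIdeal_derived hL hI j) (isIdeal_derived hL hI j)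
    rwa [sup_idem] at this

theorem derived_antitone (hL : IsLieType F L) {I : Submodule F L} (hI : IsIdeal I) :
    Antitone (derived I) := by
  refine antitone_nat_of_succ_le fun j => Submodule.span_le.2 ?_
  rintro _ ⟨a, ha, b, -, rfl⟩
  exact (isIdeal_derived hL hI j a ha b).1

theorem span_pure (I : Submodule F L) : ∀ j, Submodule.span F (Pure I j) = derived I j
  | 0 => Submodule.span_eq I
  | j + 1 => by
    rw [derived, ← span_pure I j]
    refine le_antisymm (Submodule.span_mono ?_) (Submodule.span_le.2 ?_)
    · rintro _ ⟨a, ha, b, hb, rfl⟩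
      exact ⟨a, Submodule.subset_span ha, b, Submodule.subset_span hb, rfl⟩
    · rintro _ ⟨x, hx, y, hy, rfl⟩
      induction hx using Submodule.span_induction with
      | mem x hx =>
        induction hy using Submodule.span_induction with
        | mem y hy => exact Submodule.subset_span ⟨x, hx, y, hy, rfl⟩
        | zero => simp
        | add u v _ _ hu hv => rw [mul_add]; exact Submodule.add_mem _ hu hv
        | smul r u _ hu => rw [mul_smul_comm]; exact Submodule.smul_mem _ _ hu
      | zero => simp
      | add u v _ _ hu hv => rw [add_mul]; exact Submodule.add_mem _ hu hv
      | smul r u _ hu => rw [smul_mul_assoc]; exact Submodule.smul_mem _ _ hu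

theorem pure_subset_derived (I : Submodule F L) (j : ℕ) : Pure I j ⊆ derived I j := by
  rw [← span_pure]; exact Submodule.subset_span

end Pure

end LieType


namespace LieType

open Function (update)

/-! ### Multilinear maps with small slices have nearly finite-dimensional values. -/

section Spanning

variable {F : Type*} [Field F] {L : Type*} [AddCommGroup L] [Module F L]
  {E : Type*} [AddCommGroup E] [Module F E]

/-- Bounds for the number of spanning values and for the level of the error. -/
def spanBound (c : ℕ) : ℕ → ℕ × ℕ
  | 0 => (1, 0)
  | n + 1 =>
    let N := (spanBound c n).1
    let d := (spanBound c n).2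
    (N + N + N * c * N, ((N + 1) * d + (N + 1) * ((N + 1) * c)) + N * c + d + N * c * d)

/-- The iterated bound for the size of a gap in the levels. -/
def gapBound (c₁ : ℕ) : ℕ → ℕ → ℕ
  | 0, c => c
  | k + 1, c => gapBound c₁ k (c₁ + 4 * c)

theorem le_gapBound (c₁ : ℕ) : ∀ k c, c ≤ gapBound c₁ k c
  | 0, _ => le_rfl
  | k + 1, c => le_trans (by omega) (le_gapBound c₁ k (c₁ + 4 * c))

/-- At a gap level `d`, sums of two vectors of level `d` that stay in `V` are again of level `d`. If
`W` has no nonzero vector of level `c₁ + 3 * c`, the approximants of such vectors vanish and `d = c`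
works. Otherwise such a vector is absorbed into the error, at most `dim W` times. -/
theorem exists_gap (N : Nrm F E) (c₁ : ℕ) (V : Set E) (k : ℕ) : ∀ (c : ℕ) (W : Submodule F E)
    [Module.Finite F W] (_ : Module.finrank F W ≤ k) (_ : ∀ y ∈ V, (N.mod W).S c y),
    ∃ d ≤ gapBound c₁ k c, ∀ y ∈ V, N.S (c₁ + 2 * d) y → N.S d y := by
  induction k with
  | zero =>
    intro c W _ hW hV
    have hW' : W = ⊥ := Submodule.finrank_eq_zero.1 (Nat.le_zero.1 hW)
    refine ⟨c, le_rfl, fun y hy _ => ?_⟩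
    obtain ⟨w, hw, h⟩ := hV y hy
    rw [hW', Submodule.mem_bot] at hw
    simpa [hw] using h
  | succ k ih =>
    intro c W _ hW hV
    by_cases hw : ∃ w ∈ W, w ≠ 0 ∧ N.S (c₁ + 3 * c) w
    · obtain ⟨w, hwW, hw0, hw⟩ := hw
      obtain ⟨W', hW'⟩ := (Submodule.span F {(⟨w, hwW⟩ : W)}).exists_isCompl
      have hfin := Submodule.finrank_add_eq_of_isCompl hW'
      rw [finrank_span_singleton (by simpa using hw0)] at hfin
      have hmap : Module.finrank F (W'.map W.subtype) = Module.finrank F W' :=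
        LinearEquiv.finrank_eq (Submodule.equivMapOfInjective _ W.subtype_injective W').symm
      refine ih (c₁ + 4 * c) (W'.map W.subtype) (by omega) fun b hb => ?_
      obtain ⟨y, hy, hyb⟩ := hV b hb
      have : (⟨y, hy⟩ : W) ∈ Submodule.span F {(⟨w, hwW⟩ : W)} ⊔ W' := by
        rw [hW'.sup_eq_top]; trivial
      obtain ⟨a, ha, a', ha', hs⟩ := Submodule.mem_sup.1 this
      obtain ⟨r, rfl⟩ := Submodule.mem_span_singleton.1 ha
      refine ⟨a', ⟨a', ha', rfl⟩, ?_⟩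
      have hs' : r • w + (a' : E) = y := congrArg Subtype.val hs
      have : b - (a' : E) = (b - y) + r • w := by rw [← hs']; abel
      rw [this]
      exact N.mono (by omega) (N.add hyb (N.smul r hw))
    · push Not at hw
      refine ⟨c, le_gapBound _ _ _, fun y hy hs => ?_⟩
      obtain ⟨w, hwW, hyw⟩ := hV y hy
      have hw0 : w = 0 := by
        by_contra h0
        refine hw w hwW h0 ?_
        have := Nrm.sub hs hyw
        rw [sub_sub_cancel] at this
        exact N.mono (by omega) this
      simpa [hw0] using hyw

/-- If `k` vectors lie in the span of fewer than `k` vectors up to small errors, then they are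
linearly dependent up to a small error. -/
theorem exists_small_combination (N : Nrm F E) {n c : ℕ} {W : Submodule F E} [Module.Finite F W]
    (hW : Module.finrank F W ≤ n) (y : Fin (n + 1) → E) (hy : ∀ j, (N.mod W).S c (y j)) :
    ∃ a : Fin (n + 1) → F, a ≠ 0 ∧ N.S ((n + 1) * c) (∑ j, a j • y j) := by
  choose w hwW hw using hy
  have hdep : ¬ LinearIndependent F fun j => (⟨w j, hwW j⟩ : W) := by
    intro h
    have := h.fintype_card_le_finrank
    rw [Fintype.card_fin] at this
    omega
  obtain ⟨a, ha, j, hj⟩ := Fintype.not_linearIndependent_iff.1 hdep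
  refine ⟨a, fun h => hj (by rw [h]; rfl), ?_⟩
  have ha' : ∑ j, a j • w j = 0 := by
    simpa using congrArg Subtype.val ha
  have : ∑ j, a j • y j = ∑ j, a j • (y j - w j) := by
    simp only [smul_sub, Finset.sum_sub_distrib, ha', sub_zero]
  rw [this]
  simpa using N.sum Finset.univ (c := c) fun j _ => N.smul (a j) (hw j)

/-- Induction on the set `Z` of coordinates that vary. For a new coordinate `i`, take a maximal
family of tuples whose values at a common `x₀` are independent up to errors. Moving `x₀` within the
intersection of their slices hardly changes these values, so by maximality they capture every other
value there; finitely many representatives cover the remaining choices of coordinate `i`. -/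
theorem exists_spanning_values_aux (N : Nrm F E) {A : Submodule F L} {U : Finset ℕ} {c : ℕ}
    {f : (ℕ → L) → E} (hlin : ∀ i ∈ U, ∀ u, IsLinearMap F fun a => f (update u i a))
    (hslice : ∀ i ∈ U, ∀ u : ℕ → L, (∀ j ∈ U, u j ∈ A) → ∃ C : Submodule F L, CodimLE C c ∧
      ∀ a ∈ C, a ∈ A → N.S c (f (update u i a))) (Z : Finset ℕ) (hZ : Z ⊆ U) :
    ∀ u : ℕ → L, (∀ j ∈ U, u j ∈ A) → ∃ l : List (ℕ → L), l.length ≤ (spanBound c Z.card).1 ∧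
      (∀ v ∈ l, ∀ j ∈ U, v j ∈ A) ∧
      ∀ v : ℕ → L, (∀ j ∈ U, v j ∈ A) → (∀ j ∉ Z, v j = u j) →
        (N.mod (Submodule.span F {y | ∃ v ∈ l, y = f v})).S (spanBound c Z.card).2 (f v) := by
  induction Z using Finset.induction_on with
  | empty =>
    intro u hu
    refine ⟨[u], by simp [spanBound], by simpa using hu, fun v hv hvu => ?_⟩
    have : v = u := funext fun j => hvu j (by simp)
    subst this
    exact ⟨f v, Submodule.subset_span ⟨v, by simp, rfl⟩, by simpa using N.zero' _⟩
  | insert i Z hi ih =>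
    intro u hu
    have hiU : i ∈ U := hZ (by simp)
    rw [Finset.card_insert_of_notMem hi]
    replace ih := ih fun j hj => hZ (by simp [hj])
    have hmem : ∀ {v : ℕ → L} {a : L}, (∀ j ∈ U, v j ∈ A) → a ∈ A →
        ∀ j ∈ U, update v i a j ∈ A := by
      intro v a hv ha j hj
      by_cases hji : j = i
      · subst hji; simpa using ha
      · simpa [hji] using hv j hj
    have hupd : ∀ (a : L) {v : ℕ → L}, (∀ j ∉ insert i Z, v j = u j) →
        ∀ j ∉ Z, update v i a j = update u i a j := by
      intro a v hv j hj
      by_cases hji : j = i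
      · subst hji; simp
      · simpa [hji] using hv j (by simp [hji, hj])
    generalize hn : (spanBound c Z.card).1 = n at ih
    generalize hd : (spanBound c Z.card).2 = d at ih
    have hb : spanBound c (Z.card + 1) = (n + n + n * c * n,
        ((n + 1) * d + (n + 1) * ((n + 1) * c)) + n * c + d + n * c * d) := by
      rw [spanBound, hn, hd]
    rw [hb]
    have ihx := fun (a : L) (ha : a ∈ A) => ih (update u i a) (hmem hu ha)
    choose! lx hlx1 hlx2 hlx3 using ihx
    -- The threshold drops by `(n + 1) * c` per vector, leaving room for the error `k * c` of a
    -- move. At `k = n + 1` it equals the level at which the inductive bound forces a dependence.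
    let θ : ℕ → ℕ := fun k => (n + 1) * d + (n + 1 - k) * ((n + 1) * c)
    let Q : ℕ → Prop := fun k => ∃ x₀ ∈ A, ∃ v : Fin k → (ℕ → L),
      (∀ j, (∀ i ∈ U, v j i ∈ A) ∧ ∀ i' ∉ insert i Z, v j i' = u i') ∧
      ∀ a : Fin k → F, N.S (θ k) (∑ j, a j • f (update (v j) i x₀)) → a = 0
    have hfinl : ∀ l : List (ℕ → L), Module.Finite F (Submodule.span F {y | ∃ v ∈ l, y = f v}) ∧
        Module.finrank F (Submodule.span F {y | ∃ v ∈ l, y = f v}) ≤ l.length := by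
      intro l
      classical
      have e : {y | ∃ v ∈ l, y = f v} = ((l.map f).toFinset : Set E) := by
        ext y; simp [eq_comm]
      rw [e]
      refine ⟨inferInstance, (finrank_span_finset_le_card _).trans ?_⟩
      exact (List.toFinset_card_le _).trans (by simp)
    have hQ0 : Q 0 := ⟨0, A.zero_mem, fun j => j.elim0, fun j => j.elim0, fun a _ =>
      Subsingleton.elim _ _⟩
    have hQn : ¬ Q (n + 1) := by
      rintro ⟨x₀, hx₀, v, hv, h⟩
      obtain ⟨hf, hr⟩ := hfinl (lx x₀)
      obtain ⟨a, ha, hs⟩ := exists_small_combination N (hr.trans (hlx1 x₀ hx₀))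
        (fun j => f (update (v j) i x₀)) fun j =>
          hlx3 x₀ hx₀ _ (hmem (hv j).1 hx₀) (hupd x₀ (hv j).2)
      exact ha (h a (N.mono (by simp [θ]) hs))
    obtain ⟨k, hk, hQk, hQk'⟩ : ∃ k ≤ n, Q k ∧ ¬ Q (k + 1) := by
      by_contra! hcon
      have : ∀ k ≤ n + 1, Q k := fun k => by
        induction k with
        | zero => exact fun _ => hQ0
        | succ k ihk => exact fun hk => hcon k (by omega) (ihk (by omega))
      exact hQn (this _ le_rfl)
    obtain ⟨x₀, hx₀, v, hv, hind⟩ := hQk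
    choose C hC hCs using fun j => hslice i hiU (v j) (hv j).1
    let X₀ : Submodule F L := ⨅ j ∈ (Finset.univ : Finset (Fin k)), C j
    have hX₀ : CodimLE X₀ (n * c) := (CodimLE.biInf Finset.univ C c fun j _ => hC j).mono le_rfl
      (by rw [Finset.card_univ, Fintype.card_fin]; exact Nat.mul_le_mul_right c hk)
    have hX₀C : ∀ x ∈ X₀, ∀ j, x ∈ C j := by
      intro x hx j
      simp only [X₀, Submodule.mem_iInf] at hx
      exact hx j (Finset.mem_univ j)
    obtain ⟨t, ht⟩ := (hX₀.comap A.subtype).exists_reps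
    -- The three pieces handle values at `x₀ + x`, at `x₀`, and at the representatives of `A` modulo
    -- `X₀`.
    let l' : List (ℕ → L) := (List.finRange k).map (fun j => update (v j) i x₀) ++ lx x₀ ++
      (List.finRange (n * c)).flatMap fun j => lx (t j)
    have hθ : θ (k + 1) + k * c ≤ θ k := by
      simp only [θ]
      have h1 : n + 1 - k = (n + 1 - (k + 1)) + 1 := by omega
      have h2 : k * c ≤ (n + 1) * c := Nat.mul_le_mul_right c (by omega)
      rw [h1, add_mul (n + 1 - (k + 1)) 1 ((n + 1) * c), one_mul]
      omega
    have hspan : ∀ l : List (ℕ → L), (∀ v ∈ l, v ∈ l') → Submodule.span F {y | ∃ v ∈ l, y = f v} ≤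
        Submodule.span F {y | ∃ v ∈ l', y = f v} := by
      intro l hl
      refine Submodule.span_mono ?_
      rintro y ⟨v, hv, e⟩
      exact ⟨v, hl v hv, e⟩
    have hmodmono : ∀ {W W' : Submodule F E} {c y}, W ≤ W' → (N.mod W).S c y → (N.mod W').S c y :=
      fun h ⟨w, hw, hs⟩ => ⟨w, h hw, hs⟩
    have hlx' : ∀ v ∈ lx x₀, v ∈ l' := fun v hv => by simp [l', hv]
    have hlt' : ∀ j, ∀ v ∈ lx (t j), v ∈ l' := fun j v hv => by
      simp only [l', List.mem_append, List.mem_flatMap]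
      exact Or.inr ⟨j, List.mem_finRange j, hv⟩
    have hlv' : ∀ j, update (v j) i x₀ ∈ l' := fun j => by
      simp only [l', List.mem_append, List.mem_map]
      exact Or.inl (Or.inl ⟨j, List.mem_finRange j, rfl⟩)
    refine ⟨l', ?_, ?_, ?_⟩
    · simp only [l', List.length_append, List.length_map, List.length_finRange,
        List.length_flatMap]
      have h1 := hlx1 x₀ hx₀
      have h2 : ((List.finRange (n * c)).map fun j => (lx (t j)).length).sum ≤ n * c * n := by
        refine (List.sum_le_card_nsmul _ n ?_).trans (by simp)
        intro m hm
        obtain ⟨j, -, rfl⟩ := List.mem_map.1 hm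
        exact hlx1 _ (t j).2
      omega
    · intro v' hv'
      simp only [l', List.mem_append, List.mem_map, List.mem_flatMap] at hv'
      rcases hv' with (⟨j, -, rfl⟩ | hv') | ⟨j, -, hv'⟩
      · exact hmem (hv j).1 hx₀
      · exact hlx2 x₀ hx₀ v' hv'
      · exact hlx2 (t j) (t j).2 v' hv'
    · intro y hy hyu
      have hlin' := hlin i hiU y
      have hsplit : ∀ x ∈ X₀, x ∈ A →
          (N.mod (Submodule.span F {y | ∃ v ∈ l', y = f v})).S
            (((n + 1) * d + (n + 1) * ((n + 1) * c)) + n * c + d) (f (update y i x)) := by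
        intro x hx hxA
        have hbase := hmodmono (hspan _ hlx')
          (hlx3 x₀ hx₀ _ (hmem hy hx₀) (hupd x₀ hyu))
        have hsum : (N.mod (Submodule.span F {y | ∃ v ∈ l', y = f v})).S
            (θ (k + 1) + k * c) (f (update y i (x₀ + x))) := by
          have hnot : ¬ ∀ a : Fin (k + 1) → F, N.S (θ (k + 1)) (∑ j, a j • f (update
              ((Fin.cons y v : Fin (k + 1) → ℕ → L) j) i (x₀ + x))) → a = 0 := fun h =>
            hQk' ⟨x₀ + x, A.add_mem hx₀ hxA, Fin.cons y v, fun j => by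
              refine Fin.cases ⟨hy, hyu⟩ (fun j => ?_) j
              exact hv j, h⟩
          push Not at hnot
          obtain ⟨a, hs, ha⟩ := hnot
          rw [Fin.sum_univ_succ] at hs
          simp only [Fin.cons_zero, Fin.cons_succ] at hs
          have hvx : ∀ j, f (update (v j) i (x₀ + x)) =
              f (update (v j) i x₀) + f (update (v j) i x) := fun j =>
            (hlin i hiU (v j)).map_add _ _
          have hsm : N.S (k * c) (∑ j, a (Fin.succ j) • f (update (v j) i x)) := by
            simpa using N.sum Finset.univ (c := c) fun j _ =>
              N.smul (a (Fin.succ j)) (hCs j x (hX₀C x hx j) hxA)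
          have hs2 : N.S (θ (k + 1) + k * c) (a 0 • f (update y i (x₀ + x)) +
              ∑ j, a (Fin.succ j) • f (update (v j) i x₀)) := by
            convert Nrm.sub hs hsm using 1
            simp only [hvx, smul_add, Finset.sum_add_distrib]
            abel
          -- If the coefficient of the new tuple vanished, the old values at `x₀` would be dependent
          -- up to `θ k`.
          by_cases ha0 : a 0 = 0
          · exfalso
            rw [ha0, zero_smul, zero_add] at hs2
            have hz := hind (fun j => a (Fin.succ j)) (N.mono hθ hs2)
            apply ha
            funext j
            refine Fin.cases ha0 (fun j => congrFun hz j) j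
          · refine ⟨-((a 0)⁻¹ • ∑ j, a (Fin.succ j) • f (update (v j) i x₀)), ?_, ?_⟩
            · refine Submodule.neg_mem _ (Submodule.smul_mem _ _ (Submodule.sum_mem _ fun j _ =>
                Submodule.smul_mem _ _ (Submodule.subset_span ⟨_, hlv' j, rfl⟩)))
            · convert N.smul (a 0)⁻¹ hs2 using 1
              rw [smul_add, smul_smul, inv_mul_cancel₀ ha0, one_smul, sub_neg_eq_add]
        have := Nrm.sub hsum hbase
        rw [hlin'.map_add, add_sub_cancel_left] at this
        refine Nrm.mono _ ?_ this
        have h0 : θ k ≤ (n + 1) * d + (n + 1) * ((n + 1) * c) := by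
          simp only [θ]
          exact Nat.add_le_add_left (Nat.mul_le_mul_right _ (by omega)) _
        omega
      obtain ⟨ξ, hξ⟩ := ht ⟨y i, hy i hiU⟩
      let x : A := ⟨y i, hy i hiU⟩ - ∑ j, ξ j • t j
      have hyi : y i = (x : L) + ∑ j, ξ j • (t j : L) := by
        simp [x]
      have hfy : f y = f (update y i x) + ∑ j, ξ j • f (update y i (t j)) := by
        have h1 : f y = hlin'.mk' _ (y i) := by simp [IsLinearMap.mk']
        rw [h1, hyi, map_add, map_sum]
        simp only [map_smul]
        rfl
      rw [hfy]
      refine Nrm.add _ (hsplit x hξ x.2) ?_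
      have := Nrm.sum (N := N.mod (Submodule.span F {y | ∃ v ∈ l', y = f v})) Finset.univ (c := d)
        (x := fun j => ξ j • f (update y i (t j))) fun j _ => Nrm.smul _ _
          (hmodmono (hspan _ (hlt' j)) (hlx3 (t j) (t j).2 _ (hmem hy (t j).2) (hupd _ hyu)))
      simpa using this

/-- If the values of a multilinear map become small when any single argument is restricted to a
subspace of bounded codimension, then all values lie in the span of boundedly many of them, up to
small errors. -/
theorem exists_spanning_values (N : Nrm F E) {A : Submodule F L} {U : Finset ℕ} {c : ℕ}
    {f : (ℕ → L) → E} (hlin : ∀ i ∈ U, ∀ u, IsLinearMap F fun a => f (update u i a))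
    (hcongr : ∀ u v : ℕ → L, (∀ j ∈ U, u j = v j) → f u = f v)
    (hslice : ∀ i ∈ U, ∀ u : ℕ → L, (∀ j ∈ U, u j ∈ A) → ∃ C : Submodule F L, CodimLE C c ∧
      ∀ a ∈ C, a ∈ A → N.S c (f (update u i a))) :
    ∃ l : List (ℕ → L), l.length ≤ (spanBound c U.card).1 ∧ (∀ v ∈ l, ∀ j ∈ U, v j ∈ A) ∧
      ∃ W : Submodule F E, Module.Finite F W ∧ Module.finrank F W ≤ (spanBound c U.card).1 ∧
      W = Submodule.span F {y | ∃ v ∈ l, y = f v} ∧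
      ∀ v : ℕ → L, (∀ j ∈ U, v j ∈ A) → (N.mod W).S (spanBound c U.card).2 (f v) := by
  obtain ⟨l, h1, h2, h3⟩ := exists_spanning_values_aux N hlin hslice U subset_rfl 0
    (fun _ _ => A.zero_mem)
  classical
  have e : {y | ∃ v ∈ l, y = f v} = ((l.map f).toFinset : Set E) := by
    ext y; simp [eq_comm]
  refine ⟨l, h1, h2, _, ?_, ?_, rfl, fun v hv => ?_⟩
  · rw [e]; infer_instance
  · rw [e]
    refine (finrank_span_finset_le_card _).trans ?_
    exact (List.toFinset_card_le _).trans (by simpa using h1)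
  · have := h3 (fun j => if j ∈ U then v j else 0) (fun j hj => by simpa [hj] using hv j hj)
      (fun j hj => by simp [hj])
    rwa [hcongr _ v fun j hj => by simp [hj]] at this

end Spanning

end LieType


namespace LieType

universe u v

open Function (update)

/-! ### Enlarging small subspaces to ideals. -/

section Ideal

variable {F : Type*} [Field F] {V : Type*} [AddCommGroup V] [Module F V]

theorem CodimLE.sup_span_singleton {C : Submodule F V} {k : ℕ} (hC : CodimLE C (k + 1)) {z : V}
    (hz : z ∉ C) : CodimLE (C ⊔ Submodule.span F {z}) k := by
  have hr := codimLE_iff_rank.1 hC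
  have hfin : Module.Finite F (V ⧸ C) :=
    Module.rank_lt_aleph0_iff.1 (hr.trans_lt Cardinal.natCast_lt_aleph0)
  rw [← Module.finrank_eq_rank, Nat.cast_le] at hr
  let D : Submodule F (V ⧸ C) := Submodule.span F {C.mkQ z}
  have hz' : C.mkQ z ≠ 0 := fun h => hz ((Submodule.Quotient.mk_eq_zero C).1 h)
  have h1 := Submodule.finrank_quotient_add_finrank D
  rw [finrank_span_singleton hz'] at h1
  refine CodimLE.of_ker_le (T := D.mkQ.comp C.mkQ) (by omega) ?_
  intro x hx
  have hx' : C.mkQ x ∈ D := (Submodule.Quotient.mk_eq_zero D).1 hx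
  obtain ⟨r, hr⟩ := Submodule.mem_span_singleton.1 hx'
  have h2 : x - r • z ∈ C := by
    rw [← Submodule.Quotient.mk_eq_zero, Submodule.Quotient.mk_sub, Submodule.Quotient.mk_smul,
      sub_eq_zero]
    exact hr.symm
  have : x = (x - r • z) + r • z := by abel
  rw [this]
  exact Submodule.add_mem_sup h2 (Submodule.smul_mem _ _ (Submodule.mem_span_singleton_self z))

variable {L : Type*} [NonUnitalNonAssocRing L] [Module F L]

/-- Multiplication increases the level by at most the factor `M`. -/
def Nrm.Inv (N : Nrm F L) (M : ℕ) : Prop :=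
  ∀ {c : ℕ} {d : L}, N.S c d → ∀ l : L, N.S (M * c) (d * l) ∧ N.S (M * c) (l * d)

/-- A product leaving `C` has level at most `M * s`, so it can be adjoined to `C`. This lowers the
codimension and multiplies the level by `M + 1`; hence an ideal is reached after at most `k` steps.
-/
theorem exists_ideal_of_small {N : Nrm F L} {M : ℕ} (hN : N.Inv M) (k : ℕ) :
    ∀ (s : ℕ) (C : Submodule F L), CodimLE C k → (∀ d ∈ C, N.S s d) →
    ∃ I : Submodule F L, IsIdeal I ∧ CodimLE I k ∧ ∀ d ∈ I, N.S ((M + 1) ^ k * s) d := by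
  induction k with
  | zero =>
    intro s C hC hs
    obtain ⟨g, hg⟩ := hC
    have hC : C = ⊤ := eq_top_iff.2 fun x _ => hg (Subsingleton.elim _ _)
    exact ⟨⊤, fun _ _ _ => ⟨trivial, trivial⟩, CodimLE.top, fun d _ => by
      simpa using hs d (hC ▸ trivial)⟩
  | succ k ih =>
    intro s C hC hs
    by_cases hI : IsIdeal C
    · exact ⟨C, hI, hC, fun d hd => N.mono (Nat.le_mul_of_pos_left s (by positivity)) (hs d hd)⟩
    · have : ∃ z, N.S (M * s) z ∧ z ∉ C := by
        unfold IsIdeal at hI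
        push Not at hI
        obtain ⟨x, hx, y, hxy⟩ := hI
        by_cases h : x * y ∈ C
        · exact ⟨_, (hN (hs x hx) y).2, hxy h⟩
        · exact ⟨_, (hN (hs x hx) y).1, h⟩
      obtain ⟨z, hz, hzC⟩ := this
      obtain ⟨I, h1, h2, h3⟩ := ih ((M + 1) * s) _ (hC.sup_span_singleton hzC) (by
        intro d hd
        obtain ⟨a, ha, b, hb, rfl⟩ := Submodule.mem_sup.1 hd
        obtain ⟨r, rfl⟩ := Submodule.mem_span_singleton.1 hb
        refine N.mono (le_of_eq ?_) (N.add (hs a ha) (N.smul r hz))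
        ring)
      refine ⟨I, h1, h2.mono le_rfl (Nat.le_succ k), fun d hd => ?_⟩
      have := h3 d hd
      rwa [← mul_assoc, ← pow_succ] at this

end Ideal

/-- All monomials of shape `T` are small when the letters are chosen generically one after the
other, in any order. -/
def Hyp {F : Type*} [Field F] {L : Type*} [NonUnitalNonAssocRing L] [Module F L] (T : Tr)
    (N : Nrm F L) (c : ℕ) : Prop :=
  ∀ ℓ : List ℕ, ℓ.Perm T.leaves → ∀ x : ℕ → L,
    Gen F c ℓ (fun z => ∀ f ∈ evl L T, N.S c (f z)) x

/-- Generic smallness of monomials of shape `T` implies smallness of all balanced products of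
fixed height in an ideal of bounded codimension. -/
def RT (T : Tr) : Prop :=
  ∃ K : ℕ, ∀ M c : ℕ, ∃ c' r : ℕ, ∀ (F : Type u) (L : Type v) [Field F]
    [NonUnitalNonAssocRing L] [Module F L] [IsScalarTower F L L] [SMulCommClass F L L],
    IsLieType F L → ∀ N : Nrm F L, N.Inv M → Hyp T N c →
    ∃ I : Submodule F L, IsIdeal I ∧ CodimLE I r ∧ ∀ d ∈ Pure I K, N.S c' d

/-! ### Operator families with some letters fixed and the others generic. -/

section Merge

variable {L : Type*}

/-- The coordinates in `U` are taken from `x`, the others from `z`. -/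
def mrg (U : Finset ℕ) (x z : ℕ → L) : ℕ → L := fun i => if i ∈ U then x i else z i

theorem mrg_of_mem {U : Finset ℕ} {i : ℕ} (h : i ∈ U) (x z : ℕ → L) : mrg U x z i = x i :=
  if_pos h

theorem mrg_of_notMem {U : Finset ℕ} {i : ℕ} (h : i ∉ U) (x z : ℕ → L) : mrg U x z i = z i :=
  if_neg h

theorem mrg_update_left {U : Finset ℕ} {i : ℕ} (h : i ∈ U) (x z : ℕ → L) (a : L) :
    mrg U (update x i a) z = update (mrg U x z) i a := by
  funext j
  by_cases hj : j = i
  · subst hj; simp [mrg, h]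
  · simp [mrg, hj]

theorem mrg_update_right {U : Finset ℕ} {i : ℕ} (h : i ∉ U) (x z : ℕ → L) (a : L) :
    mrg U x (update z i a) = update (mrg U x z) i a := by
  funext j
  by_cases hj : j = i
  · subst hj; simp [mrg, h]
  · simp [mrg, hj]

end Merge

section Mixed

variable {F : Type u} [Field F] {L : Type v} [NonUnitalNonAssocRing L] [Module F L]

/-- The space of families of operators on `L` depending on the generic letters. -/
abbrev OpFam (F : Type u) (L : Type v) [Field F] [NonUnitalNonAssocRing L] [Module F L]
    (ι : Type*) := ι → (ℕ → L) → (L →ₗ[F] L)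

/-- The family is small if its values at the monomials of shape `w`, transformed by the operators
in `τ`, are small for generic letters in `ℓ`. -/
def Nrm.fam (N : Nrm F L) (ι : Type*) (w : Tr) (ℓ : List ℕ) (τ : List (L →ₗ[F] L)) :
    Nrm F (OpFam F L ι) where
  S c Φ := Gen F c ℓ (fun z => ∀ φ, ∀ f ∈ evl L w, ∀ T ∈ τ, N.S c (Φ φ z (T (f z)))) 0
  mono h hx := hx.mono h fun _ hz φ f hf T hT => N.mono h (hz φ f hf T hT)
  zero := Gen.of_forall fun _ _ _ _ _ _ => N.zero
  add h h' := (h.and h').mono le_rfl fun _ hz φ f hf T hT =>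
    N.add (hz.1 φ f hf T hT) (hz.2 φ f hf T hT)
  smul r h := h.mono le_rfl fun _ hz φ f hf T hT => N.smul r (hz φ f hf T hT)

theorem Nrm.span_list {E α : Type*} [AddCommGroup E] [Module F E] (N : Nrm F E) {c : ℕ}
    (l : List α) (f : α → E) (h : ∀ a ∈ l, N.S c (f a)) :
    ∀ y ∈ Submodule.span F {y | ∃ a ∈ l, y = f a}, N.S (l.length * c) y := by
  induction l with
  | nil =>
    intro y hy
    have : y = 0 := by simpa using hy
    subst this
    exact N.zero' _
  | cons a l ih =>
    intro y hy
    have e : {y | ∃ b ∈ a :: l, y = f b} = insert (f a) {y | ∃ b ∈ l, y = f b} := by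
      ext y; simp
    rw [e] at hy
    obtain ⟨r, y', hy', rfl⟩ := Submodule.mem_span_insert.1 hy
    refine N.mono (le_of_eq ?_) (N.add (N.smul r (h a (by simp)))
      (ih (fun b hb => h b (by simp [hb])) y' hy'))
    rw [List.length_cons]; ring

variable [IsScalarTower F L L] [SMulCommClass F L L]

/-- The family of all operators given by the context `cs`, with the letters in `U` fixed. -/
def ctxFam (U : Finset ℕ) (cs : List Tr) (x : ℕ → L) : OpFam F L (Ctx F L cs) :=
  fun φ z => φ.1 (mrg U x z)

theorem ctxFam_linear {U : Finset ℕ} {cs : List Tr} (hcs : (labels cs).Nodup) {i : ℕ}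
    (hi : i ∈ U) (hi' : i ∈ labels cs) (x : ℕ → L) :
    IsLinearMap F fun a => (ctxFam U cs (update x i a) : OpFam F L (Ctx F L cs)) := by
  refine ⟨fun a b => ?_, fun r a => ?_⟩
  · funext φ z
    simp only [ctxFam, mrg_update_left hi, Pi.add_apply]
    exact (ctx_linear hcs φ.2 hi' _).map_add a b
  · funext φ z
    simp only [ctxFam, mrg_update_left hi, Pi.smul_apply]
    exact (ctx_linear hcs φ.2 hi' _).map_smul r a

theorem ctxFam_congr {U : Finset ℕ} {cs : List Tr} {x y : ℕ → L} (h : ∀ i ∈ U, x i = y i) :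
    (ctxFam U cs x : OpFam F L (Ctx F L cs)) = ctxFam U cs y := by
  funext φ z
  have : mrg U x z = mrg U y z := by
    funext i
    by_cases hi : i ∈ U
    · simp [mrg, hi, h i hi]
    · simp [mrg, hi]
  rw [ctxFam, ctxFam, this]

theorem fam_ctxFam_iff {N : Nrm F L} {U : Finset ℕ} {w : Tr} {cs : List Tr} {ℓ : List ℕ}
    (hw : ∀ i ∈ w.leaves, i ∈ ℓ) (hcs : ∀ i ∈ labels cs, i ∈ ℓ ∨ i ∈ U) (hℓ : ∀ i ∈ ℓ, i ∉ U)
    {c : ℕ} {x : ℕ → L} :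
    (N.fam (Ctx F L cs) w ℓ [LinearMap.id]).S c (ctxFam U cs x) ↔
      Gen F c ℓ (fun z => ∀ h ∈ Vals F L cs w, N.S c (h z)) x := by
  have key : ∀ z z' : ℕ → L, (∀ i ∈ ℓ, z i = z' i) → (∀ i ∉ ℓ, z' i = x i) →
      ∀ φ ∈ Ctx F L cs, ∀ f ∈ evl L w, φ (mrg U x z) (f z) = φ z' (f z') := by
    intro z z' h1 h2 φ hφ f hf
    rw [evl_congr hf fun i hi => h1 i (hw i hi)]
    congr 1
    refine ctx_congr hφ fun i hi => ?_
    by_cases hiU : i ∈ U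
    · rw [mrg_of_mem hiU, h2 i fun h => hℓ i h hiU]
    · rw [mrg_of_notMem hiU, h1 i ((hcs i hi).resolve_right hiU)]
  constructor
  · intro h
    refine Gen.transfer h fun z z' h1 _ h2 hz => ?_
    rintro _ ⟨φ, hφ, f, hf, rfl⟩
    have := hz ⟨φ, hφ⟩ f hf LinearMap.id (by simp)
    rwa [LinearMap.id_apply, ctxFam, key z z' h1 h2 φ hφ f hf] at this
  · intro h
    refine Gen.transfer h fun z' z h1 h2 _ hz => ?_
    intro φ f hf T hT
    rw [List.mem_singleton] at hT
    subst hT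
    rw [LinearMap.id_apply, ctxFam, key z z' (fun i hi => (h1 i hi).symm) h2 φ.1 φ.2 f hf]
    exact hz _ ⟨φ.1, φ.2, f, hf, rfl⟩

end Mixed

end LieType


namespace LieType

universe u v

open Function (update)

/-! ### The filtration by the action beside a subtree. -/

section Star

variable {F : Type u} [Field F] {L : Type v} [NonUnitalNonAssocRing L] [Module F L]

theorem update_mem_of_mem {A : Submodule F L} {U : Finset ℕ} {x : ℕ → L}
    (hx : ∀ i ∈ U, x i ∈ A) {j : ℕ} {a : L} (ha : a ∈ A) : ∀ i ∈ U, update x j a i ∈ A := by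
  intro i hi
  by_cases h : i = j
  · subst h; simpa using ha
  · simpa [h] using hx i hi

theorem gen_hit_right {U : Finset ℕ} {ℓ : List ℕ} {c : ℕ} {Q : (ℕ → L) → Prop} {x : ℕ → L}
    (h : Gen F c ℓ (fun z => Q (mrg U x z)) 0) {j : ℕ} (hj : j ∉ U) (T : L →ₗ[F] L) :
    Gen F c ℓ (fun z => Q (update (mrg U x z) j (T (mrg U x z j)))) 0 := by
  have h0 : update (0 : ℕ → L) j (T ((0 : ℕ → L) j)) = 0 := by simp
  rw [← h0] at h
  refine (Gen.subst T h).mono le_rfl fun z hz => ?_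
  rwa [mrg_update_right hj, ← mrg_of_notMem hj x z] at hz

variable [IsScalarTower F L L] [SMulCommClass F L L]

/-- The Leibniz rule rearranged: `l` is taken off the factor `a` and placed on the product or on the
other factor. -/
theorem small_mul_ops (hL : IsLieType F L) (N : Nrm F L) {k k' : ℕ} {v a l : L}
    (h : ∀ T ∈ ops F l, N.S k (T (v * a)) ∧ N.S k (T (a * v)))
    (h' : ∀ T ∈ ops F l, N.S k' (T v * a) ∧ N.S k' (a * T v)) :
    ∀ T ∈ ops F l, N.S (k + k') (v * T a) ∧ N.S (k + k') (T a * v) := by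
  rw [forall_ops] at h h' ⊢
  obtain ⟨⟨p1, p2⟩, p3, p4⟩ := h
  obtain ⟨⟨q1, q2⟩, q3, q4⟩ := h'
  simp only [LinearMap.mulLeft_apply, LinearMap.mulRight_apply] at *
  refine ⟨⟨?_, hL.small_mul_mul N p2 q1⟩, hL.small_mul_mul' N p3 q3, ?_⟩
  · rw [add_comm]; exact hL.small_mul_mul' N q3 p3
  · rw [add_comm]; exact hL.small_mul_mul N q2 p4

theorem fam_ctxFam_iff' {N : Nrm F L} {U : Finset ℕ} {w : Tr} {cs : List Tr} {ℓ : List ℕ}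
    (hwU : ∀ i ∈ w.leaves, i ∉ U) {c : ℕ} {τ : List (L →ₗ[F] L)} {x : ℕ → L} :
    (N.fam (Ctx F L cs) w ℓ τ).S c (ctxFam U cs x) ↔
      Gen F c ℓ (fun z => ∀ φ ∈ Ctx F L cs, ∀ f ∈ evl L w, ∀ T ∈ τ,
        N.S c (φ (mrg U x z) (T (f (mrg U x z))))) 0 := by
  have key : ∀ z : ℕ → L, ∀ f ∈ evl L w, f (mrg U x z) = f z := fun z f hf =>
    evl_congr hf fun i hi => mrg_of_notMem (hwU i hi) x z
  constructor
  · intro h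
    refine h.mono le_rfl fun z hz φ hφ f hf T hT => ?_
    rw [key z f hf]
    exact hz ⟨φ, hφ⟩ f hf T hT
  · intro h
    refine h.mono le_rfl fun z hz φ f hf T hT => ?_
    rw [← key z f hf]
    exact hz φ.1 φ.2 f hf T hT

theorem ops_mem_ideal {A : Submodule F L} (hA : IsIdeal A) {a l : L} (ha : a ∈ A) :
    ∀ T ∈ ops F l, T a ∈ A := by
  rw [forall_ops]
  exact ⟨(hA a ha l).2, (hA a ha l).1⟩

/-- A hit letter of `U` stays in the ideal `A`; for a letter outside `U` the hit is a linear
substitution. -/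
theorem gen_hit {A : Submodule F L} (hA : IsIdeal A) {U : Finset ℕ} {ℓ : List ℕ} {c : ℕ}
    {Q : (ℕ → L) → Prop}
    (h : ∀ x : ℕ → L, (∀ i ∈ U, x i ∈ A) → Gen F c ℓ (fun z => Q (mrg U x z)) 0)
    {x : ℕ → L} (hx : ∀ i ∈ U, x i ∈ A) (j : ℕ) {l : L} {T : L →ₗ[F] L} (hT : T ∈ ops F l) :
    Gen F c ℓ (fun z => Q (update (mrg U x z) j (T (mrg U x z j)))) 0 := by
  by_cases hj : j ∈ U
  · have hx' : ∀ i ∈ U, update x j (T (x j)) i ∈ A :=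
      update_mem_of_mem hx (ops_mem_ideal hA (hx j hj) T hT)
    refine (h _ hx').mono le_rfl fun z hz => ?_
    rwa [mrg_update_left hj, ← mrg_of_mem hj x z] at hz
  · exact gen_hit_right (h x hx) hj T

/-- For a product of `a` and `l` standing beside w, the factor `l` is moved either onto w, where it
hits letters, or onto the product of w and `a`, from which `small_ctx_ops` carries it outwards. What
remains is `a` beside w, with at most one letter hit. -/
theorem small_star_mul (hL : IsLieType F L) {w : Tr} {cs : List Tr}
    (hnd : (w.leaves ++ labels cs).Nodup) {N : Nrm F L} {M : ℕ} (hN : N.Inv M) {c : ℕ} {a l : L}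
    {y : ℕ → L}
    (h₀ : ∀ φ ∈ Ctx F L cs, ∀ f ∈ evl L w, ∀ T ∈ ops F a, N.S c (φ y (T (f y))))
    (h : ∀ j ∈ w.leaves ++ labels cs, ∀ T' ∈ ops F l, ∀ φ ∈ Ctx F L cs, ∀ f ∈ evl L w,
      ∀ T ∈ ops F a, N.S c (φ (update y j (T' (y j))) (T (f (update y j (T' (y j)))))))
    {φ : (ℕ → L) → (L →ₗ[F] L)} (hφ : φ ∈ Ctx F L cs) {f : (ℕ → L) → L} (hf : f ∈ evl L w) :
    ∀ T' ∈ ops F l, ∀ T ∈ ops F (T' a),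
      N.S ((((labels cs).length + 1) * (M + 1) + w.leaves.length) * c) (φ y (T (f y))) := by
  rw [List.nodup_append'] at hnd
  have hf' : ∀ f ∈ evl L w, ∀ j ∈ labels cs, ∀ a, f (update y j a) = f y := fun f hf j hj =>
    evl_update_of_notMem hf (fun h' => hnd.2.2 h' hj) y
  have hφ' : ∀ j ∈ w.leaves, ∀ a, φ (update y j a) = φ y := fun j hj =>
    ctx_update_of_notMem hφ (fun h' => hnd.2.2 hj h') y
  have A : ∀ T ∈ ops F a, ∀ T' ∈ ops F l,
      N.S (((labels cs).length + 1) * ((M + 1) * c)) (φ y (T' (T (f y)))) := fun T hT =>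
    small_ctx_ops hL hnd.2.1 hφ N (fun ψ hψ => by
      have := hN (h₀ ψ hψ f hf T hT) l
      rw [forall_ops]
      exact ⟨N.mono (Nat.mul_le_mul_right c (Nat.le_succ M)) this.2,
        N.mono (Nat.mul_le_mul_right c (Nat.le_succ M)) this.1⟩)
      (fun j hj T' hT' ψ hψ => by
        have := h j (List.mem_append_right _ hj) T' hT' ψ hψ f hf T hT
        rw [hf' f hf j hj] at this
        exact N.mono (Nat.le_mul_of_pos_left c (Nat.succ_pos M)) this)
  have B : ∀ T ∈ ops F a, ∀ T' ∈ ops F l, N.S (w.leaves.length * c) (φ y (T (T' (f y)))) :=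
    fun T hT => small_ops_evl hL hnd.1 hf (N.comap ((φ y).comp T)) (fun j hj T' hT' g hg => by
      have := h j (List.mem_append_left _ hj) T' hT' φ hφ g hg T hT
      rwa [hφ' j hj] at this)
  have key := small_mul_ops hL (N.comap (φ y)) (v := f y) (a := a) (l := l)
    (fun T' hT' => ⟨A (LinearMap.mulRight F a) (by simp [ops]) T' hT',
      A (LinearMap.mulLeft F a) (by simp [ops]) T' hT'⟩)
    (k := ((labels cs).length + 1) * ((M + 1) * c)) (k' := w.leaves.length * c)
    (fun T' hT' => ⟨B (LinearMap.mulRight F a) (by simp [ops]) T' hT',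
      B (LinearMap.mulLeft F a) (by simp [ops]) T' hT'⟩)
  intro T' hT'
  have e : ((labels cs).length + 1) * ((M + 1) * c) + w.leaves.length * c =
    (((labels cs).length + 1) * (M + 1) + w.leaves.length) * c := by ring
  rw [forall_ops, ← e]
  exact ⟨(key T' hT').2, (key T' hT').1⟩

/-- The element `a` is small if it annihilates all context families, up to small errors, when
applied next to the monomial of shape `w`. -/
def Nrm.star (N : Nrm F L) (A : Submodule F L) (U : Finset ℕ) (w : Tr) (cs : List Tr)
    (ℓ : List ℕ) : Nrm F L where
  S c a := ∀ x : ℕ → L, (∀ i ∈ U, x i ∈ A) →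
    (N.fam (Ctx F L cs) w ℓ (ops F a)).S c (ctxFam U cs x)
  mono h hx x hxA := Nrm.mono _ h (hx x hxA)
  zero x _ := Gen.of_forall fun z φ f hf => by
    rw [forall_ops]; simpa using N.zero
  add h h' x hx := ((h x hx).and (h' x hx)).mono le_rfl fun z hz φ f hf => by
    have h1 := forall_ops.1 (hz.1 φ f hf)
    have h2 := forall_ops.1 (hz.2 φ f hf)
    rw [forall_ops]
    simp only [LinearMap.mulLeft_apply, LinearMap.mulRight_apply, add_mul, mul_add, map_add] at *
    exact ⟨N.add h1.1 h2.1, N.add h1.2 h2.2⟩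
  smul r h x hx := (h x hx).mono le_rfl fun z hz φ f hf => by
    have h1 := forall_ops.1 (hz φ f hf)
    rw [forall_ops]
    simp only [LinearMap.mulLeft_apply, LinearMap.mulRight_apply, smul_mul_assoc,
      mul_smul_comm, map_smul] at *
    exact ⟨N.smul r h1.1, N.smul r h1.2⟩

/-- The invariance factor of `Nrm.star`. -/
def starFactor (w : Tr) (cs : List Tr) (M : ℕ) : ℕ :=
  1 + (w.leaves ++ labels cs).length * 2 +
    (((labels cs).length + 1) * (M + 1) + w.leaves.length)

theorem star_inv (hL : IsLieType F L) {w : Tr} {cs : List Tr}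
    (hnd : (w.leaves ++ labels cs).Nodup) {N : Nrm F L} {M : ℕ} (hN : N.Inv M) {U : Finset ℕ}
    (hwU : ∀ i ∈ w.leaves, i ∉ U) {A : Submodule F L} (hA : IsIdeal A) (ℓ : List ℕ) :
    (N.star A U w cs ℓ).Inv (starFactor w cs M) := by
  intro c a h l
  suffices ∀ T' ∈ ops F l, (N.star A U w cs ℓ).S (starFactor w cs M * c) (T' a) from
    ⟨(forall_ops.1 this).2, (forall_ops.1 this).1⟩
  intro T₀ hT₀ x hx
  replace h := fun x hx => (fam_ctxFam_iff' hwU).1 (h x hx)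
  have hits := Gen.forall_list (F := F) (c := c) (ℓ := ℓ) (x := 0)
    ((w.leaves ++ labels cs) ×ˢ ops F l) (fun p hp =>
      gen_hit hA (Q := fun y => ∀ φ ∈ Ctx F L cs, ∀ f ∈ evl L w, ∀ T ∈ ops F a,
        N.S c (φ y (T (f y)))) h hx p.1 (T := p.2) (l := l) (List.mem_product.1 hp).2)
  have len : ((w.leaves ++ labels cs) ×ˢ ops F l).length =
      (w.leaves ++ labels cs).length * 2 := by
    simp [List.length_product, ops]
  rw [fam_ctxFam_iff' hwU]
  refine ((h x hx).and hits).mono ?_ fun z hz φ hφ f hf T hT => ?_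
  · rw [len, starFactor]
    have : (1 + (w.leaves ++ labels cs).length * 2 + (((labels cs).length + 1) * (M + 1) +
      w.leaves.length)) * c = c + (w.leaves ++ labels cs).length * 2 * c +
      (((labels cs).length + 1) * (M + 1) + w.leaves.length) * c := by ring
    omega
  · refine N.mono (Nat.mul_le_mul_right c (Nat.le_add_left _ _)) (small_star_mul hL hnd hN hz.1
      (fun j hj T' hT' => hz.2 (j, T') (List.mem_product.2 ⟨hj, hT'⟩)) hφ hf T₀ hT₀ T hT)

end Star

end LieType


namespace LieType

universe u v

open Function (update)

/-! ### Generic values of the inner subtree are small for the star filtration. -/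

section HypStar

variable {F : Type u} [Field F] {L : Type v} [NonUnitalNonAssocRing L] [Module F L]
  [IsScalarTower F L L] [SMulCommClass F L L]

/-- Let g be the value of `s` in the context. The product of g with dw reduces to d times gw and to
dg times w, up to orientation. In the first term g hits the letters of `w`, leaving `d` as the
sibling; in the second `d` hits the letters of `s`. -/
theorem small_ops_of_hits (hL : IsLieType F L) {w s : Tr} {ts : List Tr}
    (hnd : (w.leaves ++ labels (s :: ts)).Nodup) (N : Nrm F L) {c : ℕ} {d : L} {y : ℕ → L}
    (hα : ∀ j ∈ w.leaves, ∀ g ∈ evl L s, ∀ T ∈ ops F (g y), ∀ ψ ∈ Ctx F L ts, ∀ f ∈ evl L w,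
      ∀ T' ∈ ops F d, N.S c (ψ y (T' (f (update y j (T (y j)))))))
    (hβ : ∀ j ∈ s.leaves, ∀ T ∈ ops F d, ∀ φ ∈ Ctx F L (s :: ts), ∀ f ∈ evl L w,
      N.S c (φ (update y j (T (y j))) (f y)))
    {φ : (ℕ → L) → (L →ₗ[F] L)} (hφ : φ ∈ Ctx F L (s :: ts)) {f : (ℕ → L) → L}
    (hf : f ∈ evl L w) :
    ∀ T ∈ ops F d, N.S ((w.leaves.length + s.leaves.length) * c) (φ y (T (f y))) := by
  rw [List.nodup_append', labels_cons, List.nodup_append'] at hnd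
  obtain ⟨hw, ⟨hs, hts, hd⟩, hwd⟩ := hnd
  obtain ⟨g, hg, ψ, hψ, hφ⟩ := hφ
  have hψ' : ∀ j ∈ s.leaves, ∀ a, ψ (update y j a) = ψ y := fun j hj =>
    ctx_update_of_notMem hψ (fun h' => hd hj h') y
  have A : ∀ T ∈ ops F d, ∀ T' ∈ ops F (g y),
      N.S (w.leaves.length * c) (ψ y (T (T' (f y)))) := fun T hT =>
    small_ops_evl hL hw hf (N.comap ((ψ y).comp T)) fun j hj T' hT' f' hf' =>
      hα j hj g hg T' hT' ψ hψ f' hf' T hT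
  have B1 := small_ops_evl hL hs hg (N.comap ((ψ y).comp (LinearMap.mulRight F (f y))))
    (l := d) (c := c) (fun j hj T hT g' hg' => by
      have := hβ j hj T hT _ ⟨g', hg', ψ, hψ, Or.inl rfl⟩ f hf
      simpa [hψ' j hj, Nrm.comap] using this)
  have B2 := small_ops_evl hL hs hg (N.comap ((ψ y).comp (LinearMap.mulLeft F (f y))))
    (l := d) (c := c) (fun j hj T hT g' hg' => by
      have := hβ j hj T hT _ ⟨g', hg', ψ, hψ, Or.inr rfl⟩ f hf
      simpa [hψ' j hj, Nrm.comap] using this)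
  have key := small_mul_ops hL (N.comap (ψ y)) (v := g y) (a := f y) (l := d)
    (k := w.leaves.length * c) (k' := s.leaves.length * c)
    (fun T hT => ⟨A T hT (LinearMap.mulLeft F (g y)) (by simp [ops]),
      A T hT (LinearMap.mulRight F (g y)) (by simp [ops])⟩)
    (fun T hT => ⟨B1 T hT, B2 T hT⟩)
  intro T hT
  rw [add_mul]
  rcases hφ with rfl | rfl
  exacts [(key T hT).1, (key T hT).2]

/-- In `hα` the subtree `s` carries the new letters `y`, so that `d y` fills its slot while the old
values of `s` hit `w`. In `hβ` the slot keeps the letters `u`, one of them multiplied by `d y`. -/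
theorem fam_ops_of_hits (hL : IsLieType F L) {w s : Tr} {ts : List Tr}
    (hnd : (w.leaves ++ labels (s :: ts)).Nodup) {U : Finset ℕ} (hwU : ∀ i ∈ w.leaves, i ∉ U)
    (hsU : ∀ i ∈ s.leaves, i ∈ U) (N : Nrm F L) {ℓ : List ℕ} {c : ℕ} {y u : ℕ → L}
    (hα : (N.fam (Ctx F L (s :: ts)) w ℓ [LinearMap.id]).S c
      (ctxFam U (s :: ts) (mrg s.leaves.toFinset y u)))
    {d : (ℕ → L) → L} (hd : d ∈ evl L s)
    (hβ : ∀ j ∈ s.leaves, ∀ T ∈ ops F (d y),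
      (N.fam (Ctx F L (s :: ts)) w ℓ [LinearMap.id]).S c
        (ctxFam U (s :: ts) (update u j (T (u j))))) :
    (N.fam (Ctx F L (s :: ts)) w ℓ (ops F (d y))).S
      ((w.leaves.length * (s.count * 2) + s.leaves.length * 2 +
        (w.leaves.length + s.leaves.length)) * c) (ctxFam U (s :: ts) u) := by
  have hnd' := hnd
  rw [List.nodup_append', labels_cons, List.nodup_append'] at hnd'
  obtain ⟨hw, ⟨hs, hts, hdis⟩, hwd⟩ := hnd'
  rw [fam_ctxFam_iff' hwU] at hα ⊢
  have hα' := Gen.forall_list (F := F) (c := c) (ℓ := ℓ) (x := 0)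
    (w.leaves ×ˢ (evl L s).flatMap fun g => ops F (g u)) (fun p hp =>
      gen_hit_right (Q := fun y => ∀ φ ∈ Ctx F L (s :: ts), ∀ f ∈ evl L w,
        ∀ T ∈ [LinearMap.id], N.S c (φ y (T (f y)))) hα
        (hwU _ (List.mem_product.1 hp).1) p.2)
  have hβ' := Gen.forall_list (F := F) (c := c) (ℓ := ℓ) (x := 0) (s.leaves ×ˢ ops F (d y))
    (fun p hp => (fam_ctxFam_iff' hwU).1
      (hβ p.1 (List.mem_product.1 hp).1 p.2 (List.mem_product.1 hp).2))
  have len1 : (w.leaves ×ˢ (evl L s).flatMap fun g => ops F (g u)).length =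
      w.leaves.length * (s.count * 2) := by
    simp [List.length_product, List.length_flatMap, ops, length_evl]
  have len2 : (s.leaves ×ˢ ops F (d y)).length = s.leaves.length * 2 := by
    simp [List.length_product, ops]
  rw [len1] at hα'
  rw [len2] at hβ'
  refine (hα'.and hβ').mono ?_ fun z hz φ hφ f hf T hT => ?_
  · rw [← add_mul]
    exact Nat.mul_le_mul_right c (Nat.le_add_right _ _)
  refine N.mono (Nat.mul_le_mul_right c (Nat.le_add_left _ _))
    (small_ops_of_hits hL hnd N (c := c) (d := d y) ?_ ?_ hφ hf T hT)
  · intro j hj g hg T₁ hT₁ ψ hψ f' hf' T' hT'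
    have hgu : g (mrg U u z) = g u := evl_congr hg fun i hi => mrg_of_mem (hsU i hi) _ _
    rw [hgu] at hT₁
    have := fun φ hφ => hz.1 (j, T₁) (List.mem_product.2 ⟨hj, List.mem_flatMap.2 ⟨g, hg, hT₁⟩⟩)
      φ hφ f' hf' LinearMap.id (by simp)
    simp only [LinearMap.id_apply] at this
    have hjs : j ∉ s.leaves := fun h' => hwd hj (by simp [h'])
    have hjt : j ∉ labels ts := fun h' => hwd hj (by simp [h'])
    have e1 : ∀ a, d (update (mrg U (mrg s.leaves.toFinset y u) z) j a) = d y := fun a => by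
      rw [evl_update_of_notMem hd hjs]
      refine evl_congr hd fun i hi => ?_
      rw [mrg_of_mem (hsU i hi), mrg_of_mem (by simpa using hi)]
    have e2 : ∀ a, ψ (update (mrg U (mrg s.leaves.toFinset y u) z) j a) = ψ (mrg U u z) :=
        fun a => by
      rw [ctx_update_of_notMem hψ hjt]
      refine ctx_congr hψ fun i hi => ?_
      have hi' : i ∉ s.leaves.toFinset := fun h' => hdis (by simpa using h') hi
      by_cases hiU : i ∈ U
      · rw [mrg_of_mem hiU, mrg_of_mem hiU, mrg_of_notMem hi']
      · rw [mrg_of_notMem hiU, mrg_of_notMem hiU]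
    have e3 : f' (update (mrg U (mrg s.leaves.toFinset y u) z) j
        (T₁ (mrg U (mrg s.leaves.toFinset y u) z j))) =
        f' (update (mrg U u z) j (T₁ (mrg U u z j))) := by
      refine evl_congr hf' fun i hi => ?_
      rw [mrg_of_notMem (hwU j hj), mrg_of_notMem (hwU j hj)]
      by_cases hij : i = j
      · subst hij; simp
      · rw [Function.update_of_ne hij, Function.update_of_ne hij, mrg_of_notMem (hwU i hi),
          mrg_of_notMem (hwU i hi)]
    have h1 := this _ ⟨d, hd, ψ, hψ, Or.inl rfl⟩
    have h2 := this _ ⟨d, hd, ψ, hψ, Or.inr rfl⟩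
    simp only [LinearMap.comp_apply, LinearMap.mulLeft_apply, LinearMap.mulRight_apply, e1, e2,
      e3] at h1 h2
    revert T'
    rw [forall_ops]
    exact ⟨h1, h2⟩
  · intro j hj T₁ hT₁ φ' hφ' f' hf'
    have := hz.2 (j, T₁) (List.mem_product.2 ⟨hj, hT₁⟩) φ' hφ' f' hf' LinearMap.id (by simp)
    simp only [LinearMap.id_apply] at this
    rw [mrg_update_left (hsU j hj)] at this
    rw [evl_update_of_notMem hf' (fun h' => hwd h' (by simp [hj]))] at this
    rwa [mrg_of_mem (hsU j hj)]

variable (F L) in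
/-- The families that do not depend on the letters of `w`. -/
def indepFam (ι : Type*) (w : Tr) : Submodule F (OpFam F L ι) where
  carrier := {Φ | ∀ φ, ∀ j ∈ w.leaves, ∀ z a, Φ φ (update z j a) = Φ φ z}
  zero_mem' := fun _ _ _ _ _ => rfl
  add_mem' h h' φ j hj z a := by rw [Pi.add_apply, Pi.add_apply, h φ j hj, h' φ j hj]; rfl
  smul_mem' r Φ h φ j hj z a := by rw [Pi.smul_apply, Pi.smul_apply, h φ j hj]; rfl

theorem ctxFam_mem_indepFam {w : Tr} {cs : List Tr} (hnd : (w.leaves ++ labels cs).Nodup)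
    {U : Finset ℕ} (hwU : ∀ i ∈ w.leaves, i ∉ U) (x : ℕ → L) :
    ctxFam U cs x ∈ indepFam F L (Ctx F L cs) w := by
  intro φ j hj z a
  rw [List.nodup_append'] at hnd
  rw [ctxFam, mrg_update_right (hwU j hj), ctx_update_of_notMem φ.2 (fun h' => hnd.2.2 hj h')]
  rfl

/-- The factor `d` is distributed over the letters of `w`, which `Φ` does not see. This handles
error terms whose only known structure is that independence. -/
theorem fam_ops_of_indep (hL : IsLieType F L) {w : Tr} (hw : w.leaves.Nodup) (N : Nrm F L)
    {ι : Type*} {ℓ : List ℕ} {c : ℕ} {Φ : OpFam F L ι} (hΦ : Φ ∈ indepFam F L ι w)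
    (h : (N.fam ι w ℓ [LinearMap.id]).S c Φ) (d : L) :
    (N.fam ι w ℓ (ops F d)).S ((w.leaves.length * 2 + w.leaves.length) * c) Φ := by
  have h0 : ∀ (j : ℕ) (T : L →ₗ[F] L), update (0 : ℕ → L) j (T ((0 : ℕ → L) j)) = 0 := by simp
  have hits := Gen.forall_list (F := F) (c := c) (ℓ := ℓ) (x := 0) (w.leaves ×ˢ ops F d)
    (P := fun p z => ∀ φ, ∀ f ∈ evl L w, ∀ T ∈ [LinearMap.id],
      N.S c (Φ φ (update z p.1 (p.2 (z p.1))) (T (f (update z p.1 (p.2 (z p.1)))))))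
    (fun p _ => Gen.subst (j := p.1) (P := fun z => ∀ φ, ∀ f ∈ evl L w, ∀ T ∈ [LinearMap.id],
      N.S c (Φ φ z (T (f z)))) p.2 (by rw [h0]; exact h))
  have len : (w.leaves ×ˢ ops F d).length = w.leaves.length * 2 := by
    simp [List.length_product, ops]
  rw [len] at hits
  refine hits.mono (Nat.mul_le_mul_right c (Nat.le_add_right _ _)) fun z hz φ f hf => ?_
  have := small_ops_evl hL hw hf (N.comap (Φ φ z)) (x := z) (l := d) (c := c)
    (fun j hj T hT g hg => by
      have := hz (j, T) (List.mem_product.2 ⟨hj, hT⟩) φ g hg LinearMap.id (by simp)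
      rwa [LinearMap.id_apply, hΦ φ j hj] at this)
  exact fun T hT => N.mono (Nat.mul_le_mul_right c (Nat.le_add_left _ _)) (this T hT)

/-- The level at which the monomials of shape `s` are small for `Nrm.star`. -/
def starLevel (w s : Tr) (n c b : ℕ) : ℕ :=
  n * c + n * (s.leaves.length * s.count) * (c + c) +
    (n * ((w.leaves.length * (s.count * 2) + s.leaves.length * 2 +
        (w.leaves.length + s.leaves.length)) * c) +
      (w.leaves.length * 2 + w.leaves.length) * b)

/-- Star smallness quantifies over all `x`, but up to a small error only the families of the list
`us` have to be tested. Hence boundedly many generic conditions on the letters of `s` suffice. -/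
theorem hyp_star (hL : IsLieType F L) {w s : Tr} {ts : List Tr}
    (hnd : (w.leaves ++ labels (s :: ts)).Nodup) {U : Finset ℕ} (hwU : ∀ i ∈ w.leaves, i ∉ U)
    (hsU : ∀ i ∈ s.leaves, i ∈ U) (N : Nrm F L) {ℓ : List ℕ} {c n b : ℕ} {A : Submodule F L}
    (hA : IsIdeal A)
    (hα : ∀ u : ℕ → L, (∀ i ∈ U, u i ∈ A) → ∀ ℓ' : List ℕ, ℓ'.Perm s.leaves → ∀ y : ℕ → L,
      Gen F c ℓ' (fun y => (N.fam (Ctx F L (s :: ts)) w ℓ [LinearMap.id]).S c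
        (ctxFam U (s :: ts) (mrg s.leaves.toFinset y u))) y)
    (hslice : ∀ i ∈ U, ∀ u : ℕ → L, (∀ j ∈ U, u j ∈ A) → ∃ C : Submodule F L, CodimLE C c ∧
      ∀ a ∈ C, a ∈ A → (N.fam (Ctx F L (s :: ts)) w ℓ [LinearMap.id]).S c
        (ctxFam U (s :: ts) (update u i a)))
    {us : List (ℕ → L)} (hlen : us.length ≤ n) (hus : ∀ u ∈ us, ∀ i ∈ U, u i ∈ A)
    (hspan : ∀ x : ℕ → L, (∀ i ∈ U, x i ∈ A) →
      ((N.fam (Ctx F L (s :: ts)) w ℓ [LinearMap.id]).mod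
        (Submodule.span F {y | ∃ u ∈ us, y = ctxFam U (s :: ts) u})).S b
          (ctxFam U (s :: ts) x)) :
    Hyp s (N.star A U w (s :: ts) ℓ) (starLevel w s n c b) := by
  intro ℓ' hℓ' y₀
  have hsnd : s.leaves.Nodup := by
    rw [List.nodup_append', labels_cons, List.nodup_append'] at hnd
    exact hnd.2.1.1
  have hne : ℓ' ≠ [] := fun h => s.leaves_ne_nil (by rw [h] at hℓ'; simpa using hℓ'.symm)
  choose! C hC hCs using hslice
  have g1 := Gen.forall_list (F := F) us (fun u hu => hα u (hus u hu) ℓ' hℓ' y₀)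
  -- The value of `s` must send each letter `u j` into its slice. This is a linear condition on any
  -- single letter of `s`, once for left and once for right multiplication.
  have g2 := Gen.forall_list (F := F) (c := c + c) (ℓ := ℓ') (x := y₀)
    (us ×ˢ (s.leaves ×ˢ evl L s))
    (P := fun p y => ∀ T ∈ ops F (p.2.2 y), T (p.1 p.2.1) ∈ C p.2.1 p.1) (by
      rintro ⟨u, j, d⟩ hp
      simp only [List.mem_product] at hp
      obtain ⟨hu, hj, hd⟩ := hp
      refine Gen.of_slices hne (fun k hk z => ?_) y₀
      have hlin := evl_linear F hsnd hd (hℓ'.subset hk) z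
      let D := hlin.mk' _
      refine ⟨((C j u).comap ((LinearMap.mulRight F (u j)).comp D)) ⊓
        ((C j u).comap ((LinearMap.mulLeft F (u j)).comp D)),
        ((hC j (hsU j hj) u (hus u hu)).comap _).inf ((hC j (hsU j hj) u (hus u hu)).comap _), ?_⟩
      rintro a ⟨ha, ha'⟩
      rw [forall_ops]
      exact ⟨ha, ha'⟩)
  have len2 : (us ×ˢ (s.leaves ×ˢ evl L s)).length = us.length * (s.leaves.length * s.count) := by
    simp [List.length_product, length_evl]
  rw [len2] at g2
  have l1 : us.length * c ≤ n * c := Nat.mul_le_mul_right _ hlen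
  have l2 : us.length * (s.leaves.length * s.count) * (c + c) ≤
      n * (s.leaves.length * s.count) * (c + c) :=
    Nat.mul_le_mul_right _ (Nat.mul_le_mul_right _ hlen)
  refine (g1.and g2).mono ?_ fun y hy d hd x hx => ?_
  · rw [starLevel]; omega
  obtain ⟨Ψ, hΨ, hΦ⟩ := hspan x hx
  have hΨind : Submodule.span F {y | ∃ u ∈ us, y = ctxFam U (s :: ts) u} ≤
      indepFam F L (Ctx F L (s :: ts)) w := by
    refine Submodule.span_le.2 ?_
    rintro _ ⟨u, -, rfl⟩
    exact ctxFam_mem_indepFam hnd hwU u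
  have h1 := fam_ops_of_indep hL (List.nodup_append'.1 hnd).1 N
    (Submodule.sub_mem _ (ctxFam_mem_indepFam hnd hwU x) (hΨind hΨ)) hΦ (d y)
  have h2 := (N.fam (Ctx F L (s :: ts)) w ℓ (ops F (d y))).span_list us
    (ctxFam U (s :: ts)) (fun u hu => fam_ops_of_hits hL hnd hwU hsU N (hy.1 u hu) hd
      (fun j hj T hT => hCs j (hsU j hj) u (hus u hu) _
        (hy.2 (u, j, d) (by simp [hu, hj, hd]) T hT)
        (ops_mem_ideal hA (hus u hu j (hsU j hj)) T hT))) Ψ hΨ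
  have h3 := Nrm.add _ h2 h1
  rw [add_sub_cancel] at h3
  refine Nrm.mono _ ?_ h3
  rw [starLevel]
  have l3 := Nat.mul_le_mul_right ((w.leaves.length * (s.count * 2) + s.leaves.length * 2 +
        (w.leaves.length + s.leaves.length)) * c) hlen
  omega

end HypStar

end LieType


namespace LieType

universe u v

open Function (update)

/-! ### Releasing the letters of U. -/

section MixedStep

variable {F : Type u} [Field F] {L : Type v} [NonUnitalNonAssocRing L] [Module F L]

/-- The arguments are expanded one coordinate at a time. After each addition the gap brings the
level back to `d`, so the unbounded number of summands does no harm. -/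
theorem small_of_mem_span {E : Type*} [AddCommGroup E] [Module F E] (N : Nrm F E)
    {f : (ℕ → L) → E} {S U : Finset ℕ} {A : Submodule F L} {P : Set L}
    (hP : Submodule.span F P ≤ A)
    (hlin : ∀ i ∈ S, ∀ u, IsLinearMap F fun a => f (update u i a)) {c d : ℕ}
    (hgap : ∀ x : ℕ → L, (∀ i ∈ U, x i ∈ A) → N.S (c + 2 * d) (f x) → N.S d (f x))
    (hbase : ∀ x : ℕ → L, (∀ i ∈ U, x i ∈ A) → (∀ j ∈ S, x j ∈ P) → N.S c (f x))
    {x : ℕ → L} (hx : ∀ i ∈ U, x i ∈ A) (hxS : ∀ j ∈ S, x j ∈ Submodule.span F P) :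
    N.S d (f x) := by
  suffices ∀ Z ⊆ S, ∀ x : ℕ → L, (∀ i ∈ U, x i ∈ A) → (∀ j ∈ Z, x j ∈ Submodule.span F P) →
      (∀ j ∈ S \ Z, x j ∈ P) → N.S d (f x) from
    this S subset_rfl x hx hxS (by simp)
  intro Z
  induction Z using Finset.induction_on with
  | empty =>
    intro _ x hx _ hxP
    exact hgap x hx (N.mono (by omega) (hbase x hx fun j hj => hxP j (by simpa using hj)))
  | insert i Z hi ih =>
    intro hZ x hx hxZ hxP
    have hiS : i ∈ S := hZ (by simp)
    have key : ∀ a ∈ Submodule.span F P, N.S d (f (update x i a)) := by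
      intro a ha
      induction ha using Submodule.span_induction with
      | mem a ha =>
        refine ih (fun j hj => hZ (by simp [hj])) _
          (update_mem_of_mem hx (hP (Submodule.subset_span ha))) (fun j hj => ?_) fun j hj => ?_
        · have hji : j ≠ i := by rintro rfl; exact hi hj
          rw [Function.update_of_ne hji]
          exact hxZ j (by simp [hj])
        · by_cases hji : j = i
          · subst hji; simpa using ha
          · rw [Function.update_of_ne hji]
            refine hxP j ?_
            simp only [Finset.mem_sdiff, Finset.mem_insert, not_or] at hj ⊢
            exact ⟨hj.1, hji, hj.2⟩
      | zero =>
        have : f (update x i 0) = 0 := (hlin i hiS x).map_zero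
        rw [this]; exact N.zero' _
      | add a b ha hb iha ihb =>
        refine hgap _ (update_mem_of_mem hx (hP (Submodule.add_mem _ ha hb))) ?_
        have : f (update x i (a + b)) = f (update x i a) + f (update x i b) :=
          (hlin i hiS x).map_add a b
        rw [this]
        exact N.mono (by omega) (N.add iha ihb)
      | smul r a _ iha =>
        have : f (update x i (r • a)) = r • f (update x i a) := (hlin i hiS x).map_smul r a
        rw [this]
        exact N.smul r iha
    simpa using key (x i) (hxZ i (by simp))

/-- The monomials of shape `T` are small when the letters in `U` are taken from `A` and the others
are chosen generically in the order `ℓ`. -/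
def SmallOn (T : Tr) (N : Nrm F L) (U : Finset ℕ) (ℓ : List ℕ) (A : Submodule F L) (c : ℕ) :
    Prop :=
  ∀ x : ℕ → L, (∀ i ∈ U, x i ∈ A) → Gen F c ℓ (fun z => ∀ f ∈ evl L T, N.S c (f z)) x

theorem SmallOn.mono {T : Tr} {N : Nrm F L} {U : Finset ℕ} {ℓ : List ℕ} {A A' : Submodule F L}
    {c c' : ℕ} (h : SmallOn T N U ℓ A c) (hA : A' ≤ A) (hc : c ≤ c') : SmallOn T N U ℓ A' c' :=
  fun x hx => (h x fun i hi => hA (hx i hi)).mono hc fun _ hz f hf => N.mono hc (hz f hf)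

variable [IsScalarTower F L L] [SMulCommClass F L L]

/-- The value of `s` splits as pq with both factors star small. The identity turns pq beside w into
terms with one factor beside w and the other outside it. The outer factor is itself a value of `s`
with letters in `A`, so it fills the slot of `s` in the context and star smallness of the inner
factor applies. -/
theorem fam_of_mem_pure (hL : IsLieType F L) {w s : Tr} {ts : List Tr}
    (hnd : (w.leaves ++ labels (s :: ts)).Nodup) {U : Finset ℕ} (hwU : ∀ i ∈ w.leaves, i ∉ U)
    (hsU : ∀ i ∈ s.leaves, i ∈ U) (N : Nrm F L) {ℓ : List ℕ} {c τ : ℕ} {A J : Submodule F L}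
    (hJ : IsIdeal J) (hp : ∀ p ∈ Pure J τ, (N.star A U w (s :: ts) ℓ).S c p)
    (hq : ∀ q ∈ Pure J τ, ∃ f ∈ evl L s, ∃ x : ℕ → L, (∀ j, x j ∈ A) ∧ f x = q)
    {x : ℕ → L} (hx : ∀ i ∈ U, x i ∈ A) (hxS : ∀ j ∈ s.leaves, x j ∈ Pure J (τ + 1)) :
    (N.fam (Ctx F L (s :: ts)) w ℓ [LinearMap.id]).S (s.count * (c + c) + (c + c))
      (ctxFam U (s :: ts) x) := by
  have hnd' := hnd
  rw [List.nodup_append', labels_cons, List.nodup_append'] at hnd'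
  obtain ⟨hw, ⟨hs, hts, hdis⟩, hwd⟩ := hnd'
  choose! fq hfq xq hxq hfx using hq
  have hpq : ∀ g ∈ evl L s, ∃ p ∈ Pure J τ, ∃ q ∈ Pure J τ, g x = p * q := fun g hg =>
    evl_mem_pure_mul hJ hg hxS
  choose! p hpP q hqP hg using hpq
  let y : L → ℕ → L := fun r => mrg s.leaves.toFinset (xq r) x
  have hy : ∀ r ∈ Pure J τ, ∀ i ∈ U, y r i ∈ A := by
    intro r hr i hi
    by_cases his : i ∈ s.leaves.toFinset
    · simp only [y, mrg_of_mem his]; exact hxq r hr i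
    · simp only [y, mrg_of_notMem his]; exact hx i hi
  have gens := Gen.forall_list (F := F) (c := c + c) (ℓ := ℓ) (x := 0) (evl L s) (fun g hg =>
    ((fam_ctxFam_iff' hwU).1 (hp (p g) (hpP g hg) (y (q g)) (hy _ (hqP g hg)))).and
      ((fam_ctxFam_iff' hwU).1 (hp (q g) (hqP g hg) (y (p g)) (hy _ (hpP g hg)))))
  rw [length_evl] at gens
  rw [fam_ctxFam_iff' hwU]
  refine gens.mono (Nat.le_add_right _ _) fun z hz φ hφ f hf T hT => ?_
  rw [List.mem_singleton] at hT
  subst hT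
  rw [LinearMap.id_apply]
  obtain ⟨g, hg', ψ, hψ, hφ⟩ := hφ
  refine N.mono (Nat.le_add_left _ _) ?_
  have eψ : ∀ r, ψ (mrg U (y r) z) = ψ (mrg U x z) := fun r => ctx_congr hψ fun i hi => by
    have hi' : i ∉ s.leaves.toFinset := fun h' => hdis (by simpa using h') hi
    by_cases hiU : i ∈ U
    · rw [mrg_of_mem hiU, mrg_of_mem hiU]; exact mrg_of_notMem hi' _ _
    · rw [mrg_of_notMem hiU, mrg_of_notMem hiU]
  have ef : ∀ r, f (mrg U (y r) z) = f (mrg U x z) := fun r => evl_congr hf fun i hi => by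
    rw [mrg_of_notMem (hwU i hi), mrg_of_notMem (hwU i hi)]
  have eq' : ∀ r ∈ Pure J τ, fq r (mrg U (y r) z) = r := fun r hr => by
    conv_rhs => rw [← hfx r hr]
    refine evl_congr (hfq r hr) fun i hi => ?_
    rw [mrg_of_mem (hsU i hi)]
    exact mrg_of_mem (by simpa using hi) _ _
  have eg : g (mrg U x z) = p g * q g := by
    rw [← hg g hg']
    exact evl_congr hg' fun i hi => mrg_of_mem (hsU i hi) _ _
  have hP := hpP g hg'
  have hQ := hqP g hg'
  have a1 := forall_ops.1
    ((hz g hg').1 _ ⟨fq (q g), hfq _ hQ, ψ, hψ, Or.inl rfl⟩ f hf)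
  have a2 := forall_ops.1
    ((hz g hg').1 _ ⟨fq (q g), hfq _ hQ, ψ, hψ, Or.inr rfl⟩ f hf)
  have b1 := forall_ops.1
    ((hz g hg').2 _ ⟨fq (p g), hfq _ hP, ψ, hψ, Or.inl rfl⟩ f hf)
  have b2 := forall_ops.1
    ((hz g hg').2 _ ⟨fq (p g), hfq _ hP, ψ, hψ, Or.inr rfl⟩ f hf)
  simp only [LinearMap.comp_apply, LinearMap.mulLeft_apply, LinearMap.mulRight_apply, eψ, ef,
    eq' _ hP, eq' _ hQ] at a1 a2 b1 b2
  rcases hφ with rfl | rfl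
  · simp only [LinearMap.comp_apply, LinearMap.mulLeft_apply, eg]
    exact hL.small_mul_mul (N.comap (ψ (mrg U x z))) b1.1 a2.1
  · simp only [LinearMap.comp_apply, LinearMap.mulRight_apply, eg]
    exact hL.small_mul_mul' (N.comap (ψ (mrg U x z))) a2.2 b2.2

end MixedStep

/-- Smallness for proper subsets of `U` supplies the slices and the generic values of `s`; the
induction hypothesis for `s`, applied to the star filtration, supplies the ideal. Note that `e'` is
fixed before `M` and `c`, which keeps the final derived length free of m. -/
theorem exists_mixed_step {T : Tr} (hT : T.leaves.Nodup)
    (hRT : ∀ s : Tr, sizeOf s < sizeOf T → s.leaves.Nodup → RT.{u, v} s) {U : Finset ℕ}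
    (hU : ∀ i ∈ U, i ∈ T.leaves) (hU₁ : ∃ i ∈ T.leaves, i ∈ U) (hU₂ : ∃ i ∈ T.leaves, i ∉ U)
    {ℓ : List ℕ} (hℓ : ℓ.Perm (T.leaves.filter (· ∉ U))) (e : ℕ) :
    ∃ e' ≥ e, ∀ M c : ℕ, ∃ c' r : ℕ, ∀ (F : Type u) (L : Type v) [Field F]
      [NonUnitalNonAssocRing L] [Module F L] [IsScalarTower F L L] [SMulCommClass F L L],
      IsLieType F L → ∀ N : Nrm F L, N.Inv M → ∀ I : Submodule F L, IsIdeal I →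
      (∀ U' ⊂ U, ∀ ℓ' : List ℕ, ℓ'.Perm (T.leaves.filter (· ∉ U')) →
        SmallOn T N U' ℓ' (derived I e) c) →
      ∃ J : Submodule F L, IsIdeal J ∧ CodimLE J r ∧
        SmallOn T N U ℓ (derived (I ⊓ J) e') c' := by
  obtain ⟨w, s, ts, hwU, hsU, hperm, hsize, hvals⟩ := exists_mixed_node.{u, v} U T [] hU₁ hU₂
  have hperm' : (w.leaves ++ labels (s :: ts)).Perm T.leaves := by
    simpa [labels] using hperm
  have hnd : (w.leaves ++ labels (s :: ts)).Nodup := hperm'.nodup_iff.2 hT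
  have hnd' := hnd
  rw [List.nodup_append', labels_cons, List.nodup_append'] at hnd'
  obtain ⟨hw, ⟨hs, hts, hdis⟩, hwd⟩ := hnd'
  have hℓnd : ℓ.Nodup := hℓ.nodup_iff.2 (hT.filter _)
  have hℓmem : ∀ i, i ∈ ℓ ↔ i ∈ T.leaves ∧ i ∉ U := fun i => by
    rw [hℓ.mem_iff]; simp
  obtain ⟨K, hK⟩ := hRT s hsize hs
  -- Level `K` gives star smallness, `s.height + e` lets an element be read as a value of `s` with
  -- letters in `A`, and the extra level splits a value of `s` into two factors.
  refine ⟨max K (s.height + e) + 1, by omega, fun M c => ?_⟩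
  generalize hτ : max K (s.height + e) = τ
  obtain ⟨c₃, r, hR⟩ := hK (starFactor w (s :: ts) M)
    (starLevel w s (spanBound c U.card).1 c (spanBound c U.card).2)
  refine ⟨gapBound (s.count * (c₃ + c₃) + (c₃ + c₃)) (spanBound c U.card).1
    (spanBound c U.card).2, r, ?_⟩
  intro F L _ _ _ _ _ hL N hN I hI hsm
  generalize hAdef : derived I e = A at hsm
  have hA : IsIdeal A := hAdef ▸ isIdeal_derived hL hI e
  let NE := N.fam (Ctx F L (s :: ts)) w ℓ [LinearMap.id]
  have hv : Vals F L (s :: ts) w = {f | f ∈ evl L T} := by rw [← hvals, vals_nil]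
  have hiff : ∀ (c : ℕ) (x : ℕ → L), NE.S c (ctxFam U (s :: ts) x) ↔
      Gen F c ℓ (fun z => ∀ f ∈ evl L T, N.S c (f z)) x := by
    intro c x
    rw [fam_ctxFam_iff (fun i hi => ?_) (fun i hi => ?_) (fun i hi => ((hℓmem i).1 hi).2), hv]
    · rfl
    · exact (hℓmem i).2 ⟨hperm'.subset (List.mem_append_left _ hi), hwU i hi⟩
    · by_cases hiU : i ∈ U
      · exact Or.inr hiU
      · exact Or.inl ((hℓmem i).2 ⟨hperm'.subset (List.mem_append_right _ hi), hiU⟩)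
  have hUlab : ∀ i ∈ U, i ∈ labels (s :: ts) := fun i hi =>
    (List.mem_append.1 (hperm'.symm.subset (hU i hi))).resolve_left fun h => hwU i h hi
  have hlin : ∀ i ∈ U, ∀ u, IsLinearMap F fun a =>
      (ctxFam U (s :: ts) (update u i a) : OpFam F L (Ctx F L (s :: ts))) := fun i hi u =>
    ctxFam_linear (List.nodup_append'.1 hnd).2.1 hi (hUlab i hi) u
  have hslice : ∀ i ∈ U, ∀ u : ℕ → L, (∀ j ∈ U, u j ∈ A) → ∃ C : Submodule F L, CodimLE C c ∧
      ∀ a ∈ C, a ∈ A → NE.S c (ctxFam U (s :: ts) (update u i a)) := by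
    -- Removing `i` from `U` and choosing it first among the generic letters produces the slice.
    intro i hi u hu
    obtain ⟨C, hC, h⟩ := hsm (U.erase i) (Finset.erase_ssubset hi) (i :: ℓ) (by
      rw [List.perm_ext_iff_of_nodup
        (List.nodup_cons.2 ⟨fun h => ((hℓmem i).1 h).2 hi, hℓnd⟩) (hT.filter _)]
      intro j
      simp only [List.mem_cons, hℓmem, List.mem_filter, Finset.mem_erase, decide_eq_true_eq]
      by_cases hji : j = i
      · subst hji; simp [hU j hi]
      · simp [hji]) u (fun j hj => hu j (Finset.mem_of_mem_erase hj))
    exact ⟨C, hC, fun a ha _ => (hiff c _).2 (h a ha)⟩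
  have hα : ∀ u : ℕ → L, (∀ i ∈ U, u i ∈ A) → ∀ ℓ' : List ℕ, ℓ'.Perm s.leaves → ∀ y : ℕ → L,
      Gen F c ℓ' (fun y => NE.S c (ctxFam U (s :: ts) (mrg s.leaves.toFinset y u))) y := by
    intro u hu ℓ' hℓ' y
    have hsub : U \ s.leaves.toFinset ⊂ U := by
      obtain ⟨i, hi⟩ := List.exists_mem_of_ne_nil _ s.leaves_ne_nil
      refine (Finset.ssubset_iff_of_subset Finset.sdiff_subset).2 ⟨i, hsU i hi, ?_⟩
      simp [hi]
    have h := hsm (U \ s.leaves.toFinset) hsub (ℓ' ++ ℓ) (by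
      have hdisj : List.Disjoint ℓ' ℓ := fun i hi hi' =>
        ((hℓmem i).1 hi').2 (hsU i (hℓ'.subset hi))
      rw [List.perm_ext_iff_of_nodup
        (List.nodup_append'.2 ⟨hℓ'.nodup_iff.2 hs, hℓnd, hdisj⟩) (hT.filter _)]
      intro j
      simp only [List.mem_append, hℓmem, hℓ'.mem_iff, List.mem_filter, Finset.mem_sdiff,
        List.mem_toFinset, decide_eq_true_eq]
      by_cases hjs : j ∈ s.leaves
      · simp [hjs, hU j (hsU j hjs)]
      · simp [hjs]) u (fun j hj => hu j (Finset.mem_sdiff.1 hj).1)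
    rw [gen_append] at h
    refine Gen.transfer h fun z z' h1 h2 _ hz => ?_
    rw [← hiff] at hz
    rw [ctxFam_congr (y := z)]
    · exact hz
    · intro i hi
      by_cases his : i ∈ s.leaves
      · rw [mrg_of_mem (by simpa using his), h1 i (hℓ'.mem_iff.2 his)]
      · rw [mrg_of_notMem (by simpa using his), h2 i fun h => his (hℓ'.subset h)]
  obtain ⟨us, hlen, hus, W, hWfin, hWr, hW, hspan⟩ := exists_spanning_values NE hlin
    (fun _ _ h => ctxFam_congr h) hslice
  have hyp := hyp_star hL hnd hwU hsU N hA hα hslice hlen hus (hW ▸ hspan)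
  obtain ⟨J, hJ, hJr, hJs⟩ := hR F L hL _ (star_inv hL hnd hN hwU hA ℓ) hyp
  refine ⟨J, hJ, hJr, ?_⟩
  -- Smallness is known so far on balanced products only; the gap extends it to their span, the
  -- derived term.
  obtain ⟨d, hd, hgap⟩ := exists_gap NE (s.count * (c₃ + c₃) + (c₃ + c₃))
    {y | ∃ x : ℕ → L, (∀ i ∈ U, x i ∈ A) ∧ y = ctxFam U (s :: ts) x} (spanBound c U.card).1
    (spanBound c U.card).2 W hWr (by rintro _ ⟨x, hx, rfl⟩; exact hspan x hx)
  have hIJ := hI.inf hJ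
  have hle : derived (I ⊓ J) (τ + 1) ≤ A := by
    rw [← hAdef]
    exact (derived_antitone hL hIJ (by omega)).trans (derived_mono inf_le_left e)
  intro x hx
  have hxA : ∀ i ∈ U, x i ∈ A := fun i hi => hle (hx i hi)
  have := small_of_mem_span NE (f := ctxFam U (s :: ts)) (S := s.leaves.toFinset) (U := U)
    (A := A) (P := Pure (I ⊓ J) (τ + 1)) (by rw [span_pure]; exact hle)
    (fun i hi => hlin i (hsU i (by simpa using hi)))
    (fun x hx => hgap _ ⟨x, hx, rfl⟩)
    (fun x hx hxP => fam_of_mem_pure hL hnd hwU hsU N hIJ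
      (fun p hp => hJs p (pure_mono inf_le_right K (pure_antitone hIJ (by omega) hp)))
      (fun q hq => by
        obtain ⟨f, hf, x, hx, rfl⟩ := exists_evl_eq_of_mem_pure hIJ hs (e := e) (h := τ - e)
          (by omega) (q := q) (by rwa [Nat.sub_add_cancel (by omega)])
        refine ⟨f, hf, x, fun j => ?_, rfl⟩
        rw [← hAdef]
        exact derived_mono inf_le_left e (pure_subset_derived _ _ (hx j)))
      hx (fun j hj => hxP j (by simpa using hj)))
    hxA (fun j hj => by
      rw [span_pure]
      exact hx j (hsU j (by simpa using hj)))
  exact (hiff _ x).1 (NE.mono hd this)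

end LieType


namespace LieType

universe u v

open Function (update)

/-! ### Releasing the last letter, and the reduction theorem. -/

section Last

variable {F : Type u} [Field F] {L : Type v} [NonUnitalNonAssocRing L] [Module F L]

/-- The supremum filtration on functions. -/
def Nrm.pi {E : Type*} [AddCommGroup E] [Module F E] (N : Nrm F E) (ι : Type*) :
    Nrm F (ι → E) where
  S c Φ := ∀ i, N.S c (Φ i)
  mono h hx i := N.mono h (hx i)
  zero _ := N.zero
  add h h' i := N.add (h i) (h' i)
  smul r h i := N.smul r (h i)

variable [IsScalarTower F L L] [SMulCommClass F L L]

/-- Smallness of both products with `a`. -/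
def Nrm.mulBoth (N : Nrm F L) (a : L) : Nrm F L where
  S c v := ∀ T ∈ ops F a, N.S c (T v)
  mono h hx T hT := N.mono h (hx T hT)
  zero T _ := by simpa using N.zero
  add h h' T hT := by simpa using N.add (h T hT) (h' T hT)
  smul r h T hT := by simpa using N.smul r (h T hT)

/-- The element `a` is small if its products with all monomials of shape `T` in elements of `A`
are small. -/
def Nrm.lastStar (N : Nrm F L) (A : Submodule F L) (T : Tr) : Nrm F L where
  S c a := ∀ x : ℕ → L, (∀ i ∈ T.leaves, x i ∈ A) → ∀ f ∈ evl L T, (N.mulBoth a).S c (f x)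
  mono h hx x hxA f hf := Nrm.mono _ h (hx x hxA f hf)
  zero x _ f hf := by
    refine forall_ops.2 ?_
    simpa using N.zero
  add h h' x hx f hf := by
    have h1 := forall_ops.1 (h x hx f hf)
    have h2 := forall_ops.1 (h' x hx f hf)
    refine forall_ops.2 ?_
    simp only [LinearMap.mulLeft_apply, LinearMap.mulRight_apply, add_mul, mul_add] at *
    exact ⟨N.add h1.1 h2.1, N.add h1.2 h2.2⟩
  smul r h x hx f hf := by
    have h1 := forall_ops.1 (h x hx f hf)
    refine forall_ops.2 ?_
    simp only [LinearMap.mulLeft_apply, LinearMap.mulRight_apply, smul_mul_assoc,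
      mul_smul_comm] at *
    exact ⟨N.smul r h1.1, N.smul r h1.2⟩

theorem lastStar_inv (hL : IsLieType F L) {T : Tr} (hT : T.leaves.Nodup) {N : Nrm F L} {M : ℕ}
    (hN : N.Inv M) {A : Submodule F L} (hA : IsIdeal A) :
    (N.lastStar A T).Inv (M + T.leaves.length) := by
  intro c a h l
  suffices ∀ T' ∈ ops F l, (N.lastStar A T).S ((M + T.leaves.length) * c) (T' a) from
    ⟨(forall_ops.1 this).2, (forall_ops.1 this).1⟩
  intro T' hT' x hx f hf
  have hB : ∀ P ∈ ops F a, ∀ T' ∈ ops F l, N.S (T.leaves.length * c) (P (T' (f x))) :=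
    fun P hP => small_ops_evl hL hT hf (N.comap P) fun j hj T' hT' g hg =>
      h _ (fun i hi => by
        by_cases hij : i = j
        · subst hij; rw [Function.update_self]; exact ops_mem_ideal hA (hx i hi) T' hT'
        · rw [Function.update_of_ne hij]; exact hx i hi) g hg P hP
  have hAx := forall_ops.1 (h x hx f hf)
  have key := small_mul_ops hL N (v := f x) (a := a) (l := l) (k := M * c)
    (k' := T.leaves.length * c)
    (forall_ops.2 ⟨⟨(hN hAx.2 l).2, (hN hAx.1 l).2⟩, ⟨(hN hAx.2 l).1, (hN hAx.1 l).1⟩⟩)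
    (fun T' hT' => ⟨hB (LinearMap.mulRight F a) (by simp [ops]) T' hT',
      hB (LinearMap.mulLeft F a) (by simp [ops]) T' hT'⟩) T' hT'
  rw [add_mul]
  exact forall_ops.2 ⟨key.2, key.1⟩

/-- The values of `T` on `A` lie near the span of boundedly many. An element `a` multiplies one such
value to something small if its products with every letter lie in the slice of that letter. These
boundedly many linear conditions define `D`, which is then replaced by an ideal. -/
theorem exists_ideal_of_smallOn (hL : IsLieType F L) {T : Tr} (hT : T.leaves.Nodup) {N : Nrm F L}
    {M : ℕ} (hN : N.Inv M) {A : Submodule F L} (hA : IsIdeal A) {c : ℕ}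
    (hsm : ∀ i ∈ T.leaves, SmallOn T N (T.leaves.toFinset.erase i) [i] A c) {n b : ℕ}
    (hn : (spanBound c T.leaves.toFinset.card).1 = n)
    (hb : (spanBound c T.leaves.toFinset.card).2 = b) {k s : ℕ}
    (hk : n * T.leaves.length * (c + c) = k)
    (hs : n * (T.leaves.length * c) + M * b = s) :
    ∃ J : Submodule F L, IsIdeal J ∧ CodimLE J k ∧
      ∀ a ∈ J, (N.lastStar A T).S ((M + T.leaves.length + 1) ^ k * s) a := by
  let NE := N.pi {f // f ∈ evl L T}
  let Fm : (ℕ → L) → ({f // f ∈ evl L T} → L) := fun x f => f.1 x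
  have hslice : ∀ i ∈ T.leaves.toFinset, ∀ u : ℕ → L, (∀ j ∈ T.leaves.toFinset, u j ∈ A) →
      ∃ C : Submodule F L, CodimLE C c ∧ ∀ a ∈ C, a ∈ A → NE.S c (Fm (update u i a)) := by
    intro i hi u hu
    obtain ⟨C, hC, h⟩ := hsm i (by simpa using hi) u
      (fun j hj => hu j (Finset.mem_of_mem_erase hj))
    exact ⟨C, hC, fun a ha _ f => h a ha f.1 f.2⟩
  obtain ⟨us, hlen, hus, W, -, -, hW, hspan⟩ := exists_spanning_values NE (f := Fm)
    (fun i hi u => ⟨fun a b => funext fun f => (evl_linear F hT f.2 (by simpa using hi) u).map_add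
      a b, fun r a => funext fun f => (evl_linear F hT f.2 (by simpa using hi) u).map_smul r a⟩)
    (fun x y h => funext fun f => evl_congr f.2 fun i hi => h i (by simpa using hi)) hslice
  choose! C hC hCs using hslice
  rw [hn] at hlen
  rw [hb] at hspan
  have hus' : ∀ u ∈ us, ∀ j ∈ T.leaves, u j ∈ A := fun u hu j hj => hus u hu j (by simpa using hj)
  classical
  let D : Submodule F L := ⨅ p ∈ (us ×ˢ T.leaves).toFinset,
    ((C p.2 p.1).comap (LinearMap.mulRight F (p.1 p.2)) ⊓
      (C p.2 p.1).comap (LinearMap.mulLeft F (p.1 p.2)))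
  have hD : CodimLE D k := by
    refine (CodimLE.biInf _ _ (c + c) fun p hp => ?_).mono le_rfl ?_
    · rw [List.mem_toFinset, List.mem_product] at hp
      have := hC p.2 (by simpa using hp.2) p.1 (hus p.1 hp.1)
      exact (this.comap _).inf (this.comap _)
    · rw [← hk]
      refine Nat.mul_le_mul_right _ ((List.toFinset_card_le _).trans ?_)
      rw [List.length_product]
      exact Nat.mul_le_mul_right _ hlen
  refine exists_ideal_of_small (lastStar_inv hL hT hN hA) k s D hD fun a ha x hx f hf => ?_
  obtain ⟨Ψ, hΨ, hΦ⟩ := hspan x (fun j hj => hx j (by simpa using hj))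
  have h1 : ((N.mulBoth a).pi {f // f ∈ evl L T}).S (M * b) (Fm x - Ψ) := fun f =>
    forall_ops.2 ⟨(hN (hΦ f) a).2, (hN (hΦ f) a).1⟩
  rw [hW] at hΨ
  have h2 := ((N.mulBoth a).pi {f // f ∈ evl L T}).span_list (c := T.leaves.length * c) us Fm
    (fun u hu f => by
      refine small_ops_evl hL hT f.2 N fun j hj T' hT' g hg => ?_
      refine hCs j (by simpa using hj) u (hus u hu) _ ?_
        (ops_mem_ideal hA (hus' u hu j hj) T' hT') ⟨g, hg⟩
      simp only [D, Submodule.mem_iInf] at ha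
      have := ha (u, j) (by rw [List.mem_toFinset, List.mem_product]; exact ⟨hu, hj⟩)
      revert T'
      rw [forall_ops]
      exact this) Ψ hΨ
  have h3 := Nrm.add _ h2 h1
  rw [add_sub_cancel] at h3
  refine Nrm.mono _ ?_ (h3 ⟨f, hf⟩)
  have := Nat.mul_le_mul_right (T.leaves.length * c) hlen
  omega

end Last

theorem exists_mixed_steps {T : Tr} (hT : T.leaves.Nodup)
    (hRT : ∀ s : Tr, sizeOf s < sizeOf T → s.leaves.Nodup → RT.{u, v} s) (n e : ℕ)
    (tasks : List (Finset ℕ × List ℕ)) (htasks : ∀ p ∈ tasks, (∀ i ∈ p.1, i ∈ T.leaves) ∧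
      (∃ i ∈ T.leaves, i ∈ p.1) ∧ (∃ i ∈ T.leaves, i ∉ p.1) ∧ p.1.card ≤ n + 1 ∧
      p.2.Perm (T.leaves.filter (· ∉ p.1))) :
    ∃ e' ≥ e, ∀ M c : ℕ, ∃ c' r : ℕ, ∀ (F : Type u) (L : Type v) [Field F]
      [NonUnitalNonAssocRing L] [Module F L] [IsScalarTower F L L] [SMulCommClass F L L],
      IsLieType F L → ∀ N : Nrm F L, N.Inv M → ∀ I : Submodule F L, IsIdeal I →
      (∀ U : Finset ℕ, (∀ i ∈ U, i ∈ T.leaves) → (∃ i ∈ T.leaves, i ∉ U) → U.card ≤ n →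
        ∀ ℓ : List ℕ, ℓ.Perm (T.leaves.filter (· ∉ U)) → SmallOn T N U ℓ (derived I e) c) →
      ∃ J : Submodule F L, IsIdeal J ∧ CodimLE J r ∧
        ∀ p ∈ tasks, SmallOn T N p.1 p.2 (derived (I ⊓ J) e') c' := by
  induction tasks with
  | nil =>
    refine ⟨e, le_rfl, fun M c => ⟨0, 0, ?_⟩⟩
    intro F L _ _ _ _ _ _ N _ I _ _
    exact ⟨⊤, fun _ _ _ => ⟨trivial, trivial⟩, CodimLE.top, by simp⟩
  | cons p tasks ih =>
    obtain ⟨e₁, he₁, h₁⟩ := ih fun q hq => htasks q (by simp [hq])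
    obtain ⟨hp1, hp2, hp3, hp4, hp5⟩ := htasks p (by simp)
    obtain ⟨e₂, he₂, h₂⟩ := exists_mixed_step hT hRT hp1 hp2 hp3 hp5 e
    refine ⟨max e₁ e₂, by omega, fun M c => ?_⟩
    obtain ⟨c₁, r₁, h₁⟩ := h₁ M c
    obtain ⟨c₂, r₂, h₂⟩ := h₂ M c
    refine ⟨c₁ + c₂, r₁ + r₂, ?_⟩
    intro F L _ _ _ _ _ hL N hN I hI hsm
    obtain ⟨J₁, hJ₁, hr₁, hs₁⟩ := h₁ F L hL N hN I hI hsm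
    obtain ⟨J₂, hJ₂, hr₂, hs₂⟩ := h₂ F L hL N hN I hI (fun U' hU' ℓ' hℓ' => by
      obtain ⟨i, hi, hiU⟩ := hp3
      exact hsm U' (fun i hi => hp1 i (hU'.1 hi)) ⟨i, hi, fun h => hiU (hU'.1 h)⟩
        (by have := Finset.card_lt_card hU'; omega) ℓ' hℓ')
    have hid : IsIdeal (I ⊓ (J₁ ⊓ J₂)) := hI.inf (hJ₁.inf hJ₂)
    refine ⟨J₁ ⊓ J₂, hJ₁.inf hJ₂, hr₁.inf hr₂, fun q hq => ?_⟩
    rcases List.mem_cons.1 hq with rfl | hq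
    · refine hs₂.mono ((derived_antitone hL hid (le_max_right e₁ e₂)).trans
        (derived_mono (inf_le_inf_left I inf_le_right) _)) (by omega)
    · refine (hs₁ q hq).mono ((derived_antitone hL hid (le_max_left e₁ e₂)).trans
        (derived_mono (inf_le_inf_left I inf_le_left) _)) (by omega)

theorem exists_smallOn {T : Tr} (hT : T.leaves.Nodup)
    (hRT : ∀ s : Tr, sizeOf s < sizeOf T → s.leaves.Nodup → RT.{u, v} s) (n : ℕ) :
    ∃ e, ∀ M c : ℕ, ∃ c' r : ℕ, ∀ (F : Type u) (L : Type v) [Field F]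
      [NonUnitalNonAssocRing L] [Module F L] [IsScalarTower F L L] [SMulCommClass F L L],
      IsLieType F L → ∀ N : Nrm F L, N.Inv M → Hyp T N c →
      ∃ I : Submodule F L, IsIdeal I ∧ CodimLE I r ∧
      ∀ U : Finset ℕ, (∀ i ∈ U, i ∈ T.leaves) → (∃ i ∈ T.leaves, i ∉ U) → U.card ≤ n →
        ∀ ℓ : List ℕ, ℓ.Perm (T.leaves.filter (· ∉ U)) → SmallOn T N U ℓ (derived I e) c' := by
  induction n with
  | zero =>
    refine ⟨0, fun M c => ⟨c, 0, ?_⟩⟩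
    intro F L _ _ _ _ _ _ N _ h
    refine ⟨⊤, fun _ _ _ => ⟨trivial, trivial⟩, CodimLE.top, fun U _ _ hU ℓ hℓ x _ => ?_⟩
    rw [Nat.le_zero, Finset.card_eq_zero] at hU
    subst hU
    exact h ℓ (by simpa using hℓ) x
  | succ n ih =>
    obtain ⟨e, he⟩ := ih
    let tasks : List (Finset ℕ × List ℕ) :=
      ((T.leaves.toFinset.powerset.filter fun U => (∃ i ∈ T.leaves, i ∈ U) ∧
        (∃ i ∈ T.leaves, i ∉ U) ∧ U.card ≤ n + 1).toList).flatMap fun U =>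
          (T.leaves.filter (· ∉ U)).permutations.map fun ℓ => (U, ℓ)
    have htasks : ∀ U ℓ, (U, ℓ) ∈ tasks ↔ (∀ i ∈ U, i ∈ T.leaves) ∧
        (∃ i ∈ T.leaves, i ∈ U) ∧ (∃ i ∈ T.leaves, i ∉ U) ∧ U.card ≤ n + 1 ∧
        ℓ.Perm (T.leaves.filter (· ∉ U)) := by
      intro U ℓ
      simp only [tasks, List.mem_flatMap, List.mem_map, List.mem_permutations, Prod.mk.injEq,
        Finset.mem_toList, Finset.mem_filter, Finset.mem_powerset, Finset.subset_iff,
        List.mem_toFinset]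
      constructor
      · rintro ⟨U', ⟨h1, h2, h3, h4⟩, ℓ', h5, rfl, rfl⟩
        exact ⟨fun i hi => h1 hi, h2, h3, h4, h5⟩
      · rintro ⟨h1, h2, h3, h4, h5⟩
        exact ⟨U, ⟨fun i hi => h1 i hi, h2, h3, h4⟩, ℓ, h5, rfl, rfl⟩
    obtain ⟨e', he', h'⟩ := exists_mixed_steps hT hRT n e tasks
      (fun p hp => (htasks p.1 p.2).1 hp)
    refine ⟨e', fun M c => ?_⟩
    obtain ⟨c₀, r₀, h₀⟩ := he M c
    obtain ⟨c₁, r₁, h₁⟩ := h' M c₀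
    refine ⟨c₀ + c₁, r₀ + r₁, ?_⟩
    intro F L _ _ _ _ _ hL N hN hyp
    obtain ⟨I, hI, hIr, hIs⟩ := h₀ F L hL N hN hyp
    obtain ⟨J, hJ, hJr, hJs⟩ := h₁ F L hL N hN I hI hIs
    refine ⟨I ⊓ J, hI.inf hJ, hIr.inf hJr, fun U hU hU₂ hcard ℓ hℓ => ?_⟩
    by_cases hU₁ : ∃ i ∈ T.leaves, i ∈ U
    · exact (hJs (U, ℓ) ((htasks U ℓ).2 ⟨hU, hU₁, hU₂, hcard, hℓ⟩)).mono le_rfl (by omega)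
    · have hU0 : U = ∅ := by
        rw [Finset.eq_empty_iff_forall_notMem]
        exact fun i hi => hU₁ ⟨i, hU i hi, hi⟩
      refine (hIs U hU hU₂ (by simp [hU0]) ℓ hℓ).mono
        ((derived_antitone hL (hI.inf hJ) he').trans (derived_mono inf_le_left e)) (by omega)

/-- Generic smallness implies smallness of balanced products in an ideal of bounded codimension. -/
theorem rt_of_nodup (T : Tr) (hT : T.leaves.Nodup) : RT.{u, v} T := by
  obtain ⟨e, he⟩ := exists_smallOn.{u, v} hT (fun s _ hs => rt_of_nodup s hs) T.leaves.length
  -- The last level writes an element as a product: its first factor is read as a value of `T` on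
  -- `derived I e`, its second lies in `J`.
  refine ⟨T.height + e + 1, fun M c => ?_⟩
  obtain ⟨c₀, r₀, h₀⟩ := he M c
  obtain ⟨n, hn⟩ : ∃ n, (spanBound c₀ T.leaves.toFinset.card).1 = n := ⟨_, rfl⟩
  obtain ⟨b, hb⟩ : ∃ b, (spanBound c₀ T.leaves.toFinset.card).2 = b := ⟨_, rfl⟩
  obtain ⟨k, hk⟩ : ∃ k, n * T.leaves.length * (c₀ + c₀) = k := ⟨_, rfl⟩
  obtain ⟨s, hs⟩ : ∃ s, n * (T.leaves.length * c₀) + M * b = s := ⟨_, rfl⟩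
  refine ⟨(M + T.leaves.length + 1) ^ k * s, r₀ + k, ?_⟩
  intro F L _ _ _ _ _ hL N hN hyp
  obtain ⟨I, hI, hIr, hIs⟩ := h₀ F L hL N hN hyp
  obtain ⟨J, hJ, hJr, hJs⟩ := exists_ideal_of_smallOn hL hT hN (isIdeal_derived hL hI e) (c := c₀)
    (fun i hi => hIs _ (fun j hj => by simpa using Finset.mem_of_mem_erase hj)
      ⟨i, hi, by simp⟩ ((Finset.card_le_card (Finset.erase_subset _ _)).trans
        (List.toFinset_card_le _)) [i] (by
        rw [List.perm_ext_iff_of_nodup (by simp) (hT.filter _)]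
        intro j
        simp only [List.mem_singleton, List.mem_filter, Finset.mem_erase, List.mem_toFinset,
          decide_eq_true_eq]
        by_cases hji : j = i
        · subst hji; simp [hi]
        · simp [hji])) hn hb hk hs
  refine ⟨I ⊓ J, hI.inf hJ, hIr.inf hJr, ?_⟩
  rintro _ ⟨p, hp, q, hq, rfl⟩
  obtain ⟨f, hf, x, hx, rfl⟩ := exists_evl_eq_of_mem_pure (hI.inf hJ) hT le_rfl hp
  have hq' : q ∈ J := by
    have := pure_antitone (hI.inf hJ) (Nat.zero_le _) hq
    exact this.2
  exact hJs q hq' x (fun i _ => derived_mono inf_le_left e (pure_subset_derived _ _ (hx i))) f hf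
    (LinearMap.mulRight F q) (by simp [ops])
termination_by sizeOf T

end LieType


namespace LieType

/-! ### Kreknin's theorem in a complete lattice. -/

section Kreknin

/-- The derived series of a family graded by `ZMod q`. -/
def derivedFamily {α : Type*} [CompleteLattice α] (m : α → α → α) {q : ℕ} (g : ZMod q → α) :
    ℕ → ZMod q → α
  | 0 => g
  | j + 1 => fun a => ⨆ b, m (derivedFamily m g j b) (derivedFamily m g j (a - b))

/-- The smallest multiplicatively closed family containing the components of `g` of degree greater
than `k`. -/
def genAbove {α : Type*} [CompleteLattice α] (m : α → α → α) {q : ℕ} (g : ZMod q → α) (k : ℕ)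
    (a : ZMod q) : α :=
  sInf {x | ∃ f : ZMod q → α, (∀ b c, m (f b) (f c) ≤ f (b + c)) ∧
    (∀ b : ZMod q, k < b.val → g b ≤ f b) ∧ x = f a}

variable {α : Type*} [CompleteLattice α] {m : α → α → α} {q : ℕ}

theorem genAbove_le {g f : ZMod q → α} {k : ℕ} (hf : ∀ b c, m (f b) (f c) ≤ f (b + c))
    (hg : ∀ b : ZMod q, k < b.val → g b ≤ f b) (a : ZMod q) : genAbove m g k a ≤ f a :=
  sInf_le ⟨f, hf, hg, rfl⟩

theorem le_genAbove {g : ZMod q → α} {k : ℕ} {a : ZMod q} (ha : k < a.val) :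
    g a ≤ genAbove m g k a :=
  le_sInf fun _ ⟨_, _, h, e⟩ => e ▸ h a ha

theorem genAbove_mul (hm : ∀ {x x' y y'}, x ≤ x' → y ≤ y' → m x y ≤ m x' y') {g : ZMod q → α}
    {k : ℕ} (b c : ZMod q) :
    m (genAbove m g k b) (genAbove m g k c) ≤ genAbove m g k (b + c) := by
  refine le_sInf ?_
  rintro _ ⟨f, hf, hg, rfl⟩
  exact (hm (genAbove_le hf hg b) (genAbove_le hf hg c)).trans (hf b c)

theorem derivedFamily_add (g : ZMod q → α) (i j : ℕ) :
    derivedFamily m g (i + j) = derivedFamily m (derivedFamily m g i) j := by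
  induction j with
  | zero => rfl
  | succ j ih => rw [← add_assoc, derivedFamily, ih]; rfl

theorem derivedFamily_succ_le (hm : ∀ {x x' y y'}, x ≤ x' → y ≤ y' → m x y ≤ m x' y')
    {g : ZMod q → α} (hg : ∀ b c, m (g b) (g c) ≤ g (b + c)) (j : ℕ) (a : ZMod q) :
    derivedFamily m g (j + 1) a ≤ derivedFamily m g j a := by
  induction j generalizing a with
  | zero => exact iSup_le fun b => (hg b (a - b)).trans (by rw [add_sub_cancel]; exact le_rfl)
  | succ j ih => exact iSup_mono fun b => hm (ih b) (ih (a - b))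

theorem derivedFamily_le (hm : ∀ {x x' y y'}, x ≤ x' → y ≤ y' → m x y ≤ m x' y')
    {g : ZMod q → α} (hg : ∀ b c, m (g b) (g c) ≤ g (b + c)) (j : ℕ) (a : ZMod q) :
    derivedFamily m g j a ≤ g a := by
  induction j with
  | zero => exact le_rfl
  | succ j ih => exact (derivedFamily_succ_le hm hg j a).trans ih

theorem derivedFamily_mul (hm : ∀ {x x' y y'}, x ≤ x' → y ≤ y' → m x y ≤ m x' y')
    {g : ZMod q → α} (hg : ∀ b c, m (g b) (g c) ≤ g (b + c)) (j : ℕ) (b c : ZMod q) :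
    m (derivedFamily m g j b) (derivedFamily m g j c) ≤ derivedFamily m g j (b + c) := by
  refine le_trans ?_ (derivedFamily_succ_le hm hg j (b + c))
  refine le_trans ?_ (le_iSup _ b)
  rw [add_sub_cancel_left]

variable [NeZero q]

/-- Kreknin's elimination of components: after `2 ^ k - 1` derivations everything is generated by
the components of degree above `k`. To pass from `k` to `k + 1`, one shows that after `2 ^ k`
derivations the component of degree `k + 1` is already generated by higher ones, and then repeats
the argument for the derived family. -/
theorem derivedFamily_le_genAbove (hm : ∀ {x x' y y'}, x ≤ x' → y ≤ y' → m x y ≤ m x' y')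
    (hbot : ∀ x, m ⊥ x = ⊥) (hsup : ∀ x s, m x (sSup s) = ⨆ y ∈ s, m x y) {τ : α}
    (hjac : ∀ x ≤ τ, ∀ y ≤ τ, ∀ z ≤ τ, m x (m y z) ≤ m (m x y) z ⊔ m (m x z) y) (k : ℕ)
    (hk : k < q) : ∀ (g : ZMod q → α), (∀ b c, m (g b) (g c) ≤ g (b + c)) → g 0 = ⊥ →
      (∀ a, g a ≤ τ) → ∀ a, derivedFamily m g (2 ^ k - 1) a ≤ genAbove m g k a := by
  induction k with
  | zero =>
    intro g hg hg0 _ a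
    by_cases ha : a = 0
    · subst ha
      exact hg0.le.trans bot_le
    · exact le_genAbove (Nat.pos_of_ne_zero fun h => ha ((ZMod.val_eq_zero a).1 h))
  | succ k ih =>
    intro g hg hg0 hgτ a
    replace ih := ih (by omega)
    have hbot' : ∀ x, m x ⊥ = ⊥ := fun x => by simpa using hsup x ∅
    have hqk : ((k + 1 : ℕ) : ZMod q).val = k + 1 := ZMod.val_natCast_of_lt hk
    generalize hK : ((k + 1 : ℕ) : ZMod q) = κ at hqk
    have hval : ∀ {b c : ZMod q}, b + c = κ → b ≠ 0 → c ≠ 0 →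
        (k + 1 < b.val ∧ k + 1 < c.val) ∨ (b.val < k + 1 ∧ c.val < k + 1) := by
      intro b c h hb hc
      have h1 := ZMod.val_add b c
      rw [h, hqk] at h1
      have hb' := ZMod.val_lt b
      have hc' := ZMod.val_lt c
      have hb0 : b.val ≠ 0 := fun h => hb ((ZMod.val_eq_zero b).1 h)
      have hc0 : c.val ≠ 0 := fun h => hc ((ZMod.val_eq_zero c).1 h)
      rcases Nat.lt_or_ge (b.val + c.val) q with h2 | h2
      · rw [Nat.mod_eq_of_lt h2] at h1; omega
      · rw [Nat.mod_eq_sub_mod h2, Nat.mod_eq_of_lt (by omega)] at h1; omega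
    -- `X` shrinks only the component `κ` to its desired bound, and it is stable under right
    -- multiplication by components of degree above `k`.
    let X : ZMod q → α := fun a => if a = κ then genAbove m g (k + 1) κ else g a
    have hgen : ∀ a, genAbove m g (k + 1) a ≤ g a := genAbove_le hg fun _ _ => le_rfl
    have hXg : ∀ a, X a ≤ g a := fun a => by
      by_cases ha : a = κ
      · subst ha; simpa [X] using hgen a
      · simp [X, ha]
    have hX : ∀ a b : ZMod q, k < b.val → m (X a) (g b) ≤ X (a + b) := by
      intro a b hb
      by_cases hab : a + b = κ
      · by_cases ha : a = 0
        · have hX0 : X a = ⊥ := le_bot_iff.1 ((hXg a).trans (by rw [ha, hg0]))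
          rw [hX0, hbot]
          exact bot_le
        · have hb0 : b ≠ 0 := by rintro rfl; simp at hb
          rcases hval hab ha hb0 with h | h
          · have : X (a + b) = genAbove m g (k + 1) (a + b) := by simp [X, hab]
            rw [this]
            exact (hm ((hXg a).trans (le_genAbove h.1)) (le_genAbove h.2)).trans
              (genAbove_mul hm a b)
          · omega
      · have : X (a + b) = g (a + b) := by simp [X, hab]
        rw [this]
        exact (hm (hXg a) le_rfl).trans (hg a b)
    -- `Y` is the right stabiliser of `X`. By the Jacobi inclusion it is closed under products, so
    -- it contains everything generated by degrees above `k`.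
    let Y : ZMod q → α := fun c => sSup {y | y ≤ g c ∧ ∀ a, m (X a) y ≤ X (a + c)}
    have hYg : ∀ c, Y c ≤ g c := fun c => sSup_le fun y hy => hy.1
    have hYX : ∀ a c, m (X a) (Y c) ≤ X (a + c) := by
      intro a c
      simp only [Y, hsup]
      exact iSup₂_le fun y hy => hy.2 a
    have hYmul : ∀ b c, m (Y b) (Y c) ≤ Y (b + c) := by
      intro b c
      refine le_sSup ⟨(hm (hYg b) (hYg c)).trans (hg b c), fun a => ?_⟩
      refine (hjac _ ((hXg a).trans (hgτ a)) _ ((hYg b).trans (hgτ b)) _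
        ((hYg c).trans (hgτ c))).trans (sup_le ?_ ?_)
      · refine (hm (hYX a b) le_rfl).trans ((hYX _ c).trans ?_)
        rw [add_assoc]
      · refine (hm (hYX a c) le_rfl).trans ((hYX _ b).trans ?_)
        rw [add_assoc, add_comm c b]
    have hgenY : ∀ c, genAbove m g k c ≤ Y c := genAbove_le hYmul fun b hb =>
      le_sSup ⟨le_rfl, fun a => hX a b hb⟩
    have hκ0 : κ ≠ 0 := by
      rintro rfl
      simp at hqk
    have key : derivedFamily m g (2 ^ k - 1 + 1) κ ≤ genAbove m g (k + 1) κ := by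
      refine iSup_le fun b => ?_
      have hD := fun c => derivedFamily_le hm hg (2 ^ k - 1) c
      by_cases hb : b = 0
      · have : derivedFamily m g (2 ^ k - 1) b = ⊥ :=
          le_bot_iff.1 ((hD b).trans (by rw [hb, hg0]))
        rw [this, hbot]; exact bot_le
      by_cases hc : κ - b = 0
      · have : derivedFamily m g (2 ^ k - 1) (κ - b) = ⊥ :=
          le_bot_iff.1 ((hD _).trans (by rw [hc, hg0]))
        rw [this, hbot']; exact bot_le
      have hbc : b + (κ - b) = κ := by abel
      rcases hval hbc hb hc with h | h
      · refine (hm ((hD b).trans (le_genAbove h.1)) ((hD _).trans (le_genAbove h.2))).trans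
          ((genAbove_mul hm _ _).trans ?_)
        rw [hbc]
      · have hbκ : b ≠ κ := by rintro rfl; omega
        have hXb : X b = g b := by simp [X, hbκ]
        have hXκ : X κ = genAbove m g (k + 1) κ := by simp [X]
        refine (hm ((hD b).trans hXb.ge) ((ih g hg hg0 hgτ _).trans (hgenY _))).trans
          ((hYX b _).trans ?_)
        rw [hbc, hXκ]
    have e1 : 2 ^ k - 1 + 1 = 2 ^ k := Nat.sub_add_cancel Nat.one_le_two_pow
    have e2 : 2 ^ (k + 1) - 1 = 2 ^ k + (2 ^ k - 1) := by
      rw [pow_succ]; have := Nat.one_le_two_pow (n := k); omega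
    rw [e1] at key
    rw [e2, derivedFamily_add]
    have hH := derivedFamily_le hm hg (2 ^ k)
    refine (ih (derivedFamily m g (2 ^ k)) (derivedFamily_mul hm hg _)
      (le_bot_iff.1 ((hH 0).trans hg0.le)) (fun a => (hH a).trans (hgτ a)) a).trans ?_
    refine genAbove_le (genAbove_mul hm) (fun b hb => ?_) a
    by_cases hbκ : b = κ
    · subst hbκ; exact key
    · have : k + 1 < b.val := by
        refine lt_of_le_of_ne hb fun h => hbκ ?_
        rw [← hqk] at h
        exact (ZMod.val_injective q h).symm
      exact (hH b).trans (le_genAbove this)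

/-- A lattice version of Kreknin's theorem: a family graded by `ZMod q` with trivial zero component
is soluble. -/
theorem derivedFamily_eq_bot (hm : ∀ {x x' y y'}, x ≤ x' → y ≤ y' → m x y ≤ m x' y')
    (hbot : ∀ x, m ⊥ x = ⊥) (hsup : ∀ x s, m x (sSup s) = ⨆ y ∈ s, m x y) {τ : α}
    (hjac : ∀ x ≤ τ, ∀ y ≤ τ, ∀ z ≤ τ, m x (m y z) ≤ m (m x y) z ⊔ m (m x z) y)
    {g : ZMod q → α} (hg : ∀ b c, m (g b) (g c) ≤ g (b + c)) (hg0 : g 0 = ⊥)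
    (hgτ : ∀ a, g a ≤ τ) (a : ZMod q) : derivedFamily m g (2 ^ (q - 1) - 1) a = ⊥ := by
  refine le_bot_iff.1 ((derivedFamily_le_genAbove hm hbot hsup hjac (q - 1)
    (Nat.sub_lt (NeZero.pos q) one_pos) g hg hg0 hgτ a).trans ?_)
  refine genAbove_le (f := fun _ => ⊥) (fun _ _ => (hbot _).le) (fun b hb => ?_) a
  have := ZMod.val_lt b
  omega

end Kreknin

end LieType


namespace LieType

/-! ### Algebras graded by finite sets, with an automorphism. -/

section Multigraded

variable {K : Type*} [Field K] {V : Type*} [AddCommGroup V] [Module K V]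

/-- The product of families of subspaces indexed by finite sets, over all decompositions of the
index into two disjoint parts. -/
def famMul (B : V →ₗ[K] V →ₗ[K] V) (P Q : Finset ℕ → Submodule K V) : Finset ℕ → Submodule K V :=
  fun S => ⨆ T : {T // T ⊆ S}, Submodule.map₂ B (P T) (Q (S \ T))

variable {B : V →ₗ[K] V →ₗ[K] V}

theorem mem_famMul {P Q : Finset ℕ → Submodule K V} {S T : Finset ℕ} (h : T ⊆ S) {u v : V}
    (hu : u ∈ P T) (hv : v ∈ Q (S \ T)) : B u v ∈ famMul B P Q S :=
  Submodule.mem_iSup_of_mem ⟨T, h⟩ (Submodule.apply_mem_map₂ B hu hv)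

theorem famMul_le {P Q : Finset ℕ → Submodule K V} {S : Finset ℕ} {R : Submodule K V}
    (h : ∀ T ⊆ S, ∀ u ∈ P T, ∀ v ∈ Q (S \ T), B u v ∈ R) : famMul B P Q S ≤ R :=
  iSup_le fun T => Submodule.map₂_le.2 (h T.1 T.2)

theorem famMul_mono {P P' Q Q' : Finset ℕ → Submodule K V} (h : P ≤ P') (h' : Q ≤ Q') :
    famMul B P Q ≤ famMul B P' Q' := fun S =>
  iSup_mono fun T => Submodule.map₂_le_map₂ (h T) (h' (S \ T))

theorem famMul_bot (Q : Finset ℕ → Submodule K V) : famMul B ⊥ Q = ⊥ := by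
  refine le_bot_iff.1 fun S => famMul_le fun T _ u hu v _ => ?_
  have : u = 0 := hu
  rw [this, map_zero, LinearMap.zero_apply]
  exact Submodule.zero_mem _

theorem famMul_sSup (P : Finset ℕ → Submodule K V) (s : Set (Finset ℕ → Submodule K V)) :
    famMul B P (sSup s) = ⨆ Q ∈ s, famMul B P Q := by
  refine le_antisymm (fun S => famMul_le fun T hT u hu => ?_)
    (iSup₂_le fun Q hQ => famMul_mono le_rfl (le_sSup hQ))
  suffices (sSup s) (S \ T) ≤ ((⨆ Q ∈ s, famMul B P Q) S).comap (B u) from fun v hv => this hv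
  rw [sSup_apply]
  refine iSup_le fun Q v hv => ?_
  have : famMul B P Q.1 ≤ ⨆ Q ∈ s, famMul B P Q := le_iSup₂_of_le Q.1 Q.2 le_rfl
  exact this S (mem_famMul hT hu hv)

/-- Only an inclusion of subspaces is needed, so the scalars may differ from one triple of index
sets to another. -/
theorem famMul_jacobi {τ : Finset ℕ → Submodule K V}
    (hjac : ∀ S T R : Finset ℕ, Disjoint S T → Disjoint S R → Disjoint T R → ∃ x y : K,
      ∀ u ∈ τ S, ∀ v ∈ τ T, ∀ w ∈ τ R, B u (B v w) = x • B (B u v) w + y • B (B u w) v)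
    (P : Finset ℕ → Submodule K V) (hP : P ≤ τ) (Q : Finset ℕ → Submodule K V) (hQ : Q ≤ τ)
    (R : Finset ℕ → Submodule K V) (hR : R ≤ τ) :
    famMul B P (famMul B Q R) ≤ famMul B (famMul B P Q) R ⊔ famMul B (famMul B P R) Q := by
  intro S
  refine famMul_le fun T hT u hu => ?_
  suffices famMul B Q R (S \ T) ≤ ((famMul B (famMul B P Q) R ⊔
      famMul B (famMul B P R) Q) S).comap (B u) from fun v hv => this hv
  refine famMul_le fun T' hT' v hv w hw => ?_
  rw [Submodule.mem_comap]
  have d1 : Disjoint T T' := Finset.disjoint_of_subset_right hT' Finset.disjoint_sdiff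
  have d2 : Disjoint T ((S \ T) \ T') :=
    Finset.disjoint_of_subset_right Finset.sdiff_subset Finset.disjoint_sdiff
  have d3 : Disjoint T' ((S \ T) \ T') := Finset.disjoint_sdiff
  obtain ⟨x, y, h⟩ := hjac _ _ _ d1 d2 d3
  rw [h u (hP T hu) v (hQ _ hv) w (hR _ hw)]
  have hTS : T' ⊆ S := hT'.trans Finset.sdiff_subset
  refine Submodule.add_mem_sup (Submodule.smul_mem _ _ ?_) (Submodule.smul_mem _ _ ?_)
  · refine mem_famMul (T := T ∪ T') (Finset.union_subset hT hTS)
      (mem_famMul Finset.subset_union_left hu ?_) ?_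
    · rwa [Finset.union_sdiff_cancel_left d1]
    · have : S \ (T ∪ T') = (S \ T) \ T' := sdiff_sdiff_left.symm
      rwa [this]
  · refine mem_famMul (T := T ∪ (S \ T) \ T')
      (Finset.union_subset hT (Finset.sdiff_subset.trans Finset.sdiff_subset))
      (mem_famMul Finset.subset_union_left hu ?_) ?_
    · rwa [Finset.union_sdiff_cancel_left d2]
    · have : S \ (T ∪ (S \ T) \ T') = T' := by
        ext i
        have h1 := @hT' i
        have h2 := @hT i
        simp only [Finset.mem_sdiff, Finset.mem_union] at h1 ⊢
        tauto
      rwa [this]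

/-- The balanced products of `2 ^ j` elements with disjoint indices. -/
def BalProd (B : V →ₗ[K] V →ₗ[K] V) (τ : Finset ℕ → Submodule K V) :
    ℕ → Finset ℕ → V → Prop
  | 0, S, v => v ∈ τ S
  | j + 1, S, v => ∃ T ⊆ S, ∃ a b, BalProd B τ j T a ∧ BalProd B τ j (S \ T) b ∧ v = B a b

/-- Discrete Fourier inversion: the twisted traces `p a` of `v` are eigenvectors, lie in the
invariant subspace `W`, and add up to `q • v`. -/
theorem mem_iSup_eigenspace {Ψ : V →ₗ[K] V} {q : ℕ} [NeZero q] (hΨ : Ψ ^ q = 1) {ω : K}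
    (hω : IsPrimitiveRoot ω q) (hq : (q : K) ≠ 0) {W : Submodule K V} (hW : ∀ v ∈ W, Ψ v ∈ W)
    {v : V} (hv : v ∈ W) :
    v ∈ ⨆ a : ZMod q, W ⊓ Module.End.eigenspace Ψ (ω ^ a.val) := by
  have hω0 : ω ≠ 0 := hω.ne_zero (NeZero.ne q)
  have hpow : ∀ r, (Ψ ^ r) v ∈ W := fun r => by
    induction r with
    | zero => simpa using hv
    | succ r ih => rw [pow_succ', Module.End.mul_apply]; exact hW _ ih
  let p : ℕ → V := fun a => ∑ r ∈ Finset.range q, ((ω ^ a)⁻¹ ^ r) • (Ψ ^ r) v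
  have hp : ∀ a, p a ∈ W ⊓ Module.End.eigenspace Ψ (ω ^ a) := by
    intro a
    refine ⟨Submodule.sum_mem _ fun r _ => Submodule.smul_mem _ _ (hpow r), ?_⟩
    refine Module.End.mem_eigenspace_iff.2 ?_
    have h1 : Ψ (p a) = ω ^ a • ∑ r ∈ Finset.range q, ((ω ^ a)⁻¹ ^ (r + 1)) • (Ψ ^ (r + 1)) v := by
      simp only [p, map_sum, map_smul, Finset.smul_sum]
      refine Finset.sum_congr rfl fun r _ => ?_
      rw [pow_succ' Ψ, Module.End.mul_apply, smul_smul, pow_succ', ← mul_assoc,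
        mul_inv_cancel₀ (pow_ne_zero _ hω0), one_mul]
    have h2 := Finset.sum_range_succ' (fun r => ((ω ^ a)⁻¹ ^ r) • (Ψ ^ r) v) q
    rw [Finset.sum_range_succ] at h2
    have h3 : ((ω ^ a)⁻¹ ^ q) • (Ψ ^ q) v = ((ω ^ a)⁻¹ ^ 0) • (Ψ ^ 0) v := by
      rw [hΨ, inv_pow, ← pow_mul, mul_comm, pow_mul, hω.pow_eq_one]
      simp
    rw [h3, add_right_cancel_iff] at h2
    rw [h1, ← h2]
  have hsum : ∑ a ∈ Finset.range q, p a = (q : K) • v := by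
    simp only [p]
    rw [Finset.sum_comm, Finset.sum_eq_single 0]
    · simp only [pow_zero, one_smul, Module.End.one_apply, Finset.sum_const, Finset.card_range]
      rw [Nat.cast_smul_eq_nsmul]
    · intro r hr hr0
      rw [← Finset.sum_smul]
      have h1 : ∀ a ∈ Finset.range q, (ω ^ a)⁻¹ ^ r = ((ω ^ r)⁻¹) ^ a := fun a _ => by
        rw [inv_pow, inv_pow, ← pow_mul, ← pow_mul, mul_comm]
      rw [Finset.sum_congr rfl h1]
      have h2 : (ω ^ r)⁻¹ - 1 ≠ 0 := by
        rw [sub_ne_zero]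
        intro h
        rw [inv_eq_one] at h
        exact hω.pow_ne_one_of_pos_of_lt hr0 (Finset.mem_range.1 hr) h
      have h3 : (∑ a ∈ Finset.range q, ((ω ^ r)⁻¹) ^ a) * ((ω ^ r)⁻¹ - 1) = 0 := by
        rw [geom_sum_mul, inv_pow, ← pow_mul, mul_comm, pow_mul, hω.pow_eq_one]
        simp
      rw [(mul_eq_zero.1 h3).resolve_right h2, zero_smul]
    · intro h
      exact absurd (Finset.mem_range.2 (NeZero.pos q)) h
  rw [← Submodule.smul_mem_iff _ hq, ← hsum]
  refine Submodule.sum_mem _ fun a ha => ?_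
  refine Submodule.mem_iSup_of_mem (a : ZMod q) ?_
  rw [ZMod.val_natCast_of_lt (Finset.mem_range.1 ha)]
  exact hp a

/-- Balanced products vanish in a multigraded algebra with an automorphism of order `q` without
nontrivial fixed points. -/
theorem balProd_eq_zero {Ψ : V →ₗ[K] V} (hΨB : ∀ u v, Ψ (B u v) = B (Ψ u) (Ψ v)) {q : ℕ}
    [NeZero q] (hΨ : Ψ ^ q = 1) {ω : K} (hω : IsPrimitiveRoot ω q) (hq : (q : K) ≠ 0)
    {τ : Finset ℕ → Submodule K V}
    (hτ : ∀ S T, Disjoint S T → ∀ u ∈ τ S, ∀ v ∈ τ T, B u v ∈ τ (S ∪ T))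
    (hΨτ : ∀ S, ∀ v ∈ τ S, Ψ v ∈ τ S)
    (htr : ∀ S, ∀ v ∈ τ S, ∑ r ∈ Finset.range q, (Ψ ^ r) v = 0)
    (hjac : ∀ S T R : Finset ℕ, Disjoint S T → Disjoint S R → Disjoint T R → ∃ x y : K,
      ∀ u ∈ τ S, ∀ v ∈ τ T, ∀ w ∈ τ R, B u (B v w) = x • B (B u v) w + y • B (B u w) v)
    {S : Finset ℕ} {v : V} (hv : BalProd B τ (2 ^ (q - 1) - 1) S v) : v = 0 := by
  let g : ZMod q → Finset ℕ → Submodule K V := fun a S =>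
    τ S ⊓ Module.End.eigenspace Ψ (ω ^ a.val)
  have hgτ : ∀ a, g a ≤ τ := fun a S => inf_le_left
  have hg : ∀ b c, famMul B (g b) (g c) ≤ g (b + c) := by
    intro b c S
    refine famMul_le fun T hT u hu v hv => ⟨?_, ?_⟩
    · have := hτ T (S \ T) Finset.disjoint_sdiff u hu.1 v hv.1
      rwa [Finset.union_sdiff_of_subset hT] at this
    · have h1 := Module.End.mem_eigenspace_iff.1 hu.2
      have h2 := Module.End.mem_eigenspace_iff.1 hv.2
      refine Module.End.mem_eigenspace_iff.2 ?_
      rw [hΨB, h1, h2, map_smul, map_smul, LinearMap.smul_apply, smul_smul, ← pow_add,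
        ZMod.val_add, ← pow_mod_orderOf, ← hω.eq_orderOf, add_comm c.val]
  -- On a fixed vector the trace is multiplication by `q`, so a fixed vector of trace zero vanishes.
  have hg0 : g 0 = ⊥ := by
    refine le_bot_iff.1 fun S v hv => ?_
    have h1 : Ψ v = v := by
      have := Module.End.mem_eigenspace_iff.1 hv.2
      simpa using this
    have h2 : ∀ r, (Ψ ^ r) v = v := fun r => by
      induction r with
      | zero => simp
      | succ r ih => rw [pow_succ', Module.End.mul_apply, ih, h1]
    have h3 := htr S v hv.1
    simp only [h2, Finset.sum_const, Finset.card_range] at h3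
    rw [← Nat.cast_smul_eq_nsmul K, smul_eq_zero] at h3
    exact h3.resolve_left hq
  have hD := derivedFamily_eq_bot (m := famMul B) (fun h h' => famMul_mono h h') famMul_bot
    famMul_sSup (famMul_jacobi hjac) hg hg0 hgτ
  have key : ∀ j S v, BalProd B τ j S v →
      v ∈ ⨆ a : ZMod q, derivedFamily (famMul B) g j a S := by
    intro j
    induction j with
    | zero =>
      intro S v hv
      exact mem_iSup_eigenspace hΨ hω hq (hΨτ S) hv
    | succ j ih =>
      rintro S _ ⟨T, hT, a, b, ha, hb, rfl⟩
      have := Submodule.apply_mem_map₂ B (ih T a ha) (ih (S \ T) b hb)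
      rw [Submodule.map₂_iSup_left] at this
      simp only [Submodule.map₂_iSup_right] at this
      suffices h : (⨆ c : ZMod q, ⨆ d : ZMod q, Submodule.map₂ B
          (derivedFamily (famMul B) g j c T) (derivedFamily (famMul B) g j d (S \ T))) ≤
          ⨆ a : ZMod q, derivedFamily (famMul B) g (j + 1) a S from h this
      refine iSup_le fun c => iSup_le fun d => ?_
      refine le_trans ?_ (le_iSup _ (c + d))
      refine le_trans ?_ (le_iSup (fun b => famMul B (derivedFamily (famMul B) g j b)
        (derivedFamily (famMul B) g j (c + d - b))) c S)
      rw [add_sub_cancel_left]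
      exact Submodule.map₂_le.2 fun u hu v hv => mem_famMul hT hu hv
  have := key _ S v hv
  simp only [hD] at this
  simpa using this

end Multigraded

end LieType


namespace LieType

open Function (update)

/-! ### Generic evaluation of multilinear functions. -/

section Stages

variable {F : Type*} [Field F] {L : Type*} [AddCommGroup L] [Module F L]

variable (F) in
/-- A function of a family of vectors that depends only on the coordinates in `U` and is linear in
each of them. -/
structure IsMultilinOn (U : Finset ℕ) (p : (ℕ → L) → L) : Prop where
  congr : ∀ z z' : ℕ → L, (∀ i ∈ U, z i = z' i) → p z = p z'
  linear : ∀ (z : ℕ → L), ∀ i ∈ U, IsLinearMap F fun y => p (update z i y)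

/-- Only the last letter of `U` is restricted: `p` is linear in it, and the letters chosen later do
not change `p`. -/
theorem IsMultilinOn.gen {E : Type*} [AddCommGroup E] [Module F E] {N : Nrm F E} {c : ℕ}
    {H : L →ₗ[F] E} (hH : (N.hom L).S c H) {U : Finset ℕ} {p : (ℕ → L) → L}
    (hp : IsMultilinOn F U p) {ℓ : List ℕ} (hℓ : ∃ i ∈ ℓ, i ∈ U) (x : ℕ → L) :
    Gen F c ℓ (fun z => N.S c (H (p z))) x := by
  induction ℓ generalizing x with
  | nil => simp at hℓ
  | cons i ℓ ih =>
    by_cases h : ∃ i ∈ ℓ, i ∈ U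
    · exact ⟨⊤, CodimLE.top.mono le_rfl (Nat.zero_le c), fun y _ => ih h _⟩
    · have hi : i ∈ U := by
        obtain ⟨j, hj, hjU⟩ := hℓ
        rcases List.mem_cons.1 hj with rfl | hj
        exacts [hjU, absurd ⟨j, hj, hjU⟩ h]
      obtain ⟨C, hC, hH⟩ := hH
      refine ⟨C.comap (hp.linear x i hi).mk', hC.comap _, fun y hy => ?_⟩
      refine (Gen.of_forall (P := fun _ => True) (x := update x i y) fun _ => trivial).transfer
        fun z z' _ _ hz' _ => ?_
      have : p z' = p (update x i y) := hp.congr _ _ fun j hj => hz' j fun hj' => h ⟨j, hj', hj⟩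
      rw [this]
      exact hH _ hy

/-- The last coordinate in `U` is chosen before the last coordinate in `V`. -/
def Before (ℓ : List ℕ) (U V : Finset ℕ) : Prop :=
  ∃ b, b <:+ ℓ ∧ (∀ i ∈ b, i ∉ U) ∧ ∃ i ∈ b, i ∈ V

theorem before_total {ℓ : List ℕ} {U V : Finset ℕ} (hUV : Disjoint U V) (hU : ∃ i ∈ ℓ, i ∈ U)
    (hV : ∃ i ∈ ℓ, i ∈ V) : Before ℓ U V ∨ Before ℓ V U := by
  induction ℓ with
  | nil => simp at hU
  | cons i ℓ ih =>
    have key : ∀ U V : Finset ℕ, Disjoint U V → (∃ j ∈ i :: ℓ, j ∈ U) → (∃ j ∈ i :: ℓ, j ∈ V) →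
        (¬ ∃ j ∈ ℓ, j ∈ U) → Before (i :: ℓ) U V := by
      rintro U V hUV ⟨j, hj, hjU⟩ ⟨k, hk, hkV⟩ h
      refine ⟨ℓ, List.suffix_cons i ℓ, fun j hj hjU => h ⟨j, hj, hjU⟩, k, ?_, hkV⟩
      rcases List.mem_cons.1 hj with rfl | hj
      · rcases List.mem_cons.1 hk with rfl | hk
        exacts [absurd hkV (Finset.disjoint_left.1 hUV hjU), hk]
      · exact absurd ⟨j, hj, hjU⟩ h
    by_cases hU' : ∃ j ∈ ℓ, j ∈ U
    · by_cases hV' : ∃ j ∈ ℓ, j ∈ V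
      · refine (ih hU' hV').imp ?_ ?_ <;>
        · rintro ⟨b, hb, h⟩
          exact ⟨b, hb.trans (List.suffix_cons i ℓ), h⟩
      · exact Or.inr (key V U hUV.symm hV hU hV')
    · exact Or.inl (key U V hUV hU hV hU')

/-- The list is cut so that `p` is fixed after the first piece and `q` after the second. The three
nested codimension conditions on `G` are then met one per piece. -/
theorem gen_trilinear {c : ℕ} {G : L →ₗ[F] L →ₗ[F] L →ₗ[F] L}
    (hG : ((((Nrm.exact F L).hom L).hom L).hom L).S c G) {ℓ : List ℕ} {U V W : Finset ℕ}
    (hU : ∃ i ∈ ℓ, i ∈ U) (hUV : Before ℓ U V) (hVW : Before ℓ V W) {p q r : (ℕ → L) → L}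
    (hp : IsMultilinOn F U p) (hq : IsMultilinOn F V q) (hr : IsMultilinOn F W r) (x : ℕ → L) :
    Gen F c ℓ (fun z => G (p z) (q z) (r z) = 0) x := by
  obtain ⟨b, hb, hbU, hbV⟩ := hUV
  obtain ⟨e, he, heV, heW⟩ := hVW
  obtain ⟨d, rfl⟩ : e <:+ b := by
    rcases List.suffix_or_suffix_of_suffix he hb with h | h
    · exact h
    · obtain ⟨i, hi, hiV⟩ := hbV
      exact absurd hiV (heV i (h.subset hi))
  obtain ⟨a, rfl⟩ := hb
  have ha : ∃ i ∈ a, i ∈ U := by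
    obtain ⟨i, hi, hiU⟩ := hU
    exact ⟨i, (List.mem_append.1 hi).resolve_right fun h => hbU i h hiU, hiU⟩
  have hd : ∃ i ∈ d, i ∈ V := by
    obtain ⟨i, hi, hiV⟩ := hbV
    exact ⟨i, (List.mem_append.1 hi).resolve_right fun h => heV i h hiV, hiV⟩
  rw [gen_append]
  refine (hp.gen hG ha x).mono le_rfl fun z hz => ?_
  rw [gen_append]
  refine (hq.gen hz hd z).transfer fun z₁ z₁' h1 h2 h3 h4 => ?_
  obtain rfl : z₁ = z₁' := funext fun i => by
    by_cases hi : i ∈ d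
    · exact h1 i hi
    · rw [h2 i hi, h3 i hi]
  refine (hr.gen h4 heW z₁).transfer fun z₂ z₂' g1 g2 g3 g4 => ?_
  obtain rfl : z₂ = z₂' := funext fun i => by
    by_cases hi : i ∈ e
    · exact g1 i hi
    · rw [g2 i hi, g3 i hi]
  have e1 : p z₂ = p z := hp.congr _ _ fun i hi => by
    rw [g2 i fun h => hbU i (by simp [h]) hi, h2 i fun h => hbU i (by simp [h]) hi]
  have e2 : q z₂ = q z₁ := hq.congr _ _ fun i hi => g2 i fun h => heV i h hi
  rw [e1, e2]
  exact g4

end Stages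

/-! ### Uniform scalars for the Lie type identity. -/

section Relation

variable {F : Type*} [Field F] {L : Type*} [NonUnitalNonAssocRing L] [Module F L]

theorem IsLieType.exists_mul_mul_eq (hL : IsLieType F L) (a b c : L) :
    ∃ x y : F, a * (b * c) = x • ((a * b) * c) + y • ((a * c) * b) := by
  obtain ⟨α, β, hα, h⟩ := hL a b c
  refine ⟨α⁻¹, -(α⁻¹ * β), ?_⟩
  rw [h, smul_add, smul_smul, smul_smul, inv_mul_cancel₀ hα]
  module

theorem exists_gen_relation {X Y Z : L →ₗ[F] L →ₗ[F] L →ₗ[F] L}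
    (h : ∀ a b c, ∃ x y : F, Z a b c = x • X a b c + y • Y a b c) {ℓ : List ℕ} {U V W : Finset ℕ}
    (hU : ∃ i ∈ ℓ, i ∈ U) (hUV : Before ℓ U V) (hVW : Before ℓ V W) :
    ∃ x y : F, ∀ p q r : (ℕ → L) → L, IsMultilinOn F U p → IsMultilinOn F V q →
      IsMultilinOn F W r → ∀ z₀, Gen F (10 ^ 18) ℓ (fun z =>
        Z (p z) (q z) (r z) = x • X (p z) (q z) (r z) + y • Y (p z) (q z) (r z)) z₀ := by
  obtain ⟨x, y, hxy⟩ := Nrm.exists_trilinear_relation X Y Z h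
  refine ⟨x, y, fun p q r hp hq hr z₀ => ?_⟩
  refine (gen_trilinear hxy hU hUV hVW hp hq hr z₀).mono le_rfl fun z hz => ?_
  simp only [LinearMap.sub_apply, LinearMap.smul_apply] at hz
  rw [← sub_eq_zero, ← hz]
  abel

variable [IsScalarTower F L L] [SMulCommClass F L L]

theorem IsLieType.exists_gen_relation (hL : IsLieType F L) {ℓ : List ℕ} {U V W : Finset ℕ}
    (hUV : Disjoint U V) (hUW : Disjoint U W) (hVW : Disjoint V W)
    (hU : ∃ i ∈ ℓ, i ∈ U) (hV : ∃ i ∈ ℓ, i ∈ V) (hW : ∃ i ∈ ℓ, i ∈ W) :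
    ∃ x y : F, ∀ p q r : (ℕ → L) → L, IsMultilinOn F U p → IsMultilinOn F V q →
      IsMultilinOn F W r → ∀ z₀, Gen F (10 ^ 18) ℓ (fun z =>
        p z * (q z * r z) = x • ((p z * q z) * r z) + y • ((p z * r z) * q z)) z₀ := by
  let M := LinearMap.mul F L
  let X : L →ₗ[F] L →ₗ[F] L →ₗ[F] L := (LinearMap.llcomp F L L (L →ₗ[F] L) M) ∘ₗ M
  let Z : L →ₗ[F] L →ₗ[F] L →ₗ[F] L := (LinearMap.lcomp F (L →ₗ[F] L) M) ∘ₗ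
    (LinearMap.llcomp F L L L) ∘ₗ M
  let s : (L →ₗ[F] L →ₗ[F] L →ₗ[F] L) → (L →ₗ[F] L →ₗ[F] L →ₗ[F] L) := fun T =>
    (LinearMap.lflip (R₀ := F)).toLinearMap ∘ₗ T
  have rel : ∀ a b c, ∃ x y : F, Z a b c = x • X a b c + y • s X a b c :=
    fun a b c => hL.exists_mul_mul_eq a b c
  have UV := before_total hUV hU hV
  have UW := before_total hUW hU hW
  have VW := before_total hVW hV hW
  -- The arguments must be taken in the order in which their values become fixed. `s` swaps the last
  -- two arguments and `flip` the first two, which covers all orders.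
  rcases UV with h1 | h1 <;> rcases VW with h2 | h2
  · obtain ⟨x, y, h⟩ := LieType.exists_gen_relation rel hU h1 h2
    exact ⟨x, y, fun p q r hp hq hr z₀ => h p q r hp hq hr z₀⟩
  · rcases UW with h3 | h3
    · obtain ⟨x, y, h⟩ := LieType.exists_gen_relation (Z := s Z) (X := s X) (Y := s (s X))
        (fun a c b => rel a b c) hU h3 h2
      exact ⟨x, y, fun p q r hp hq hr z₀ => h p r q hp hr hq z₀⟩
    · obtain ⟨x, y, h⟩ := LieType.exists_gen_relation (Z := (s Z).flip) (X := (s X).flip)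
        (Y := (s (s X)).flip) (fun c a b => rel a b c) hW h3 h1
      exact ⟨x, y, fun p q r hp hq hr z₀ => h r p q hr hp hq z₀⟩
  · rcases UW with h3 | h3
    · obtain ⟨x, y, h⟩ := LieType.exists_gen_relation (Z := Z.flip) (X := X.flip)
        (Y := (s X).flip) (fun b a c => rel a b c) hV h1 h3
      exact ⟨x, y, fun p q r hp hq hr z₀ => h q p r hq hp hr z₀⟩
    · obtain ⟨x, y, h⟩ := LieType.exists_gen_relation (Z := s Z.flip) (X := s X.flip)
        (Y := s (s X).flip) (fun b c a => rel a b c) hV h2 h3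
      exact ⟨x, y, fun p q r hp hq hr z₀ => h q r p hq hr hp z₀⟩
  · obtain ⟨x, y, h⟩ := LieType.exists_gen_relation (Z := s (s Z).flip) (X := s (s X).flip)
      (Y := s (s (s X)).flip) (fun c b a => rel a b c) hW h2 h1
    exact ⟨x, y, fun p q r hp hq hr z₀ => h r q p hr hq hp z₀⟩

end Relation

end LieType


namespace LieType

open Function (update)

/-! ### Monomials in the images of generic letters. -/

section Monomials

variable {F : Type*} [Field F] {L : Type*} [NonUnitalNonAssocRing L] [Module F L]

/-- The multilinear monomials in the elements `(ψ ^ r) (z i)` with `i < Q`, with their sets of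
variables. -/
inductive IsMonomial (ψ : L →ₗ[F] L) (Q : ℕ) : Finset ℕ → ((ℕ → L) → L) → Prop
  | letter (i r : ℕ) (hi : i < Q) : IsMonomial ψ Q {i} fun z => (ψ ^ r) (z i)
  | mul {U V : Finset ℕ} {p q : (ℕ → L) → L} (hp : IsMonomial ψ Q U p) (hq : IsMonomial ψ Q V q)
    (hUV : Disjoint U V) : IsMonomial ψ Q (U ∪ V) fun z => p z * q z

/-- A finite list that contains all monomials of degree at most `h`. -/
def monomialList (ψ : L →ₗ[F] L) (q Q : ℕ) : ℕ → List (Finset ℕ × ((ℕ → L) → L))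
  | 0 => (List.range Q ×ˢ List.range q).map fun a => ({a.1}, fun z => (ψ ^ a.2) (z a.1))
  | h + 1 => monomialList ψ q Q h ++ (monomialList ψ q Q h ×ˢ monomialList ψ q Q h).map fun a =>
      (a.1.1 ∪ a.2.1, fun z => a.1.2 z * a.2.2 z)

/-- The length of the list of monomials. -/
def monomialCount (q Q : ℕ) : ℕ → ℕ
  | 0 => Q * q
  | h + 1 => monomialCount q Q h + monomialCount q Q h * monomialCount q Q h

variable {ψ : L →ₗ[F] L} {q Q : ℕ}

theorem length_monomialList (h : ℕ) : (monomialList ψ q Q h).length = monomialCount q Q h := by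
  induction h with
  | zero => simp [monomialList, monomialCount, List.length_product]
  | succ h ih => simp [monomialList, monomialCount, ih, List.length_product]

theorem monomialList_subset {h h' : ℕ} (hh : h ≤ h') :
    monomialList ψ q Q h ⊆ monomialList ψ q Q h' := by
  induction hh with
  | refl => exact List.Subset.refl _
  | step _ ih => exact fun a ha => List.subset_append_left _ _ (ih ha)

namespace IsMonomial

variable {U V W : Finset ℕ} {p p' p'' : (ℕ → L) → L}

theorem nonempty (h : IsMonomial ψ Q U p) : U.Nonempty := by
  induction h with
  | letter i r hi => simp
  | mul _ _ _ h _ => exact h.mono Finset.subset_union_left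

theorem lt_of_mem (h : IsMonomial ψ Q U p) : ∀ i ∈ U, i < Q := by
  induction h with
  | letter i r hi => simpa
  | mul _ _ _ h h' =>
    intro i hi
    rcases Finset.mem_union.1 hi with hi | hi
    exacts [h i hi, h' i hi]

theorem card_le (h : IsMonomial ψ Q U p) : U.card ≤ Q := by
  have := Finset.card_le_card (t := Finset.range Q) fun i hi => Finset.mem_range.2 (h.lt_of_mem i hi)
  simpa using this

/-- Exponents of `ψ` count only modulo `q`, and both factors of a product have fewer letters, so
finitely many monomials occur. -/
theorem mem_monomialList [NeZero q] (hψ : ψ ^ q = 1) (h : IsMonomial ψ Q U p) :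
    (U, p) ∈ monomialList ψ q Q U.card := by
  induction h with
  | letter i r hi =>
    refine monomialList_subset (Nat.zero_le _) (List.mem_map.2 ⟨(i, r % q), ?_, ?_⟩)
    · exact List.mem_product.2
        ⟨List.mem_range.2 hi, List.mem_range.2 (Nat.mod_lt _ (NeZero.pos q))⟩
    · have : ψ ^ (r % q) = ψ ^ r := by
        conv_rhs => rw [← Nat.div_add_mod r q, pow_add, pow_mul, hψ, one_pow, one_mul]
      simp only [this]
  | @mul U V p p' hp hq hUV ih ih' =>
    have h1 := Finset.card_pos.2 hp.nonempty
    have h2 := Finset.card_pos.2 hq.nonempty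
    rw [Finset.card_union_of_disjoint hUV]
    refine monomialList_subset (h := U.card + V.card - 1 + 1) (by omega) ?_
    refine List.mem_append_right _ (List.mem_map.2 ⟨((U, p), (V, p')), ?_, rfl⟩)
    exact List.mem_product.2 ⟨monomialList_subset (by omega) ih, monomialList_subset (by omega) ih'⟩

theorem mem_monomialList' [NeZero q] (hψ : ψ ^ q = 1) (h : IsMonomial ψ Q U p) :
    (U, p) ∈ monomialList ψ q Q Q :=
  monomialList_subset h.card_le (h.mem_monomialList hψ)

theorem map (hψ : ∀ x y, ψ (x * y) = ψ x * ψ y) (h : IsMonomial ψ Q U p) :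
    IsMonomial ψ Q U fun z => ψ (p z) := by
  induction h with
  | letter i r hi =>
    have := IsMonomial.letter (ψ := ψ) i (r + 1) hi
    simpa only [pow_succ', Module.End.mul_apply] using this
  | mul _ _ hUV h h' =>
    simp only [hψ]
    exact h.mul h' hUV

variable [IsScalarTower F L L] [SMulCommClass F L L]

theorem isMultilinOn (h : IsMonomial ψ Q U p) : IsMultilinOn F U p := by
  induction h with
  | letter i r hi =>
    refine ⟨fun z z' h => by rw [h i (by simp)], fun z j hj => ?_⟩
    obtain rfl := Finset.mem_singleton.1 hj
    simp only [Function.update_self]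
    exact (ψ ^ r).isLinear
  | @mul U V p p' _ _ hUV h h' =>
    refine ⟨fun z z' hz => ?_, fun z j hj => ?_⟩
    · rw [h.congr z z' fun i hi => hz i (by simp [hi]), h'.congr z z' fun i hi => hz i (by simp [hi])]
    · rcases Finset.mem_union.1 hj with hj | hj
      · have h1 := h.linear z j hj
        have h2 : ∀ y, p' (update z j y) = p' z := fun y => h'.congr _ _ fun i hi =>
          Function.update_of_ne (by rintro rfl; exact Finset.disjoint_left.1 hUV hj hi) _ _
        exact ⟨fun a b => by simp only [h2, h1.map_add, add_mul],
          fun r a => by simp only [h2, h1.map_smul, smul_mul_assoc]⟩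
      · have h1 := h'.linear z j hj
        have h2 : ∀ y, p (update z j y) = p z := fun y => h.congr _ _ fun i hi =>
          Function.update_of_ne (by rintro rfl; exact Finset.disjoint_left.1 hUV hi hj) _ _
        exact ⟨fun a b => by simp only [h2, h1.map_add, mul_add],
          fun r a => by simp only [h2, h1.map_smul, mul_smul_comm]⟩

end IsMonomial

theorem sum_pow_apply_mem_ker (hψ : ψ ^ q = 1) (v : L) :
    (∑ r ∈ Finset.range q, ψ ^ r) v ∈ LinearMap.ker (ψ - 1) := by
  have : (ψ - 1) * ∑ r ∈ Finset.range q, ψ ^ r = 0 := by rw [mul_geom_sum, hψ, sub_self]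
  exact LinearMap.congr_fun this v

/-- The trace maps into the fixed space, so its kernel has codimension at most `m`. -/
theorem hom_sum_pow (hψ : ψ ^ q = 1) {m : ℕ} (hm : Module.rank F (LinearMap.ker (ψ - 1)) ≤ m) :
    ((Nrm.exact F L).hom L).S m (∑ r ∈ Finset.range q, ψ ^ r) := by
  have hfin : Module.Finite F (LinearMap.ker (ψ - 1)) :=
    Module.rank_lt_aleph0_iff.1 (hm.trans_lt Cardinal.natCast_lt_aleph0)
  rw [← Module.finrank_eq_rank, Nat.cast_le] at hm
  refine ⟨LinearMap.ker ((∑ r ∈ Finset.range q, ψ ^ r).codRestrict (LinearMap.ker (ψ - 1))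
    (sum_pow_apply_mem_ker hψ)), CodimLE.of_ker_le hm le_rfl, fun b hb => ?_⟩
  exact congrArg Subtype.val (LinearMap.mem_ker.1 hb)

/-- The conditions on `z` under which the monomials span a graded algebra of Kreknin type. -/
structure IsGood (ψ : L →ₗ[F] L) (q Q : ℕ) (x y : Finset ℕ → Finset ℕ → Finset ℕ → F)
    (z : ℕ → L) : Prop where
  trace : ∀ U p, IsMonomial ψ Q U p → ∑ r ∈ Finset.range q, (ψ ^ r) (p z) = 0
  jacobi : ∀ U V W p p' p'', IsMonomial ψ Q U p → IsMonomial ψ Q V p' → IsMonomial ψ Q W p'' →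
    Disjoint U V → Disjoint U W → Disjoint V W →
    p z * (p' z * p'' z) = x U V W • ((p z * p' z) * p'' z) + y U V W • ((p z * p'' z) * p' z)

variable [IsScalarTower F L L] [SMulCommClass F L L]

/-- The scalars come from the trilinear relation for the product on L and depend only on the letter
sets and the order `ℓ`, not on the monomials. The finitely many conditions for all monomials are
then imposed together. -/
theorem IsLieType.exists_gen_isGood [NeZero q] (hL : IsLieType F L) (hψ : ψ ^ q = 1) {m : ℕ}
    (hm : Module.rank F (LinearMap.ker (ψ - 1)) ≤ m) {ℓ : List ℕ} (hℓ : ∀ i < Q, i ∈ ℓ) :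
    ∃ x y : Finset ℕ → Finset ℕ → Finset ℕ → F, ∀ z₀ : ℕ → L,
      Gen F (monomialCount q Q Q * m + monomialCount q Q Q ^ 3 * 10 ^ 18) ℓ
        (IsGood ψ q Q x y) z₀ := by
  have meets : ∀ {U p}, IsMonomial ψ Q U p → ∃ i ∈ ℓ, i ∈ U := fun h => by
    obtain ⟨i, hi⟩ := h.nonempty
    exact ⟨i, hℓ i (h.lt_of_mem i hi), hi⟩
  have rel : ∀ U V W : Finset ℕ, ∃ x y : F, ∀ p p' p'', IsMonomial ψ Q U p →
      IsMonomial ψ Q V p' → IsMonomial ψ Q W p'' → Disjoint U V → Disjoint U W → Disjoint V W →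
      ∀ z₀ : ℕ → L, Gen F (10 ^ 18) ℓ (fun z =>
        p z * (p' z * p'' z) = x • ((p z * p' z) * p'' z) + y • ((p z * p'' z) * p' z)) z₀ := by
    intro U V W
    by_cases h : (Disjoint U V ∧ Disjoint U W ∧ Disjoint V W) ∧ (∃ i ∈ ℓ, i ∈ U) ∧
        (∃ i ∈ ℓ, i ∈ V) ∧ ∃ i ∈ ℓ, i ∈ W
    · obtain ⟨⟨h1, h2, h3⟩, h4, h5, h6⟩ := h
      obtain ⟨x, y, h⟩ := hL.exists_gen_relation h1 h2 h3 h4 h5 h6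
      exact ⟨x, y, fun p p' p'' hp hp' hp'' _ _ _ => h p p' p'' hp.isMultilinOn
        hp'.isMultilinOn hp''.isMultilinOn⟩
    · exact ⟨0, 0, fun p p' p'' hp hp' hp'' h1 h2 h3 =>
        absurd ⟨⟨h1, h2, h3⟩, meets hp, meets hp', meets hp''⟩ h⟩
  choose x y hxy using rel
  refine ⟨x, y, fun z₀ => ?_⟩
  let A := monomialList ψ q Q Q
  have g1 := Gen.forall_list (F := F) (c := m) (ℓ := ℓ) (x := z₀) A
    (P := fun a z => IsMonomial ψ Q a.1 a.2 → ∑ r ∈ Finset.range q, (ψ ^ r) (a.2 z) = 0) (by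
      intro a _
      by_cases ha : IsMonomial ψ Q a.1 a.2
      · refine (ha.isMultilinOn.gen (hom_sum_pow hψ hm) (meets ha) z₀).mono le_rfl fun z hz _ => ?_
        rw [← LinearMap.sum_apply]
        exact hz
      · exact Gen.of_forall fun z h => absurd h ha)
  have g2 := Gen.forall_list (F := F) (c := 10 ^ 18) (ℓ := ℓ) (x := z₀) (A ×ˢ (A ×ˢ A))
    (P := fun a z => IsMonomial ψ Q a.1.1 a.1.2 → IsMonomial ψ Q a.2.1.1 a.2.1.2 →
      IsMonomial ψ Q a.2.2.1 a.2.2.2 → Disjoint a.1.1 a.2.1.1 → Disjoint a.1.1 a.2.2.1 →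
      Disjoint a.2.1.1 a.2.2.1 → a.1.2 z * (a.2.1.2 z * a.2.2.2 z) =
        x a.1.1 a.2.1.1 a.2.2.1 • ((a.1.2 z * a.2.1.2 z) * a.2.2.2 z) +
        y a.1.1 a.2.1.1 a.2.2.1 • ((a.1.2 z * a.2.2.2 z) * a.2.1.2 z)) (by
      rintro ⟨⟨U, p⟩, ⟨V, p'⟩, ⟨W, p''⟩⟩ _
      by_cases ha : (IsMonomial ψ Q U p ∧ IsMonomial ψ Q V p' ∧ IsMonomial ψ Q W p'') ∧
          Disjoint U V ∧ Disjoint U W ∧ Disjoint V W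
      · exact (hxy U V W p p' p'' ha.1.1 ha.1.2.1 ha.1.2.2 ha.2.1 ha.2.2.1 ha.2.2.2 z₀).mono le_rfl
          fun z hz _ _ _ _ _ _ => hz
      · exact Gen.of_forall fun z h1 h2 h3 h4 h5 h6 => absurd ⟨⟨h1, h2, h3⟩, h4, h5, h6⟩ ha)
  refine (g1.and g2).mono ?_ ?_
  · rw [List.length_product, List.length_product, length_monomialList]
    apply le_of_eq; ring
  · rintro z ⟨h1, h2⟩
    refine ⟨fun U p hp => h1 (U, p) (hp.mem_monomialList' hψ) hp, ?_⟩
    intro U V W p p' p'' hp hp' hp''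
    exact h2 ((U, p), (V, p'), (W, p'')) (List.mem_product.2 ⟨hp.mem_monomialList' hψ,
      List.mem_product.2 ⟨hp'.mem_monomialList' hψ, hp''.mem_monomialList' hψ⟩⟩) hp hp' hp''

end Monomials

end LieType


namespace LieType

/-! ### Vanishing of balanced monomials in good letters. -/

/-- The complete binary tree of height `k` with consecutive labels from `o` on. -/
def bal : ℕ → ℕ → Tr
  | 0, o => .leaf o
  | k + 1, o => .node (bal k o) (bal k (o + 2 ^ k))

theorem leaves_bal (k o : ℕ) : (bal k o).leaves = List.range' o (2 ^ k) := by
  induction k generalizing o with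
  | zero => rfl
  | succ k ih =>
    rw [bal, Tr.leaves, ih, ih, pow_succ, mul_two]
    simp

section BaseChange

open TensorProduct

variable {F : Type*} [Field F] {L : Type*} [NonUnitalNonAssocRing L] [Module F L]
  [IsScalarTower F L L] [SMulCommClass F L L]

variable (F) in
theorem balProd_evl {K : Type*} [Field K] [Algebra F K]
    {τ : Finset ℕ → Submodule K (K ⊗[F] L)} {z : ℕ → L} {Q : ℕ}
    (hτ : ∀ i < Q, (1 : K) ⊗ₜ[F] z i ∈ τ {i}) {k o : ℕ} (ho : o + 2 ^ k ≤ Q) {f : (ℕ → L) → L} (hf : f ∈ evl L (bal k o)) :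
    BalProd (LinearMap.BilinMap.baseChange K (LinearMap.mul F L)) τ k
      (Finset.Ico o (o + 2 ^ k)) ((1 : K) ⊗ₜ[F] f z) := by
  induction k generalizing o f with
  | zero =>
    rw [bal, mem_evl_leaf] at hf
    subst hf
    simpa [BalProd] using hτ o ho
  | succ k ih =>
    obtain ⟨g, hg, h, hh, hf⟩ := mem_evl_node.1 hf
    have e1 : Finset.Ico o (o + 2 ^ (k + 1)) \ Finset.Ico o (o + 2 ^ k) =
        Finset.Ico (o + 2 ^ k) (o + 2 ^ k + 2 ^ k) := by
      ext i
      simp only [Finset.mem_sdiff, Finset.mem_Ico, pow_succ]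
      omega
    have e2 : Finset.Ico o (o + 2 ^ (k + 1)) \ Finset.Ico (o + 2 ^ k) (o + 2 ^ k + 2 ^ k) =
        Finset.Ico o (o + 2 ^ k) := by
      ext i
      simp only [Finset.mem_sdiff, Finset.mem_Ico, pow_succ]
      omega
    have hk : 2 ^ (k + 1) = 2 ^ k + 2 ^ k := by rw [pow_succ, mul_two]
    have hpos : 0 ≤ 2 ^ k := Nat.zero_le _
    have ihg := ih (o := o) (by omega) hg
    have ihh := ih (o := o + 2 ^ k) (by omega) hh
    rcases hf with rfl | rfl
    · exact ⟨Finset.Ico o (o + 2 ^ k), Finset.Ico_subset_Ico le_rfl (by omega),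
        (1 : K) ⊗ₜ g z, (1 : K) ⊗ₜ h z, ihg, by rwa [e1], by simp⟩
    · exact ⟨Finset.Ico (o + 2 ^ k) (o + 2 ^ k + 2 ^ k),
        Finset.Ico_subset_Ico (by omega) (by omega),
        (1 : K) ⊗ₜ h z, (1 : K) ⊗ₜ g z, ihh, by rwa [e2], by simp⟩

/-- The algebraic closure supplies a primitive `q`-th root of unity. The relations are known only
for monomials, and they extend linearly to the spans `τ S`, which serve as graded components.
Vanishing descends because L embeds into its base change. -/
theorem IsGood.evl_eq_zero {ψ : L →ₗ[F] L} (hψmul : ∀ x y, ψ (x * y) = ψ x * ψ y) {q Q : ℕ}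
    [NeZero q] (hψ : ψ ^ q = 1) (hq : (q : F) ≠ 0) {x y : Finset ℕ → Finset ℕ → Finset ℕ → F}
    {z : ℕ → L} (hz : IsGood ψ q Q x y z) (hQ : 2 ^ (2 ^ (q - 1) - 1) ≤ Q)
    {f : (ℕ → L) → L} (hf : f ∈ evl L (bal (2 ^ (q - 1) - 1) 0)) : f z = 0 := by
  let K := AlgebraicClosure F
  have hqK : (q : K) ≠ 0 := by
    rw [← map_natCast (algebraMap F K)]
    exact (map_ne_zero _).2 hq
  have : NeZero (q : K) := ⟨hqK⟩
  obtain ⟨ω, hω⟩ := HasEnoughRootsOfUnity.exists_primitiveRoot K q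
  let B := LinearMap.BilinMap.baseChange K (LinearMap.mul F L)
  have hB : ∀ u v : L, B ((1 : K) ⊗ₜ u) ((1 : K) ⊗ₜ v) = (1 : K) ⊗ₜ[F] (u * v) := fun u v => by
    simp [B]
  let Ψ : K ⊗[F] L →ₗ[K] K ⊗[F] L := ψ.baseChange K
  have hΨ1 : ∀ (r : ℕ) (u : L), (Ψ ^ r) ((1 : K) ⊗ₜ u) = (1 : K) ⊗ₜ[F] (ψ ^ r) u := by
    intro r u
    rw [← LinearMap.baseChange_pow, LinearMap.baseChange_tmul]
  have hΨ2 : ∀ u : L, Ψ ((1 : K) ⊗ₜ u) = (1 : K) ⊗ₜ[F] ψ u := fun u => by simp [Ψ]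
  let G : Finset ℕ → Set (K ⊗[F] L) := fun S => {w | ∃ p, IsMonomial ψ Q S p ∧ (1 : K) ⊗ₜ p z = w}
  let τ : Finset ℕ → Submodule K (K ⊗[F] L) := fun S => Submodule.span K (G S)
  have hττ : ∀ S T, Disjoint S T → ∀ u ∈ τ S, ∀ v ∈ τ T, B u v ∈ τ (S ∪ T) := by
    intro S T hST u hu v hv
    have := Submodule.apply_mem_map₂ B hu hv
    rw [Submodule.map₂_span_span] at this
    refine Submodule.span_mono ?_ this
    rintro _ ⟨_, ⟨p, hp, rfl⟩, _, ⟨p', hp', rfl⟩, rfl⟩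
    exact ⟨_, hp.mul hp' hST, (hB _ _).symm⟩
  have hΨτ : ∀ S, ∀ v ∈ τ S, Ψ v ∈ τ S := by
    intro S v hv
    have := Submodule.mem_map_of_mem (f := Ψ) hv
    rw [Submodule.map_span] at this
    refine Submodule.span_mono ?_ this
    rintro _ ⟨_, ⟨p, hp, rfl⟩, rfl⟩
    exact ⟨_, hp.map hψmul, (hΨ2 _).symm⟩
  have htr : ∀ S, ∀ v ∈ τ S, ∑ r ∈ Finset.range q, (Ψ ^ r) v = 0 := by
    intro S v hv
    rw [← LinearMap.sum_apply, ← LinearMap.mem_ker]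
    refine Submodule.span_le.2 ?_ hv
    rintro _ ⟨p, hp, rfl⟩
    rw [SetLike.mem_coe, LinearMap.mem_ker, LinearMap.sum_apply]
    simp only [hΨ1]
    rw [← tmul_sum, hz.trace S p hp, tmul_zero]
  have hjac : ∀ S T R : Finset ℕ, Disjoint S T → Disjoint S R → Disjoint T R → ∃ x y : K,
      ∀ u ∈ τ S, ∀ v ∈ τ T, ∀ w ∈ τ R, B u (B v w) = x • B (B u v) w + y • B (B u w) v := by
    intro S T R h1 h2 h3
    refine ⟨algebraMap F K (x S T R), algebraMap F K (y S T R), fun u hu v hv w hw => ?_⟩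
    induction hu using Submodule.span_induction with
    | zero => simp
    | add u u' _ _ h h' => simp only [map_add, LinearMap.add_apply, h, h']; module
    | smul a u _ h => simp only [map_smul, LinearMap.smul_apply, h]; module
    | mem u hu =>
      induction hv using Submodule.span_induction with
      | zero => simp
      | add u u' _ _ h h' => simp only [map_add, LinearMap.add_apply, h, h']; module
      | smul a u _ h => simp only [map_smul, LinearMap.smul_apply, h]; module
      | mem v hv =>
        induction hw using Submodule.span_induction with
        | zero => simp
        | add u u' _ _ h h' => simp only [map_add, LinearMap.add_apply, h, h']; module
        | smul a u _ h => simp only [map_smul, LinearMap.smul_apply, h]; module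
        | mem w hw =>
          obtain ⟨p, hp, rfl⟩ := hu
          obtain ⟨p', hp', rfl⟩ := hv
          obtain ⟨p'', hp'', rfl⟩ := hw
          simp only [hB, algebraMap_smul]
          rw [hz.jacobi S T R p p' p'' hp hp' hp'' h1 h2 h3, tmul_add, tmul_smul, tmul_smul]
  have hΨB : ∀ u v, Ψ (B u v) = B (Ψ u) (Ψ v) := by
    intro u v
    induction u with
    | zero => simp
    | add u u' h h' => simp only [map_add, LinearMap.add_apply, h, h']
    | tmul a u =>
      induction v with
      | zero => simp
      | add v v' h h' => simp only [map_add, h, h']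
      | tmul b v => simp [B, Ψ, hψmul]
  have hΨq : Ψ ^ q = 1 := by
    rw [← LinearMap.baseChange_pow, hψ, LinearMap.baseChange_one]
  have hlet : ∀ i < Q, (1 : K) ⊗ₜ[F] z i ∈ τ {i} := fun i hi =>
    Submodule.subset_span ⟨_, IsMonomial.letter i 0 hi, by simp⟩
  have := balProd_eq_zero hΨB hΨq hω hqK hττ hΨτ htr hjac
    (balProd_evl F hlet (by omega) hf)
  exact Module.FaithfullyFlat.tensorProduct_mk_injective (A := F) (B := K) L
    (by simpa using this)

end BaseChange

end LieType


namespace LieType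

universe u v

/-! ### Removing the characteristic from the order. -/

section Fixed

variable {F : Type*} [Field F] {V : Type*} [AddCommGroup V] [Module F V]

/-- `N ^ j` maps the kernel of `N ^ (j + 1)` into that of `N`, and what it kills there lies in the
kernel of `N ^ j`. -/
theorem rank_ker_pow_le (N : V →ₗ[F] V) (j : ℕ) :
    Module.rank F (LinearMap.ker (N ^ j)) ≤ j * Module.rank F (LinearMap.ker N) := by
  induction j with
  | zero =>
    have : LinearMap.ker (N ^ 0) = ⊥ := by rw [pow_zero]; exact LinearMap.ker_id
    rw [this, rank_bot]
    exact zero_le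
  | succ j ih =>
    let f : LinearMap.ker (N ^ (j + 1)) →ₗ[F] LinearMap.ker N :=
      ((N ^ j).comp (LinearMap.ker (N ^ (j + 1))).subtype).codRestrict _ fun x => by
        have h : (N * N ^ j) x.1 = 0 := by
          rw [← pow_succ']
          exact x.2
        exact h
    have h1 := LinearMap.rank_range_add_rank_ker f
    have h2 : Module.rank F (LinearMap.range f) ≤ Module.rank F (LinearMap.ker N) :=
      Submodule.rank_le _
    let g : LinearMap.ker f →ₗ[F] LinearMap.ker (N ^ j) :=
      ((LinearMap.ker (N ^ (j + 1))).subtype.comp (LinearMap.ker f).subtype).codRestrict _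
        fun x => congrArg Subtype.val (LinearMap.mem_ker.1 x.2)
    have h3 : Module.rank F (LinearMap.ker f) ≤ Module.rank F (LinearMap.ker (N ^ j)) :=
      LinearMap.rank_le_of_injective g fun x y h =>
        by
        have h' : (g x).1 = (g y).1 := by rw [h]
        exact Subtype.ext (Subtype.ext h')
    rw [← h1, Nat.cast_succ, add_mul, one_mul, add_comm]
    exact add_le_add (h3.trans ih) h2

/-- The Frobenius identity in F[X], evaluated at `φ`. -/
theorem pow_expChar_pow_sub_one (p : ℕ) [ExpChar F p] (φ : V →ₗ[F] V) (s : ℕ) :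
    φ ^ p ^ s - 1 = (φ - 1) ^ p ^ s := by
  have h := sub_pow_expChar_pow (p := p) (Polynomial.X : Polynomial F) 1 s
  simpa using (congrArg (Polynomial.aeval φ) h).symm

variable (F) in
theorem exists_eq_pow_mul {n : ℕ} (hn : 0 < n) (p : ℕ) [hp : ExpChar F p] :
    ∃ s q : ℕ, n = p ^ s * q ∧ (q : F) ≠ 0 := by
  cases hp with
  | zero => exact ⟨0, n, by simp, Nat.cast_ne_zero.2 hn.ne'⟩
  | prime hp =>
    obtain ⟨s, q, hq, h⟩ := Nat.exists_eq_pow_mul_and_not_dvd hn.ne' p hp.ne_one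
    exact ⟨s, q, h, fun h0 => hq ((CharP.cast_eq_zero_iff F p q).1 h0)⟩

end Fixed

/-! ### Conclusion. -/

section Main

variable {F : Type*} [Field F] {L : Type*} [NonUnitalNonAssocRing L] [Module F L]

/-- The codimension of the genericity conditions for an automorphism of order prime to the
characteristic. -/
def krekninCodim (q m : ℕ) : ℕ :=
  monomialCount q (2 ^ (2 ^ (q - 1) - 1)) (2 ^ (2 ^ (q - 1) - 1)) * m +
    monomialCount q (2 ^ (2 ^ (q - 1) - 1)) (2 ^ (2 ^ (q - 1) - 1)) ^ 3 * 10 ^ 18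

theorem IsLieType.hyp_bal [IsScalarTower F L L] [SMulCommClass F L L] (hL : IsLieType F L)
    {ψ : L →ₗ[F] L} (hψmul : ∀ x y, ψ (x * y) = ψ x * ψ y) {q : ℕ} [NeZero q] (hψ : ψ ^ q = 1)
    (hq : (q : F) ≠ 0) {m : ℕ} (hm : Module.rank F (LinearMap.ker (ψ - 1)) ≤ m) :
    Hyp (bal (2 ^ (q - 1) - 1) 0) (Nrm.exact F L) (krekninCodim q m) := by
  intro ℓ hℓ x₀
  obtain ⟨x, y, h⟩ := hL.exists_gen_isGood hψ hm (Q := 2 ^ (2 ^ (q - 1) - 1)) (ℓ := ℓ)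
    fun i hi => hℓ.mem_iff.2 (by rw [leaves_bal]; simpa using hi)
  exact (h x₀).mono le_rfl fun z hz f hf => hz.evl_eq_zero hψmul hψ hq le_rfl hf

theorem inv_exact : (Nrm.exact F L).Inv 1 := by
  intro c d hd l
  obtain rfl : d = 0 := hd
  exact ⟨zero_mul l, mul_zero l⟩

theorem toLinearMap_pow (φ : L ≃ₗ[F] L) (k : ℕ) :
    ((φ ^ k : L ≃ₗ[F] L) : L →ₗ[F] L) = (φ : L →ₗ[F] L) ^ k :=
  map_pow LinearEquiv.automorphismGroup.toLinearMapMonoidHom φ k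

theorem IsAlgAut.pow_apply_mul {φ : L ≃ₗ[F] L} (hφ : IsAlgAut φ) (k : ℕ) (x y : L) :
    ((φ : L →ₗ[F] L) ^ k) (x * y) = ((φ : L →ₗ[F] L) ^ k) x * ((φ : L →ₗ[F] L) ^ k) y := by
  induction k with
  | zero => simp
  | succ k ih => simp only [pow_succ', Module.End.mul_apply, ih, LinearEquiv.coe_coe, hφ _ _]

theorem IsAlgAut.exists_coprime_power {φ : L ≃ₗ[F] L} (hφ : IsAlgAut φ) {n m : ℕ} (hn : 0 < n)
    (hord : orderOf φ = n) (hm : Module.rank F (fixedSubalgebra φ hφ) = (m : Cardinal)) :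
    ∃ (ψ : L →ₗ[F] L) (q : ℕ), (∀ x y, ψ (x * y) = ψ x * ψ y) ∧ ψ ^ q = 1 ∧ (q : F) ≠ 0 ∧ q ≤ n ∧
      Module.rank F (LinearMap.ker (ψ - 1)) ≤ ((n * m : ℕ) : Cardinal) := by
  obtain ⟨p, hp⟩ := ExpChar.exists F
  obtain ⟨s, q, hsq, hq⟩ := exists_eq_pow_mul F hn p
  have hps : p ^ s ≤ n := by
    rw [hsq]
    exact Nat.le_mul_of_pos_right _ (Nat.pos_of_ne_zero fun h => hq (by simp [h]))
  have hqn : q ≤ n := by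
    rw [hsq]
    exact Nat.le_mul_of_pos_left _ (Nat.pos_of_ne_zero fun h => by simp [h] at hsq; omega)
  have hker : Module.rank F (LinearMap.ker ((φ : L →ₗ[F] L) - 1)) ≤ m := by
    rw [← hm]
    let g : LinearMap.ker ((φ : L →ₗ[F] L) - 1) →ₗ[F] fixedSubalgebra φ hφ :=
      { toFun := fun x => ⟨x.1, sub_eq_zero.1 (LinearMap.mem_ker.1 x.2)⟩
        map_add' := fun _ _ => rfl
        map_smul' := fun _ _ => rfl }
    exact LinearMap.rank_le_of_injective g fun x y h => by
      have h' : (g x).1 = (g y).1 := by rw [h]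
      exact Subtype.ext h'
  refine ⟨(φ : L →ₗ[F] L) ^ p ^ s, q, hφ.pow_apply_mul _, ?_, hq, hqn, ?_⟩
  · rw [← pow_mul, ← hsq, ← hord, ← toLinearMap_pow, pow_orderOf_eq_one]
    rfl
  · rw [pow_expChar_pow_sub_one p]
    refine (rank_ker_pow_le _ _).trans ?_
    rw [Nat.cast_mul]
    exact mul_le_mul' (Nat.cast_le.2 hps) hker

end Main

theorem exists_codim_len : ∃ (codim : ℕ → ℕ → ℕ) (len : ℕ → ℕ),
    ∀ (F : Type u) (L : Type v) [Field F] [NonUnitalNonAssocRing L] [Module F L]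
      [IsScalarTower F L L] [SMulCommClass F L L], IsLieType F L →
      ∀ (n m : ℕ) (φ : L ≃ₗ[F] L) (hφ : IsAlgAut φ), 0 < n → orderOf φ = n →
        Module.rank F (fixedSubalgebra φ hφ) = (m : Cardinal) →
        ∃ I : Submodule F L, IsIdeal I ∧ Module.rank F (L ⧸ I) ≤ (codim n m : Cardinal) ∧
          derived I (len n) = ⊥ := by
  have hRT : ∀ q, RT.{u, v} (bal (2 ^ (q - 1) - 1) 0) := fun q =>
    rt_of_nodup _ (by rw [leaves_bal]; exact List.nodup_range')
  choose K hK using hRT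
  choose c r hcr using fun q m => hK q 1 (krekninCodim q m)
  -- The part `q` of the order depends on the characteristic, so the bounds are maximised over all
  -- `q ≤ n`; the fixed space of `ψ` has dimension at most `n * m`.
  refine ⟨fun n m => (Finset.range (n + 1)).sup fun q => r q (n * m),
    fun n => (Finset.range (n + 1)).sup K, ?_⟩
  intro F L _ _ _ _ _ hL n m φ hφ hn hord hm
  obtain ⟨ψ, q, hψmul, hψ, hq, hqn, hker⟩ := hφ.exists_coprime_power hn hord hm
  have : NeZero q := ⟨fun h => hq (by simp [h])⟩
  have hmem : q ∈ Finset.range (n + 1) := Finset.mem_range.2 (by omega)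
  obtain ⟨I, hI, hIr, hIK⟩ := hcr q (n * m) F L hL (Nrm.exact F L) inv_exact
    (hL.hyp_bal hψmul hψ hq hker)
  refine ⟨I, hI, codimLE_iff_rank.1 (hIr.mono le_rfl
    (Finset.le_sup (f := fun q => r q (n * m)) hmem)), ?_⟩
  have h0 : derived I (K q) = ⊥ := by
    rw [← span_pure, Submodule.span_eq_bot]
    exact fun d hd => hIK d hd
  exact le_bot_iff.1 (h0 ▸ derived_antitone hL hI (Finset.le_sup hmem))

end LieType

theorem theorem1 :
    ∃ (codim : ℕ → ℕ → ℕ) (len : ℕ → ℕ),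
      ∀ (F : Type*) (L : Type*) [Field F] [NonUnitalNonAssocRing L] [Module F L]
        [IsScalarTower F L L] [SMulCommClass F L L],
        LieType.IsLieType F L →
        ∀ (n m : ℕ) (φ : L ≃ₗ[F] L) (hφ : LieType.IsAlgAut φ),
          0 < n → orderOf φ = n →
          Module.rank F (LieType.fixedSubalgebra φ hφ) = (m : Cardinal) →
          ∃ I : Submodule F L, LieType.IsIdeal I ∧
            Module.rank F (L ⧸ I) ≤ (codim n m : Cardinal) ∧
            LieType.derived I (len n) = ⊥ := by
  exact LieType.exists_codim_len
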